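/- Let $c\in L^\infty(\mathbb R)$ be a.e. nonnegative and compactly supported, let $H=L^2(\mathbb R\times[-1,1])$, and let $K$ be the isotropic collision operator $(Kf)(x,\mu)=\frac12\int_{-1}^1 f(x,\mu')\,d\mu'$. Let $L=i\mu\,\partial_x-i\,c(x)K$ on the domain of all $f\in H$ such that $f(\cdot,\mu)$ is locally absolutely continuous for a.e. $\mu$ and $\mu\,\partial_x f\in H$. Put $T=L^*$ and $V=\operatorname{Im}T=c(x)K$, let $E=\overline{\operatorname{Ran}V}$ (identified with the space of functions in $L^2(\mathbb R)$ vanishing a.e. where $c=0$, via $u\mapsto u(x)$), and let $$S(z)=I+2i\sqrt V\,(T^*-z)^{-1}\sqrt V:\ E\to E,\qquad \operatorname{Im}z>0,$$ be the characteristic function of $T$; for real $k$, $S(k)$ denotes the strong nontangential boundary value of $S$ at $k$. Let $Y$ be the integral operator in $E$ with kernel $\frac12\sqrt{c(x)}\,(\gamma+\ln|x-y|)\sqrt{c(y)}$, where $\gamma$ is Euler's constant, and let $$\mathrm N=\{u\in\ker(I+Y):\ \langle u,\sqrt c\rangle=0\}.$$ (1) There are $\delta>0$ and $C$ (depending on $c$)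 such that for all $z$ with $\operatorname{Im}z>0$ and $|z|\le\delta$ the operator $S(z)$ is boundedly invertible and $\|S^{-1}(z)\|\le C/|z|$. (2) If $\mathrm N\neq\{0\}$, then $0$ is a spectral singularity of $T$ of first order in the strict sense, and for every $h\in\mathrm N$ the boundary values $S(k)$ exist for all sufficiently small real $k\ne0$ and $\|S(k)h\|=O(|k|)$ as $k\to0$. Here a real point $k_0$ is a spectral singularity if it is not proper, and it is proper if for some $\delta>0$ the function $S_e^{-1}$ is bounded in $\{\operatorname{Im}z>0,\ |z-k_0|\le\delta\}$, where $S=S_iS_e$ is the canonical factorization of $S$ in the upper half-plane ($S_i,S_e$ contractive analytic $\mathbf B(E)$-valued functions, $S_i(k)$ isometric for a.e. real $k$, and $S_eH^2_+(E)$ dense in the Hardy class $H^2_+(E)$). A spectral singularity $k_0$ is of order $p>0$ in the strict sense if $\|S^{-1}(k)\|\le C|k-k_0|^{-p}$ for a.e. real $k$ in a neighbourhood of $k_0$, and there are a nonzero $e_0\in E$ and a constant $C_1$ with $\|S(k)e_0\|\le C_1|k-k_0|^{p}$ for a.e. real $k$. -/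

import Mathlib

open MeasureTheory Filter Topology
open scoped ENNReal LinearPMap

noncomputable section

namespace SlabTransport

/-! ### Analytic operator functions in the upper half-plane -/

section AnalyticFunctions

variable {E : Type*} [NormedAddCommGroup E] [InnerProductSpace ℂ E]

/-- The open upper half-plane `ℂ₊`, as a subset of `ℂ`. -/
def upperHalf : Set ℂ := {z | 0 < z.im}

/-- The set `ω_δ(k) = {z ∈ ℂ₊ : |z - k| ≤ δ}`. -/
def halfDisc (δ : ℝ) (k : ℝ) : Set ℂ := {z | 0 < z.im ∧ ‖z - k‖ ≤ δ}

/-- The Stolz angle `{z ∈ ℂ₊ : |Re z - k| ≤ a Im z}` with vertex `k`. -/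
def stolzAngle (a k : ℝ) : Set ℂ := {z | 0 < z.im ∧ |z.re - k| ≤ a * z.im}

/-- `A` is the nontangential boundary value `Φ(k) = Φ(k + i0)`, in the strong operator topology,
of the operator function `Φ` at the real point `k`. -/
def HasBoundaryValue (Φ : ℂ → E →L[ℂ] E) (k : ℝ) (A : E →L[ℂ] E) : Prop :=
  ∀ a : ℝ, 0 < a → ∀ h : E,
    Tendsto (fun z => Φ z h) (𝓝[stolzAngle a k] (k : ℂ)) (𝓝 (A h))

/-- The function is analytic in `ℂ₊` and its values there are contractions. -/
def IsContractiveAnalytic (Φ : ℂ → E →L[ℂ] E) : Prop :=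
  DifferentiableOn ℂ Φ upperHalf ∧ ∀ z ∈ upperHalf, ‖Φ z‖ ≤ 1

/-- The square of the norm in the Hardy class `H²₊(E)`:
`sup_{ε > 0} ∫ ‖f(k + iε)‖² dk`. -/
def hardyNormSq (f : ℂ → E) : ℝ≥0∞ :=
  ⨆ (ε : ℝ) (_ : 0 < ε), ∫⁻ k : ℝ, ‖f (k + ε * Complex.I)‖ₑ ^ 2

/-- The Hardy class `H²₊(E)`. -/
def MemHardy (f : ℂ → E) : Prop :=
  DifferentiableOn ℂ f upperHalf ∧ hardyNormSq f < ∞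

/-- For a bounded analytic operator function `Φ`: the set `Φ H²₊(E)` is dense in `H²₊(E)`. -/
def IsOuter (Φ : ℂ → E →L[ℂ] E) : Prop :=
  ∀ f : ℂ → E, MemHardy f → ∀ ε : ℝ≥0∞, 0 < ε →
    ∃ g : ℂ → E, MemHardy g ∧ hardyNormSq (fun z => f z - Φ z (g z)) < ε

/-- The boundary values of `Φ` on the real axis exist and are isometric almost everywhere. -/
def HasIsometricBoundaryValues (Φ : ℂ → E →L[ℂ] E) : Prop :=
  ∀ᵐ k : ℝ, ∃ A : E →L[ℂ] E, HasBoundaryValue Φ k A ∧ ∀ h : E, ‖A h‖ = ‖h‖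

/-- `S = Si Se` is the canonical factorization of the contractive analytic function `S`. -/
structure IsCanonicalFactorization (S Si Se : ℂ → E →L[ℂ] E) : Prop where
  contractive_inner : IsContractiveAnalytic Si
  contractive_outer : IsContractiveAnalytic Se
  isometric : HasIsometricBoundaryValues Si
  outer : IsOuter Se
  factor : ∀ z ∈ upperHalf, S z = Si z ∘L Se z

/-- `k` is a proper point: the inverse of the outer factor `Se` of `S` is bounded in `ω_δ(k)` for
some `δ > 0`. (The canonical factorization is unique up to a constant unitary factor, which does
not affect the norm of the inverse of `Se`.) -/
def IsProperPoint (S : ℂ → E →L[ℂ] E) (k : ℝ) : Prop :=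
  ∃ Si Se : ℂ → E →L[ℂ] E, IsCanonicalFactorization S Si Se ∧
    ∃ δ : ℝ, 0 < δ ∧ ∃ C : ℝ, ∀ z ∈ halfDisc δ k,
      IsUnit (Se z) ∧ ‖Ring.inverse (Se z)‖ ≤ C

/-- For an operator with characteristic function `S`: a spectral singularity is a real point that
is not proper. -/
def IsSpectralSingularity (S : ℂ → E →L[ℂ] E) (k : ℝ) : Prop :=
  ¬ IsProperPoint S k

/-- For an operator with characteristic function `S`: the point `k₀` is a spectral singularity of
order `p > 0` in the strict sense. -/
structure IsStrictSpectralSingularityOfOrder (S : ℂ → E →L[ℂ] E) (k₀ p : ℝ) : Prop where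
  order_pos : 0 < p
  singular : IsSpectralSingularity S k₀
  inverse_bound : ∃ δ : ℝ, 0 < δ ∧ ∃ C : ℝ, ∀ᵐ k : ℝ, |k - k₀| < δ →
    ∃ A : E →L[ℂ] E, HasBoundaryValue S k A ∧ IsUnit A ∧
      ‖Ring.inverse A‖ ≤ C * |k - k₀| ^ (-p)
  sharp : ∃ e₀ : E, e₀ ≠ 0 ∧ ∃ C₁ : ℝ, ∀ᵐ k : ℝ,
    ∃ A : E →L[ℂ] E, HasBoundaryValue S k A ∧ ‖A e₀‖ ≤ C₁ * |k - k₀| ^ p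

end AnalyticFunctions

/-! ### The characteristic function of a dissipative operator -/

section CharacteristicFunction

variable {H : Type*} [NormedAddCommGroup H] [InnerProductSpace ℂ H]

/-- `R` is the bounded everywhere defined inverse of `A - z`. -/
def IsResolventAt (A : H →ₗ.[ℂ] H) (z : ℂ) (R : H →L[ℂ] H) : Prop :=
  (∀ f : H, ∃ u : A.domain, (u : H) = R f ∧ A u - z • (u : H) = f) ∧
    ∀ u : A.domain, R (A u - z • (u : H)) = u

open Classical in
/-- The resolvent `(A - z)⁻¹` of a partially defined operator; it is set to `0` when `z` is not in
the resolvent set of `A`. -/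
def resolventOp (A : H →ₗ.[ℂ] H) (z : ℂ) : H →L[ℂ] H :=
  if h : ∃ R : H →L[ℂ] H, IsResolventAt A z R then h.choose else 0

/-- The subspace `E`, the closure of the range of `V`. -/
abbrev defectSpace (V : H →L[ℂ] H) : Submodule ℂ H :=
  V.range.topologicalClosure

variable [CompleteSpace H]

/-- The range of `√V` lies in `E`. -/
theorem sqrt_apply_mem_defectSpace {V : H →L[ℂ] H} (hV : 0 ≤ V) (x : H) :
    CFC.sqrt V x ∈ defectSpace V := by
  have hVs : IsSelfAdjoint V := IsSelfAdjoint.of_nonneg hV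
  have hs : IsSelfAdjoint (CFC.sqrt V) := IsSelfAdjoint.of_nonneg (CFC.sqrt_nonneg V)
  have hmul : CFC.sqrt V * CFC.sqrt V = V := CFC.sqrt_mul_sqrt_self V hV
  have key : ∀ y ∈ (V.range)ᗮ, CFC.sqrt V y = 0 := by
    intro y hy
    have h1 : inner ℂ (V y) y = (0 : ℂ) := (Submodule.mem_orthogonal _ _).1 hy _ ⟨y, rfl⟩
    have h2 : inner ℂ (CFC.sqrt V y) (CFC.sqrt V y) = (0 : ℂ) := by
      have h3 := ContinuousLinearMap.adjoint_inner_left (CFC.sqrt V) y (CFC.sqrt V y)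
      have h4 : CFC.sqrt V (CFC.sqrt V y) = V y := congrArg (fun W : H →L[ℂ] H => W y) hmul
      rw [← ContinuousLinearMap.star_eq_adjoint, hs.star_eq, h4, h1] at h3
      exact h3.symm
    exact inner_self_eq_zero.1 h2
  rw [defectSpace, ← Submodule.orthogonal_orthogonal_eq_closure, Submodule.mem_orthogonal]
  intro y hy
  have := ContinuousLinearMap.adjoint_inner_left (CFC.sqrt V) x y
  rw [← ContinuousLinearMap.star_eq_adjoint, hs.star_eq, key y hy, inner_zero_left] at this
  exact this.symm

/-- The characteristic function `S(z) = I + 2i √V (T* - z)⁻¹ √V : E → E` of a maximal dissipative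
operator `T` with bounded imaginary part `V`. As `√V` maps into `E`, the orthogonal
projection onto `E` only restricts the codomain. -/
def characteristicFunction (T : H →ₗ.[ℂ] H) (V : H →L[ℂ] H) (z : ℂ) :
    defectSpace V →L[ℂ] defectSpace V :=
  1 + (2 * Complex.I) • ((defectSpace V).orthogonalProjectionOnto ∘L
    (CFC.sqrt V ∘L resolventOp T† z ∘L CFC.sqrt V) ∘L (defectSpace V).subtypeL)

end CharacteristicFunction

/-! ### The transport operator for a slab, isotropic scattering -/

/-- Lebesgue measure on `Ω = [-1, 1]`. -/
def angleMeasure : Measure ℝ := volume.restrict (Set.Icc (-1) 1)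

instance : IsFiniteMeasure angleMeasure := by
  unfold angleMeasure; infer_instance

theorem angleMeasure_univ : angleMeasure Set.univ = 2 := by
  simp [angleMeasure]; norm_num

/-- Lebesgue measure on the phase space `ℝ × Ω`. -/
def slabMeasure : Measure (ℝ × ℝ) := (volume : Measure ℝ).prod angleMeasure

/-- The Hilbert space `H = L²(ℝ × [-1, 1])`; its elements are functions of `(x, μ)`. -/
abbrev Slab : Type := Lp ℂ 2 slabMeasure

/-- The relation `w = iμ ∂ₓu`, where for almost every `μ` the function `u(·, μ)` is absolutely
continuous on every bounded interval. -/
def IsFreeTransport (u w : Slab) : Prop :=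
  ∀ᵐ μ ∂angleMeasure, ∃ g : ℝ → ℂ, (∀ a b : ℝ, AbsolutelyContinuousOnInterval g a b) ∧
    (∀ᵐ x : ℝ, u (x, μ) = g x) ∧ ∀ᵐ x : ℝ, w (x, μ) = Complex.I * μ * deriv g x

theorem ae_ae_of_ae_slab {p : ℝ × ℝ → Prop} (h : ∀ᵐ q ∂slabMeasure, p q) :
    ∀ᵐ μ ∂angleMeasure, ∀ᵐ x : ℝ, p (x, μ) := by
  have h' : ∀ᵐ q ∂(angleMeasure.prod (volume : Measure ℝ)), p q.swap := by
    have := (Measure.measurePreserving_swap (μ := angleMeasure)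
      (ν := (volume : Measure ℝ))).quasiMeasurePreserving
    exact this.ae h
  exact Measure.ae_ae_of_ae_prod h'

theorem ae_differentiableAt_of_absolutelyContinuous {g : ℝ → ℂ}
    (hg : ∀ a b : ℝ, AbsolutelyContinuousOnInterval g a b) :
    ∀ᵐ x : ℝ, DifferentiableAt ℝ g x := by
  have h : LocallyBoundedVariationOn g Set.univ := by
    intro a b _ _
    refine ((hg a b).boundedVariationOn).mono ?_
    rintro x ⟨-, hx⟩
    exact Set.Icc_subset_uIcc hx
  exact h.ae_differentiableAt

/-- The graph of `L₀ = iμ ∂ₓ`. -/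
def freeTransportGraph : Submodule ℂ (Slab × Slab) where
  carrier := {p | IsFreeTransport p.1 p.2}
  zero_mem' := by
    have h0 := ae_ae_of_ae_slab (Lp.coeFn_zero ℂ 2 slabMeasure)
    filter_upwards [h0] with μ hμ
    refine ⟨fun _ => 0, fun a b => ?_, ?_, ?_⟩
    · simpa [AbsolutelyContinuousOnInterval] using tendsto_const_nhds
    · filter_upwards [hμ] with x hx
      simpa using hx
    · filter_upwards [hμ] with x hx
      simpa using hx
  add_mem' := by
    rintro ⟨u, w⟩ ⟨u', w'⟩ h h'
    filter_upwards [h, h', ae_ae_of_ae_slab (Lp.coeFn_add u u'),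
      ae_ae_of_ae_slab (Lp.coeFn_add w w')] with μ ⟨g, hg, hu, hw⟩ ⟨g', hg', hu', hw'⟩ h1 h2
    refine ⟨fun x => g x + g' x, fun a b => (hg a b).add (hg' a b), ?_, ?_⟩
    · filter_upwards [hu, hu', h1] with x a1 a2 a3
      simpa [a1, a2] using a3
    · filter_upwards [hw, hw', h2, ae_differentiableAt_of_absolutelyContinuous hg,
        ae_differentiableAt_of_absolutelyContinuous hg'] with x a1 a2 a3 a4 a5
      have : deriv (fun x => g x + g' x) x = deriv g x + deriv g' x := deriv_add a4 a5
      rw [this, mul_add, ← a1, ← a2]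
      simpa using a3
  smul_mem' := by
    rintro r ⟨u, w⟩ h
    filter_upwards [h, ae_ae_of_ae_slab (Lp.coeFn_smul r u),
      ae_ae_of_ae_slab (Lp.coeFn_smul r w)] with μ ⟨g, hg, hu, hw⟩ h1 h2
    refine ⟨fun x => r • g x, fun a b => (hg a b).const_smul r, ?_, ?_⟩
    · filter_upwards [hu, h1] with x a1 a2
      simpa [a1] using a2
    · filter_upwards [hw, h2] with x a1 a2
      have : deriv (fun x => r • g x) x = r • deriv g x := by simp
      rw [this]
      simp only [Prod.smul_snd, a2, Pi.smul_apply, a1, smul_eq_mul]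
      ring

/-- `iμ ∂ₓu` is determined by `u`. -/
theorem freeTransportGraph_functional (p : Slab × Slab) (hp : p ∈ freeTransportGraph)
    (h0 : p.1 = 0) : p.2 = 0 := by
  obtain ⟨u, w⟩ := p
  simp only at h0
  subst h0
  have key : ∀ᵐ μ ∂angleMeasure, ∀ᵐ x : ℝ, w (x, μ) = 0 := by
    filter_upwards [hp, ae_ae_of_ae_slab (Lp.coeFn_zero ℂ 2 slabMeasure)]
      with μ ⟨g, hg, hu, hw⟩ h1
    have hcont : Continuous g := by
      rw [continuous_iff_continuousAt]
      intro x
      have := (hg (x - 1) (x + 1)).continuousOn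
      refine this.continuousAt ?_
      rw [Set.uIcc_of_le (by linarith)]
      exact Icc_mem_nhds (by linarith) (by linarith)
    have hae : g =ᵐ[volume] fun _ => (0 : ℂ) := by
      filter_upwards [hu, h1] with x a1 a2
      exact a1.symm.trans a2
    have hz : g = fun _ => (0 : ℂ) := hcont.ae_eq_iff_eq volume continuous_const |>.1 hae
    filter_upwards [hw] with x hx
    simpa [hz] using hx
  have hw : StronglyMeasurable (w : ℝ × ℝ → ℂ) := Lp.stronglyMeasurable w
  have hset : MeasurableSet {q : ℝ × ℝ | w q = 0} :=
    hw.measurable (measurableSet_singleton (0 : ℂ))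
  have h2 : ∀ᵐ q ∂(angleMeasure.prod (volume : Measure ℝ)), w q.swap = 0 :=
    (Measure.ae_prod_iff_ae_ae (p := fun q : ℝ × ℝ => w q.swap = 0)
      (measurable_swap hset)).2 key
  have h3 : ∀ᵐ q ∂slabMeasure, w q = 0 := by
    have := (Measure.measurePreserving_swap (μ := (volume : Measure ℝ))
      (ν := angleMeasure)).quasiMeasurePreserving.ae h2
    exact this
  exact (Lp.eq_zero_iff_ae_eq_zero).2 h3

/-- The operator `L₀ = iμ ∂ₓ`, on the domain of all `u ∈ H` such that `u(·, μ)` is absolutely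
continuous for almost every `μ` and `μ ∂ₓu ∈ H`. -/
def freeTransport : Slab →ₗ.[ℂ] Slab := freeTransportGraph.toLinearPMap

theorem freeTransport_graph : freeTransport.graph = freeTransportGraph :=
  Submodule.toLinearPMap_graph_eq _ freeTransportGraph_functional

theorem enorm_average_sq_le {g : ℝ → ℂ} (hg : AEStronglyMeasurable g angleMeasure) :
    ‖(1 / 2 : ℂ) * ∫ μ, g μ ∂angleMeasure‖ₑ ^ 2 * 2 ≤ ∫⁻ μ, ‖g μ‖ₑ ^ 2 ∂angleMeasure := by
  have h1 : ‖∫ μ, g μ ∂angleMeasure‖ₑ ≤ eLpNorm g 1 angleMeasure := by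
    rw [eLpNorm_one_eq_lintegral_enorm]
    exact enorm_integral_le_lintegral_enorm _
  have h2 := eLpNorm_le_eLpNorm_mul_rpow_measure_univ (p := 1) (q := 2) (by norm_num) hg
  rw [angleMeasure_univ] at h2
  have h3 : eLpNorm g 2 angleMeasure ^ 2 = ∫⁻ μ, ‖g μ‖ₑ ^ 2 ∂angleMeasure := by
    have := eLpNorm_nnreal_pow_eq_lintegral (f := g) (μ := angleMeasure) (p := 2) (by norm_num)
    simpa using this
  have h4 : ((2 : ℝ≥0∞) ^ (1 / (1 : ℝ≥0∞).toReal - 1 / (2 : ℝ≥0∞).toReal)) ^ 2 = 2 := by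
    rw [← ENNReal.rpow_natCast, ← ENNReal.rpow_mul]
    norm_num
  have h5 : ‖∫ μ, g μ ∂angleMeasure‖ₑ ^ 2 ≤ (∫⁻ μ, ‖g μ‖ₑ ^ 2 ∂angleMeasure) * 2 := by
    calc _ ≤ (eLpNorm g 2 angleMeasure
            * 2 ^ (1 / (1 : ℝ≥0∞).toReal - 1 / (2 : ℝ≥0∞).toReal)) ^ 2 := by
          gcongr; exact h1.trans h2
      _ = _ := by rw [mul_pow, h3, h4]
  have h6 : ‖(1 / 2 : ℂ)‖ₑ ^ 2 * 2 * 2 = 1 := by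
    have : ‖(1 / 2 : ℂ)‖ₑ = (2 : ℝ≥0∞)⁻¹ := by
      rw [one_div, enorm_inv (by norm_num)]
      congr 1
      rw [← ofReal_norm]
      simp
    rw [this, sq, mul_assoc, mul_assoc, ← mul_assoc _ (2 : ℝ≥0∞) 2,
      ENNReal.inv_mul_cancel (by norm_num) (by norm_num), one_mul,
      ENNReal.inv_mul_cancel (by norm_num) (by norm_num)]
  calc _ = ‖(1 / 2 : ℂ)‖ₑ ^ 2 * 2 * ‖∫ μ, g μ ∂angleMeasure‖ₑ ^ 2 := by
        rw [enorm_mul, mul_pow]; ring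
    _ ≤ ‖(1 / 2 : ℂ)‖ₑ ^ 2 * 2 * ((∫⁻ μ, ‖g μ‖ₑ ^ 2 ∂angleMeasure) * 2) := by gcongr
    _ = (‖(1 / 2 : ℂ)‖ₑ ^ 2 * 2 * 2) * ∫⁻ μ, ‖g μ‖ₑ ^ 2 ∂angleMeasure := by ring
    _ = _ := by rw [h6, one_mul]

/-- The function `(x, μ) ↦ ½ ∫_{-1}^{1} f(x, μ') dμ'`. -/
def angleAverage (f : ℝ × ℝ → ℂ) : ℝ × ℝ → ℂ :=
  fun q => (1 / 2 : ℂ) * ∫ μ, f (q.1, μ) ∂angleMeasure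

theorem aestronglyMeasurable_angleAverage {f : ℝ × ℝ → ℂ}
    (hf : AEStronglyMeasurable f slabMeasure) :
    AEStronglyMeasurable (angleAverage f) slabMeasure := by
  have h : AEStronglyMeasurable (fun x : ℝ => ∫ μ, f (x, μ) ∂angleMeasure) volume :=
    hf.integral_prod_right'
  exact (h.comp_quasiMeasurePreserving
    (Measure.quasiMeasurePreserving_fst (μ := (volume : Measure ℝ)) (ν := angleMeasure))).const_mul _

theorem eLpNorm_angleAverage_le {f : ℝ × ℝ → ℂ} (hf : AEStronglyMeasurable f slabMeasure) :
    eLpNorm (angleAverage f) 2 slabMeasure ≤ eLpNorm f 2 slabMeasure := by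
  have hsq : ∀ F : ℝ × ℝ → ℂ, eLpNorm F 2 slabMeasure ^ 2 = ∫⁻ q, ‖F q‖ₑ ^ 2 ∂slabMeasure := by
    intro F
    have := eLpNorm_nnreal_pow_eq_lintegral (f := F) (μ := slabMeasure) (p := 2) (by norm_num)
    simpa using this
  have hm : ∀ F : ℝ × ℝ → ℂ, AEStronglyMeasurable F slabMeasure →
      ∫⁻ q, ‖F q‖ₑ ^ 2 ∂slabMeasure = ∫⁻ x, ∫⁻ μ, ‖F (x, μ)‖ₑ ^ 2 ∂angleMeasure := by
    intro F hF
    exact lintegral_prod _ (hF.enorm.pow_const 2)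
  have hle : eLpNorm (angleAverage f) 2 slabMeasure ^ 2 ≤ eLpNorm f 2 slabMeasure ^ 2 := by
    rw [hsq, hsq, hm _ (aestronglyMeasurable_angleAverage hf), hm _ hf]
    refine lintegral_mono_ae ?_
    filter_upwards [hf.prodMk_left] with x hx
    have : ∫⁻ μ, ‖angleAverage f (x, μ)‖ₑ ^ 2 ∂angleMeasure
        = ‖(1 / 2 : ℂ) * ∫ μ, f (x, μ) ∂angleMeasure‖ₑ ^ 2 * 2 := by
      simp [angleAverage, angleMeasure_univ]
    rw [this]
    exact enorm_average_sq_le hx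
  exact (ENNReal.pow_le_pow_left_iff (by norm_num)).1 hle

theorem memLp_angleAverage {f : ℝ × ℝ → ℂ} (hf : MemLp f 2 slabMeasure) :
    MemLp (angleAverage f) 2 slabMeasure :=
  ⟨aestronglyMeasurable_angleAverage hf.1, (eLpNorm_angleAverage_le hf.1).trans_lt hf.2⟩

theorem angleAverage_congr {f g : ℝ × ℝ → ℂ} (h : f =ᵐ[slabMeasure] g) :
    angleAverage f =ᵐ[slabMeasure] angleAverage g := by
  have h1 : ∀ᵐ x : ℝ, ∀ᵐ μ ∂angleMeasure, f (x, μ) = g (x, μ) := Measure.ae_ae_of_ae_prod h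
  have h2 : ∀ᵐ x : ℝ, ∫ μ, f (x, μ) ∂angleMeasure = ∫ μ, g (x, μ) ∂angleMeasure := by
    filter_upwards [h1] with x hx
    exact integral_congr_ae hx
  have h3 := (Measure.quasiMeasurePreserving_fst (μ := (volume : Measure ℝ))
    (ν := angleMeasure)).ae h2
  filter_upwards [h3] with q hq
  simp only [angleAverage, hq]

theorem ae_integrable_section (f : Slab) :
    ∀ᵐ q ∂slabMeasure, Integrable (fun μ => f (q.1, μ)) angleMeasure := by
  have hf := Lp.memLp f
  have hfin : ∫⁻ x, ∫⁻ μ, ‖f (x, μ)‖ₑ ^ 2 ∂angleMeasure < ∞ := by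
    have h1 : ∫⁻ q, ‖f q‖ₑ ^ 2 ∂slabMeasure < ∞ := by
      have := eLpNorm_nnreal_pow_eq_lintegral (f := f) (μ := slabMeasure) (p := 2) (by norm_num)
      have h2 : eLpNorm f 2 slabMeasure ^ 2 = ∫⁻ q, ‖f q‖ₑ ^ 2 ∂slabMeasure := by simpa using this
      rw [← h2]
      exact ENNReal.pow_lt_top hf.2
    have h3 : ∫⁻ q, ‖f q‖ₑ ^ 2 ∂slabMeasure = ∫⁻ x, ∫⁻ μ, ‖f (x, μ)‖ₑ ^ 2 ∂angleMeasure :=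
      lintegral_prod _ (hf.1.enorm.pow_const 2)
    rwa [h3] at h1
  have hae : ∀ᵐ x : ℝ, ∫⁻ μ, ‖f (x, μ)‖ₑ ^ 2 ∂angleMeasure < ∞ :=
    ae_lt_top' ((hf.1.enorm.pow_const 2).lintegral_prod_right') hfin.ne
  have h3 : ∀ᵐ x : ℝ, Integrable (fun μ => f (x, μ)) angleMeasure := by
    filter_upwards [hae, hf.1.prodMk_left] with x hx hm
    have : MemLp (fun μ => f (x, μ)) 2 angleMeasure := by
      refine ⟨hm, ?_⟩
      have := eLpNorm_nnreal_pow_eq_lintegral (f := fun μ => f (x, μ)) (μ := angleMeasure)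
        (p := 2) (by norm_num)
      have h2 : eLpNorm (fun μ => f (x, μ)) 2 angleMeasure ^ 2
          = ∫⁻ μ, ‖f (x, μ)‖ₑ ^ 2 ∂angleMeasure := by simpa using this
      rw [← h2] at hx
      exact (ENNReal.pow_lt_top_iff.1 hx).resolve_right (by norm_num)
    exact this.integrable (by norm_num)
  exact (Measure.quasiMeasurePreserving_fst (μ := (volume : Measure ℝ)) (ν := angleMeasure)).ae h3

/-- The collision operator `K` of isotropic scattering,
`(K f)(x, μ) = ½ ∫_{-1}^{1} f(x, μ') dμ'`. -/
def collision : Slab →L[ℂ] Slab :=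
  LinearMap.mkContinuous
    { toFun := fun f => (memLp_angleAverage (Lp.memLp f)).toLp (angleAverage f)
      map_add' := by
        intro f g
        rw [← MemLp.toLp_add]
        refine MemLp.toLp_congr _ _ ((angleAverage_congr (Lp.coeFn_add f g)).trans ?_)
        filter_upwards [ae_integrable_section f, ae_integrable_section g] with q hf hg
        simp only [angleAverage, Pi.add_apply]
        rw [integral_add hf hg, mul_add]
      map_smul' := by
        intro r f
        rw [RingHom.id_apply, ← MemLp.toLp_const_smul]
        refine MemLp.toLp_congr _ _ ((angleAverage_congr (Lp.coeFn_smul r f)).trans ?_)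
        refine Eventually.of_forall fun q => ?_
        simp only [angleAverage, Pi.smul_apply, smul_eq_mul]
        rw [integral_const_mul]
        ring }
    1 (by
      intro f
      rw [one_mul]
      simp only [LinearMap.coe_mk, AddHom.coe_mk, Lp.norm_toLp]
      rw [Lp.norm_def]
      exact ENNReal.toReal_mono (Lp.memLp f).2.ne (eLpNorm_angleAverage_le (Lp.memLp f).1))

theorem coeFn_collision (f : Slab) :
    collision f =ᵐ[slabMeasure] fun q => (1 / 2 : ℂ) * ∫ μ, f (q.1, μ) ∂angleMeasure :=
  MemLp.coeFn_toLp (memLp_angleAverage (Lp.memLp f))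

variable (c : Lp ℝ ∞ (volume : Measure ℝ))

theorem memLp_coefficient : MemLp (fun q : ℝ × ℝ => (c q.1 : ℂ)) ∞ slabMeasure := by
  have hq := Measure.quasiMeasurePreserving_fst (μ := (volume : Measure ℝ)) (ν := angleMeasure)
  have hc := (Lp.memLp c).ofReal (K := ℂ)
  refine ⟨hc.1.comp_quasiMeasurePreserving hq, ?_⟩
  have h : ∀ᵐ x : ℝ, ‖(c x : ℂ)‖ₑ ≤ eLpNorm (fun x => (c x : ℂ)) ∞ volume := by
    rw [eLpNorm_exponent_top]
    exact ae_le_eLpNormEssSup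
  rw [eLpNorm_exponent_top]
  exact (essSup_le_of_ae_le _ (hq.ae h)).trans_lt hc.2

/-- Multiplication by `c(x)` in `H`. -/
def multiplication : Slab →L[ℂ] Slab :=
  (ContinuousLinearMap.mul ℂ ℂ).holderL slabMeasure ∞ 2 2 (memLp_coefficient c).toLp

theorem coeFn_multiplication (f : Slab) :
    multiplication c f =ᵐ[slabMeasure] fun q => (c q.1 : ℂ) * f q := by
  have h := (ContinuousLinearMap.mul ℂ ℂ).coeFn_holder (r := 2) (memLp_coefficient c).toLp f
  filter_upwards [h, MemLp.coeFn_toLp (memLp_coefficient c)] with q h1 h2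
  change (ContinuousLinearMap.mul ℂ ℂ).holder 2 (memLp_coefficient c).toLp f q = _
  rw [h1, h2]
  simp

/-- The bounded operator `V = c(x) K` in `H`. -/
def imaginaryPart : Slab →L[ℂ] Slab := multiplication c ∘L collision

/-- The transport operator `L = iμ ∂ₓ - i c(x) K` on the domain of `L₀`. -/
def transportOperator : Slab →ₗ.[ℂ] Slab :=
  (-(Complex.I • imaginaryPart c) : Slab →L[ℂ] Slab).toLinearMap +ᵥ freeTransport

/-- The dissipative operator `T = L* = iμ ∂ₓ + i c(x) K`, with imaginary part `V = c(x) K`. -/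
def dissipativeOperator : Slab →ₗ.[ℂ] Slab := (transportOperator c)†

/-- The closure `E` of the range of `V`. Its elements are the functions in `H` that do not depend
on `μ` and vanish outside the set `{c ≠ 0}`. -/
abbrev scatteringSpace : Submodule ℂ Slab := defectSpace (imaginaryPart c)

/-- The characteristic function of `T`. -/
def scatteringCharFun (z : ℂ) : scatteringSpace c →L[ℂ] scatteringSpace c :=
  characteristicFunction (dissipativeOperator c) (imaginaryPart c) z

/-- The kernel `½ √c(x) (γ + ln |x - y|) √c(y)` of the integral operator `Y`. -/
def kernelY (x y : ℝ) : ℝ :=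
  1 / 2 * √(c x) * (Real.eulerMascheroniConstant + Real.log |x - y|) * √(c y)

/-- The subspace `N = {u ∈ ker (I + Y) : ⟨u, √c⟩ = 0}` of `E`, where a function `u` of `x` is
identified with the function `(x, μ) ↦ u(x)`. -/
def exceptionalVectors : Set (scatteringSpace c) :=
  {h | ∃ u : ℝ → ℂ, MemLp u 2 volume ∧
    ((h : Slab) : ℝ × ℝ → ℂ) =ᵐ[slabMeasure] (fun q => u q.1) ∧
    (∀ᵐ x : ℝ, u x + ∫ y, (kernelY c x y : ℂ) * u y = 0) ∧
    ∫ x, u x * (√(c x) : ℂ) = 0}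

end SlabTransport

end

/-! Put L₀ = iμ∂ₓ and B(z) = -i√V (L₀ - z)⁻¹ √V, restricted to E. The free operator L₀ is
selfadjoint, so T* = L₀ - iV. The resolvent identity then shows that S is the Cayley transform of B
for Im z > 0, S = (I - B)(I + B)⁻¹ (`characteristicFunction_mul`). Dissipativity gives Re B ≥ 0,
hence (I + B)⁻¹ is a contraction. Since S⁻¹ = 2(I - B)⁻¹ - I, both claims reduce to the behaviour of
I - B(z) near z = 0.

Integration along characteristics and over directions identifies B(z) with the integral operator
with kernel ½√c(x) E₁(-iz|x - y|)√c(y) (`sandwich_eq_convOp`). From E₁(s) = -γ - log s + Ein(s) one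
gets I - B(z) = I + Y + ¼ log(-iz)⟨·, √c⟩√c - ½G(z), with the inner product of H, which is twice
that of L²(ℝ). Here G(z)/z → -iD as z → 0, where D has kernel √c(x)|x - y|√c(y). The formula also
makes sense for real z ≠ 0 and is norm continuous there, so S has boundary values at every real k ≠
0.

Lower bound |z|‖u‖ ≤ C‖(I - B(z))u‖: otherwise there are z_n → 0 and unit vectors v_n with (I -
B(z_n))v_n = o(z_n). Compactness of Y gives a limit u of norm one. As the logarithm diverges, ⟨√c,
u⟩ = 0. Pairing the equation with u and dividing by z_n shows that the logarithmic term disappears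
in the limit and that ⟨u, Du⟩ = 0. But |x - y| is strictly negative definite on functions with mean
zero, so √c u = 0 and u = 0, a contradiction (`false_of_approximate_kernel`,
`ae_eq_zero_of_integral_abs_eq_zero`). Since B(z) is compact, the lower bound yields invertibility.

For h in N the formula collapses to (I - B(z))h = -½G(z)h = O(|z|), and the contraction (I + B)⁻¹
gives ‖S(k)h‖ = O(|k|). If 0 were proper, then ‖S(k)h‖ = ‖S_e(k)h‖ would be bounded below by a
positive multiple of ‖h‖ for a.e. small k, which is impossible (`not_isProperPoint`). This needs
boundary values of S_e h, which come from a weak form of the Fatou theorem for Hilbert space valued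
functions (`exists_ae_tendsto_of_bounded`). -/

noncomputable section

namespace SlabTransport

/-! ### Boundary values of bounded analytic vector functions -/

section BoundaryLimits

open Complex in
/-- Horizontal contour shift for a holomorphic function on a strip with quadratic decay. -/
theorem integral_horizontal_eq {h : ℂ → ℂ} {a b C : ℝ} (hab : a ≤ b)
    (hd : ∀ z : ℂ, a ≤ z.im → z.im ≤ b → DifferentiableAt ℂ h z)
    (hC : ∀ z : ℂ, a ≤ z.im → z.im ≤ b → ‖h z‖ ≤ C / (1 + z.re ^ 2)) :
    ∫ x : ℝ, h (x + a * I) = ∫ x : ℝ, h (x + b * I) := by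
  have hcont : ∀ y : ℝ, a ≤ y → y ≤ b → Continuous fun x : ℝ => h (x + y * I) := by
    intro y h1 h2
    rw [continuous_iff_continuousAt]
    intro x
    have : ContinuousAt h ((x : ℂ) + y * I) := (hd _ (by simpa) (by simpa)).continuousAt
    exact this.comp (f := fun x : ℝ => (x : ℂ) + y * I) (by fun_prop)
  have hint : ∀ y : ℝ, a ≤ y → y ≤ b → Integrable fun x : ℝ => h (x + y * I) := by
    intro y h1 h2
    refine (integrable_inv_one_add_sq.const_mul C).mono' (hcont y h1 h2).aestronglyMeasurable ?_
    refine Eventually.of_forall fun x => ?_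
    have := hC (x + y * I) (by simpa) (by simpa)
    simpa [div_eq_mul_inv] using this
  have lim : ∀ y : ℝ, a ≤ y → y ≤ b →
      Tendsto (fun R : ℝ => ∫ x : ℝ in (-R)..R, h (x + y * I)) atTop
        (𝓝 (∫ x : ℝ, h (x + y * I))) := fun y h1 h2 =>
    intervalIntegral_tendsto_integral (hint y h1 h2) tendsto_neg_atTop_atBot tendsto_id
  -- The two vertical sides of the rectangle, σ = ±1: bounded length times an integrand of size C/(1
  -- + R²).
  have side : ∀ σ : ℝ, σ ^ 2 = 1 →
      Tendsto (fun R : ℝ => I • ∫ y : ℝ in a..b, h (((σ * R : ℝ) : ℂ) + y * I)) atTop (𝓝 0) := by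
    intro σ hσ
    have h0 : Tendsto (fun R : ℝ => C / (1 + R ^ 2) * |b - a|) atTop (𝓝 0) := by
      have h1 : Tendsto (fun R : ℝ => 1 + R ^ 2) atTop atTop :=
        tendsto_atTop_add_const_left _ _ (tendsto_pow_atTop two_ne_zero)
      have := (h1.const_div_atTop C).mul_const |b - a|
      simpa using this
    refine squeeze_zero_norm (fun R => ?_) h0
    rw [norm_smul, norm_I, one_mul]
    refine intervalIntegral.norm_integral_le_of_norm_le_const fun y hy => ?_
    rw [Set.uIoc_of_le hab] at hy
    have := hC (((σ * R : ℝ) : ℂ) + y * I) (by simpa using hy.1.le) (by simpa using hy.2)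
    simpa [mul_pow, hσ] using this
  have rect : ∀ R : ℝ, (∫ x : ℝ in (-R)..R, h (x + a * I)) - (∫ x : ℝ in (-R)..R, h (x + b * I)) +
      I • (∫ y : ℝ in a..b, h (((1 * R : ℝ) : ℂ) + y * I)) -
      I • (∫ y : ℝ in a..b, h (((-1 * R : ℝ) : ℂ) + y * I)) = 0 := by
    intro R
    have := integral_boundary_rect_eq_zero_of_differentiableOn h ⟨-R, a⟩ ⟨R, b⟩ (by
      intro z hz
      have hz' := hz.2
      simp only [Set.mem_preimage, Set.uIcc_of_le hab] at hz'
      exact (hd z hz'.1 hz'.2).differentiableWithinAt)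
    simpa using this
  have l1 := (((lim a le_rfl hab).sub (lim b hab le_rfl)).add (side 1 (by norm_num))).sub
    (side (-1) (by norm_num))
  have l2 := tendsto_nhds_unique l1 ((tendsto_const_nhds (x := (0 : ℂ))).congr fun R => (rect R).symm)
  simpa [sub_eq_zero] using l2

variable {E : Type*} [NormedAddCommGroup E] [InnerProductSpace ℂ E]

open Complex ComplexConjugate in
-- The conjugation of the variable cancels against the conjugate linearity of the first slot of the
-- inner product. This makes inner products of values of g on two horizontal lines accessible to
-- contour shifts.
theorem differentiableAt_inner_reflect {g : ℂ → E} {s : ℝ} {z : ℂ}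
    (h1 : DifferentiableAt ℂ g (conj z + s * I)) (h2 : DifferentiableAt ℂ g z) :
    DifferentiableAt ℂ (fun w => inner ℂ (g (conj w + s * I)) (g w)) z := by
  have h3 : HasDerivAt (fun w : ℂ => innerSL ℂ (g (conj w + s * I)))
      (innerSL ℂ (deriv g (conj z + s * I))) z := by
    have h4 := h1.hasDerivAt
    rw [hasDerivAt_iff_isLittleO] at h4 ⊢
    have h5 : Tendsto (fun w : ℂ => conj w + s * I) (𝓝 z) (𝓝 (conj z + s * I)) := by
      have : Continuous fun w : ℂ => conj w + s * I := by fun_prop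
      exact this.tendsto z
    have h6 := h4.comp_tendsto h5
    rw [← Asymptotics.isLittleO_norm_norm] at h6 ⊢
    refine h6.congr (fun w => ?_) (fun w => ?_)
    · simp only [Function.comp]
      rw [← innerSL_apply_norm (𝕜 := ℂ)]
      congr 1
      rw [map_sub, map_sub, map_smulₛₗ]
      simp
    · simp only [Function.comp]
      rw [← norm_conj (w - z)]
      congr 1
      simp
  exact (h3.clm_apply h2.hasDerivAt).differentiableAt

/-- `∫ ‖g(k + iε)‖² dk`. -/
def lineNormSq (g : ℂ → E) (ε : ℝ) : ℝ := ∫ k : ℝ, ‖g (k + ε * Complex.I)‖ ^ 2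

section Decay

variable {g : ℂ → E} {C : ℝ} (hd : DifferentiableOn ℂ g upperHalf)
  (hC : ∀ z ∈ upperHalf, ‖g z‖ ^ 2 ≤ C / (1 + z.re ^ 2))

theorem isOpen_upperHalf : IsOpen upperHalf := isOpen_lt continuous_const Complex.continuous_im

omit [InnerProductSpace ℂ E] in
include hC in
theorem norm_mul_norm_le_of_decay {z w : ℂ} (hz : z ∈ upperHalf) (hw : w ∈ upperHalf)
    (h : w.re = z.re) : ‖g w‖ * ‖g z‖ ≤ C / (1 + z.re ^ 2) := by
  have h1 := hC z hz
  have h2 := hC w hw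
  rw [h] at h2
  nlinarith [sq_nonneg (‖g w‖ - ‖g z‖)]

include hd in
theorem continuous_line {ε : ℝ} (hε : 0 < ε) : Continuous fun k : ℝ => g (k + ε * Complex.I) := by
  refine hd.continuousOn.comp_continuous (by fun_prop) fun k => ?_
  simpa [upperHalf] using hε

include hd hC in
theorem integrable_inner_line {ε ε' : ℝ} (hε : 0 < ε) (hε' : 0 < ε') :
    Integrable fun k : ℝ => inner ℂ (g (k + ε * Complex.I)) (g (k + ε' * Complex.I)) := by
  refine (integrable_inv_one_add_sq.const_mul C).mono'
    ((continuous_line hd hε).inner (continuous_line hd hε')).aestronglyMeasurable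
    (Eventually.of_forall fun k => ?_)
  refine (norm_inner_le_norm _ _).trans ?_
  have := norm_mul_norm_le_of_decay hC (z := k + ε' * Complex.I) (w := k + ε * Complex.I)
    (by simpa [upperHalf]) (by simpa [upperHalf]) (by simp)
  simpa [div_eq_mul_inv] using this

include hd hC in
theorem integrable_norm_sq_line {ε : ℝ} (hε : 0 < ε) :
    Integrable fun k : ℝ => ‖g (k + ε * Complex.I)‖ ^ 2 := by
  refine (integrable_inner_line hd hC hε hε).re.congr (Eventually.of_forall fun k => ?_)
  exact inner_self_eq_norm_sq _

include hd hC in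
-- The integrand is the restriction to Im w = ε' of the holomorphic function ⟨g(w̄ + i(ε + ε')),
-- g(w)⟩. On the line at half the total height both arguments coincide, and the integral becomes a
-- squared norm.
theorem integral_inner_line_eq {ε ε' : ℝ} (hε : 0 < ε) (hε' : 0 < ε') :
    ∫ k : ℝ, inner ℂ (g (k + ε * Complex.I)) (g (k + ε' * Complex.I)) =
      (lineNormSq g ((ε + ε') / 2) : ℂ) := by
  open Complex ComplexConjugate in
  have key : ∀ z : ℂ, 0 < z.im → z.im < ε + ε' →
      DifferentiableAt ℂ (fun w => inner ℂ (g (conj w + (ε + ε' : ℝ) * I)) (g w)) z ∧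
      ‖inner ℂ (g (conj z + (ε + ε' : ℝ) * I)) (g z)‖ ≤ C / (1 + z.re ^ 2) := by
    intro z h1 h2
    have hw : conj z + (ε + ε' : ℝ) * I ∈ upperHalf := by
      simp only [upperHalf, Set.mem_ofPred_eq]; simp; linarith
    have hz : z ∈ upperHalf := h1
    exact ⟨differentiableAt_inner_reflect (hd.differentiableAt (isOpen_upperHalf.mem_nhds hw))
      (hd.differentiableAt (isOpen_upperHalf.mem_nhds hz)),
      (norm_inner_le_norm _ _).trans (norm_mul_norm_le_of_decay hC hz hw (by simp))⟩
  open Complex ComplexConjugate in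
  have e0 : ∀ y : ℝ, ∀ k : ℝ, conj ((k : ℂ) + y * I) + (ε + ε' : ℝ) * I
      = (k : ℂ) + ((ε + ε' - y : ℝ) : ℂ) * I := by
    intro y k
    simp only [map_add, map_mul, conj_ofReal, conj_I]
    push_cast
    ring
  open Complex ComplexConjugate in
  have e1 : ∫ k : ℝ, inner ℂ (g (conj ((k : ℂ) + ε' * I) + (ε + ε' : ℝ) * I))
        (g ((k : ℂ) + ε' * I)) =
      ∫ k : ℝ, inner ℂ (g (conj ((k : ℂ) + ((ε + ε') / 2 : ℝ) * I) + (ε + ε' : ℝ) * I))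
        (g ((k : ℂ) + ((ε + ε') / 2 : ℝ) * I)) := by
    rcases le_total ε' ((ε + ε') / 2) with h | h
    · exact integral_horizontal_eq h
        (fun z h1 h2 => (key z (by linarith) (by linarith)).1)
        (fun z h1 h2 => (key z (by linarith) (by linarith)).2)
    · exact (integral_horizontal_eq h
        (fun z h1 h2 => (key z (by linarith) (by linarith)).1)
        (fun z h1 h2 => (key z (by linarith) (by linarith)).2)).symm
  simp only [e0, add_sub_cancel_right] at e1
  rw [e1, lineNormSq, ← integral_complex_ofReal]
  congr 1
  ext k
  rw [show ε + ε' - (ε + ε') / 2 = (ε + ε') / 2 by ring, inner_self_eq_norm_sq_to_K]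
  simp

include hd hC in
-- This identity serves twice: nonnegativity of the left side is midpoint convexity of `lineNormSq
-- g`, and smallness of the right side is the Cauchy property in L².
theorem integral_norm_sub_sq_line {ε ε' : ℝ} (hε : 0 < ε) (hε' : 0 < ε') :
    ∫ k : ℝ, ‖g (k + ε * Complex.I) - g (k + ε' * Complex.I)‖ ^ 2 =
      lineNormSq g ε + lineNormSq g ε' - 2 * lineNormSq g ((ε + ε') / 2) := by
  have h1 := integrable_inner_line hd hC hε hε'
  have h2 : ∫ k : ℝ, (inner ℂ (g (k + ε * Complex.I)) (g (k + ε' * Complex.I))).re =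
      lineNormSq g ((ε + ε') / 2) := by
    have := integral_re h1
    rw [integral_inner_line_eq hd hC hε hε'] at this
    simpa using this
  have h3 : ∀ k : ℝ, ‖g (k + ε * Complex.I) - g (k + ε' * Complex.I)‖ ^ 2 =
      ‖g (k + ε * Complex.I)‖ ^ 2 + ‖g (k + ε' * Complex.I)‖ ^ 2 -
        2 * (inner ℂ (g (k + ε * Complex.I)) (g (k + ε' * Complex.I))).re := by
    intro k
    rw [norm_sub_sq (𝕜 := ℂ)]
    simp only [RCLike.re_to_complex]
    ring
  simp only [h3]
  rw [integral_sub, integral_add, integral_const_mul, h2]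
  · rfl
  · exact integrable_norm_sq_line hd hC hε
  · exact integrable_norm_sq_line hd hC hε'
  · exact (integrable_norm_sq_line hd hC hε).add (integrable_norm_sq_line hd hC hε')
  · exact h1.re.const_mul 2

omit [InnerProductSpace ℂ E] in
include hC in
theorem lineNormSq_le {ε : ℝ} (hε : 0 < ε) : lineNormSq g ε ≤ C * Real.pi := by
  rw [lineNormSq, ← integral_univ_inv_one_add_sq, ← integral_const_mul]
  refine integral_mono_of_nonneg (Eventually.of_forall fun k => by positivity)
    (integrable_inv_one_add_sq.const_mul C) (Eventually.of_forall fun k => ?_)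
  have := hC (k + ε * Complex.I) (by simpa [upperHalf])
  simpa [div_eq_mul_inv] using this

include hd hC in
-- A midpoint convex function on (0, ∞) that is bounded above cannot increase: a single increase
-- would be repeated on all later steps of the same length and give linear growth.
theorem lineNormSq_antitone {ε ε' : ℝ} (hε : 0 < ε) (h : ε ≤ ε') :
    lineNormSq g ε' ≤ lineNormSq g ε := by
  by_contra hlt
  push Not at hlt
  set d := ε' - ε
  have hd0 : 0 ≤ d := sub_nonneg.2 h
  have conv : ∀ t : ℝ, 0 < t → lineNormSq g (t + d) - lineNormSq g t ≤
      lineNormSq g (t + d + d) - lineNormSq g (t + d) := by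
    intro t ht
    have h1 := integral_norm_sub_sq_line hd hC ht (show 0 < t + d + d by positivity)
    have h2 : 0 ≤ ∫ k : ℝ, ‖g (k + t * Complex.I) - g (k + (t + d + d : ℝ) * Complex.I)‖ ^ 2 :=
      integral_nonneg fun k => by positivity
    rw [h1, show (t + (t + d + d)) / 2 = t + d by ring] at h2
    linarith
  set η := lineNormSq g ε' - lineNormSq g ε
  have hη : 0 < η := sub_pos.2 hlt
  have step : ∀ n : ℕ, η ≤ lineNormSq g (ε + n * d + d) - lineNormSq g (ε + n * d) := by
    intro n
    induction n with
    | zero => simp [η, d]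
    | succ n ih =>
      refine ih.trans ((conv (ε + n * d) (by positivity)).trans (le_of_eq ?_))
      push_cast
      ring_nf
  have grow : ∀ n : ℕ, lineNormSq g ε + n * η ≤ lineNormSq g (ε + n * d) := by
    intro n
    induction n with
    | zero => simp
    | succ n ih =>
      have := step n
      have e : ε + ((n + 1 : ℕ) : ℝ) * d = ε + n * d + d := by push_cast; ring
      rw [e]
      push_cast
      linarith
  obtain ⟨n, hn⟩ := exists_nat_gt ((C * Real.pi - lineNormSq g ε) / η)
  rw [div_lt_iff₀ hη] at hn
  have h1 := grow n
  have h2 := lineNormSq_le hC (ε := ε + n * d) (by positivity)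
  linarith

include hd hC in
-- The squared norms on horizontal lines increase to a finite limit as the height tends to 0, so the
-- parallelogram identity makes the restrictions Cauchy in L². An almost everywhere convergent
-- subsequence provides the heights.
theorem exists_ae_tendsto_of_decay [CompleteSpace E] :
    ∃ ε : ℕ → ℝ, (∀ n, 0 < ε n) ∧ Tendsto ε atTop (𝓝 0) ∧
      ∀ᵐ k : ℝ, ∃ v, Tendsto (fun n => g (k + ε n * Complex.I)) atTop (𝓝 v) := by
  set e : ℕ → ℝ := fun n => 1 / ((n : ℝ) + 1)
  have he : ∀ n, 0 < e n := fun n => by positivity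
  have he0 : Tendsto e atTop (𝓝 0) := tendsto_one_div_add_atTop_nhds_zero_nat
  have hanti : Antitone e := fun m n h => one_div_le_one_div_of_le (by positivity) (by gcongr)
  have hmono : Monotone fun n => lineNormSq g (e n) := fun m n h =>
    lineNormSq_antitone hd hC (he n) (hanti h)
  have hbdd : BddAbove (Set.range fun n => lineNormSq g (e n)) :=
    ⟨C * Real.pi, by rintro _ ⟨n, rfl⟩; exact lineNormSq_le hC (he n)⟩
  have hlim := tendsto_atTop_ciSup hmono hbdd
  set L := ⨆ n, lineNormSq g (e n)
  have hmem : ∀ n, MemLp (fun k : ℝ => g (k + e n * Complex.I)) 2 volume := fun n =>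
    (memLp_two_iff_integrable_sq_norm (continuous_line hd (he n)).aestronglyMeasurable).2
      (integrable_norm_sq_line hd hC (he n))
  set G : ℕ → Lp E 2 (volume : Measure ℝ) := fun n => (hmem n).toLp
  have hdist : ∀ m n, dist (G m) (G n) ^ 2 =
      lineNormSq g (e m) + lineNormSq g (e n) - 2 * lineNormSq g ((e m + e n) / 2) := by
    intro m n
    rw [← integral_norm_sub_sq_line hd hC (he m) (he n), dist_eq_norm, ← MemLp.toLp_sub,
      Lp.norm_toLp, MemLp.eLpNorm_eq_integral_rpow_norm (by norm_num) (by norm_num)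
        ((hmem m).sub (hmem n)), ENNReal.toReal_ofReal (by positivity)]
    simp only [ENNReal.toReal_ofNat, Pi.sub_apply, Real.rpow_ofNat]
    rw [← Real.rpow_natCast, ← Real.rpow_mul (integral_nonneg fun k => by positivity)]
    norm_num
  have hcau : CauchySeq G := by
    rw [Metric.cauchySeq_iff']
    intro r hr
    -- For n ≥ N the midpoint of the two heights is at most `e N`, so the squared distance is at
    -- most L - `lineNormSq g (e N)`, which is below r²/2.
    obtain ⟨N, hN⟩ := (hlim.eventually (lt_mem_nhds (show L - r ^ 2 / 2 < L by nlinarith))).exists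
    refine ⟨N, fun n hn => ?_⟩
    have h1 := hdist n N
    have h2 : lineNormSq g (e N) ≤ lineNormSq g ((e n + e N) / 2) :=
      lineNormSq_antitone hd hC (by linarith [he n, he N]) (by linarith [hanti hn])
    have h3 : lineNormSq g (e n) ≤ L := le_ciSup hbdd n
    have h4 : dist (G n) (G N) ^ 2 < r ^ 2 := by nlinarith [sq_nonneg r]
    exact lt_of_pow_lt_pow_left₀ 2 hr.le h4
  obtain ⟨F, hF⟩ := cauchySeq_tendsto_of_complete hcau
  obtain ⟨ns, hns, hae⟩ := (tendstoInMeasure_of_tendsto_Lp hF).exists_seq_tendsto_ae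
  refine ⟨fun n => e (ns n), fun n => he _, he0.comp hns.tendsto_atTop, ?_⟩
  have hall : ∀ᵐ k : ℝ, ∀ n, G n k = g (k + e n * Complex.I) :=
    ae_all_iff.2 fun n => (hmem n).coeFn_toLp
  filter_upwards [hae, hall] with k h1 h2
  exact ⟨F k, h1.congr fun n => h2 _⟩

end Decay

/-- A bounded analytic function in the upper half-plane has strong limits along almost every
vertical line, through a common sequence of heights. -/
theorem exists_ae_tendsto_of_bounded [CompleteSpace E] {f : ℂ → E} {M : ℝ}
    (hd : DifferentiableOn ℂ f upperHalf) (hM : ∀ z ∈ upperHalf, ‖f z‖ ≤ M) :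
    ∃ ε : ℕ → ℝ, (∀ n, 0 < ε n) ∧ Tendsto ε atTop (𝓝 0) ∧
      ∀ᵐ k : ℝ, ∃ v, Tendsto (fun n => f (k + ε n * Complex.I)) atTop (𝓝 v) := by
  have hne : ∀ z ∈ upperHalf, z + Complex.I ≠ 0 := by
    intro z hz h0
    have := congrArg Complex.im h0
    simp at this
    have hz' : 0 < z.im := hz
    linarith
  -- Division by z + i makes a bounded function decay quadratically in the square of the norm; the
  -- factor is restored pointwise after the limit.
  obtain ⟨ε, h1, h2, h3⟩ := exists_ae_tendsto_of_decay (C := M ^ 2)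
    (g := fun z => (z + Complex.I)⁻¹ • f z)
    (DifferentiableOn.smul (DifferentiableOn.inv (by fun_prop) hne) hd) (by
      intro z hz
      have hz' : 0 < z.im := hz
      have h4 : 1 + z.re ^ 2 ≤ ‖z + Complex.I‖ ^ 2 := by
        rw [Complex.sq_norm, Complex.normSq_apply]
        simp
        nlinarith
      have h5 := hM z hz
      rw [norm_smul, mul_pow, norm_inv, inv_pow, inv_mul_eq_div]
      gcongr)
  refine ⟨ε, h1, h2, ?_⟩
  filter_upwards [h3] with k ⟨v, hv⟩
  have h6 : Tendsto (fun n => (k : ℂ) + ε n * Complex.I + Complex.I) atTop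
      (𝓝 ((k : ℂ) + (0 : ℝ) * Complex.I + Complex.I)) :=
    (tendsto_const_nhds.add
      (((Complex.continuous_ofReal.tendsto 0).comp h2).mul_const _)).add_const _
  refine ⟨_, (h6.smul hv).congr fun n => ?_⟩
  refine smul_inv_smul₀ (hne _ ?_) _
  simpa [upperHalf] using h1 n

end BoundaryLimits

/-! ### The exponential integral -/

section ExponentialIntegral

/-- The exponential integral `E₁(s) = ∫₀¹ e^{-s/μ} dμ/μ`. -/
def expInt (s : ℂ) : ℂ := ∫ μ in Set.Ioc (0 : ℝ) 1, Complex.exp (-s / μ) / μ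

/-- The entire exponential integral `Ein(s) = ∫₀¹ (1 - e^{-st}) dt/t`. -/
def expEin (s : ℂ) : ℂ := ∫ t in Set.Ioc (0 : ℝ) 1, (1 - Complex.exp (-s * t)) / t

theorem norm_exp_neg_sub_exp_neg_le {s s' : ℂ} (hs : 0 ≤ s.re) (hs' : 0 ≤ s'.re) :
    ‖Complex.exp (-s) - Complex.exp (-s')‖ ≤ ‖s - s'‖ := by
  have hconv : Convex ℝ {w : ℂ | w.re ≤ 0} := convex_halfSpace_re_le 0
  have := hconv.norm_image_sub_le_of_norm_deriv_le (f := Complex.exp) (C := 1)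
    (fun w _ => Complex.differentiableAt_exp) (fun w hw => by
      rw [Complex.deriv_exp, Complex.norm_exp]
      exact Real.exp_le_one_iff.2 hw)
    (x := -s') (y := -s) (by simpa using hs') (by simpa using hs)
  rwa [one_mul, neg_sub_neg, norm_sub_rev s' s] at this

theorem norm_expEin_integrand_sub_le {s s' : ℂ} (hs : 0 ≤ s.re) (hs' : 0 ≤ s'.re) {t : ℝ}
    (ht : 0 < t) : ‖(1 - Complex.exp (-s * t)) / t - (1 - Complex.exp (-s' * t)) / t‖ ≤
      ‖s - s'‖ := by
  have h1 := norm_exp_neg_sub_exp_neg_le (s := s' * t) (s' := s * t)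
    (by simpa using mul_nonneg hs' ht.le) (by simpa using mul_nonneg hs ht.le)
  rw [← sub_div, norm_div, Complex.norm_real, Real.norm_of_nonneg ht.le, div_le_iff₀ ht]
  rw [← sub_mul, norm_mul, Complex.norm_real, Real.norm_of_nonneg ht.le, norm_sub_rev s'] at h1
  rw [sub_sub_sub_cancel_left, neg_mul, neg_mul]
  exact h1

theorem aestronglyMeasurable_expEin_integrand (s : ℂ) :
    AEStronglyMeasurable (fun t : ℝ => (1 - Complex.exp (-s * t)) / t)
      volume := by
  refine Measurable.aestronglyMeasurable ?_
  fun_prop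

theorem integrableOn_expEin {s : ℂ} (hs : 0 ≤ s.re) :
    IntegrableOn (fun t : ℝ => (1 - Complex.exp (-s * t)) / t) (Set.Ioc (0 : ℝ) 1) := by
  refine Measure.integrableOn_of_bounded (M := ‖s‖) (by simp)
    (aestronglyMeasurable_expEin_integrand s) ?_
  refine (ae_restrict_iff' measurableSet_Ioc).2 (Eventually.of_forall fun t ht => ?_)
  simpa using norm_expEin_integrand_sub_le hs (s' := 0) (by simp) ht.1

/-- The exponential is 1-Lipschitz in the left half-plane, which cancels the factor 1/t under the
integral. Validity on the closed half-plane Re s ≥ 0 is what carries the operators to real z. -/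
theorem norm_expEin_sub_le {s s' : ℂ} (hs : 0 ≤ s.re) (hs' : 0 ≤ s'.re) :
    ‖expEin s - expEin s'‖ ≤ ‖s - s'‖ := by
  rw [expEin, expEin, ← integral_sub (integrableOn_expEin hs) (integrableOn_expEin hs')]
  refine (norm_setIntegral_le_of_norm_le_const (C := ‖s - s'‖) (by simp) fun t ht =>
    norm_expEin_integrand_sub_le hs hs' ht.1).trans ?_
  simp [Measure.real]

theorem expEin_zero : expEin 0 = 0 := by simp [expEin]

theorem norm_expEin_le {s : ℂ} (hs : 0 ≤ s.re) : ‖expEin s‖ ≤ ‖s‖ := by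
  simpa [expEin_zero] using norm_expEin_sub_le hs (s' := 0) (by simp)

/-- First order expansion of Ein at 0, uniform up to the imaginary axis; it produces the operator
with kernel |x - y|. -/
theorem norm_expEin_sub_self_le {s : ℂ} (hs : 0 ≤ s.re) (h1 : ‖s‖ ≤ 1) :
    ‖expEin s - s‖ ≤ ‖s‖ ^ 2 := by
  have hc : ∫ _ in Set.Ioc (0 : ℝ) 1, s = s := by simp [Measure.real]
  rw [expEin]
  nth_rewrite 2 [← hc]
  rw [← integral_sub (integrableOn_expEin hs) (integrableOn_const (by simp))]
  refine (norm_setIntegral_le_of_norm_le_const (C := ‖s‖ ^ 2) (by simp) fun t ht => ?_).trans ?_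
  · have ht0 : (t : ℂ) ≠ 0 := by exact_mod_cast ht.1.ne'
    have e : (1 - Complex.exp (-s * t)) / t - s = -(Complex.exp (-s * t) - 1 - (-s * t)) / t := by
      field_simp
      ring
    have hn : ‖-s * t‖ = ‖s‖ * t := by
      rw [norm_mul, norm_neg, Complex.norm_real, Real.norm_of_nonneg ht.1.le]
    have h2 := Complex.norm_exp_sub_one_sub_id_le (x := -s * t) (by
      rw [hn]
      exact mul_le_one₀ h1 ht.1.le ht.2)
    rw [e, norm_div, norm_neg, Complex.norm_real, Real.norm_of_nonneg ht.1.le, div_le_iff₀ ht.1]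
    refine h2.trans ?_
    rw [hn, mul_pow, sq t]
    have := mul_le_of_le_one_left ht.1.le ht.2
    gcongr
  · simp [Measure.real]

theorem hasDerivAt_expEin {s : ℂ} (hs : 0 < s.re) :
    HasDerivAt expEin ((1 - Complex.exp (-s)) / s) s := by
  have hs0 : s ≠ 0 := by rintro rfl; simp at hs
  have hmem : {w : ℂ | 0 < w.re} ∈ 𝓝 s := (isOpen_lt continuous_const Complex.continuous_re).mem_nhds hs
  have key := hasDerivAt_integral_of_dominated_loc_of_deriv_le (𝕜 := ℂ)
    (μ := volume.restrict (Set.Ioc (0 : ℝ) 1))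
    (F := fun (w : ℂ) (t : ℝ) => (1 - Complex.exp (-w * t)) / t)
    (F' := fun (w : ℂ) (t : ℝ) => Complex.exp (-w * t)) (x₀ := s) (bound := fun _ => 1) hmem
    (Eventually.of_forall fun w => (aestronglyMeasurable_expEin_integrand w).restrict)
    (integrableOn_expEin hs.le) (by fun_prop)
    ((ae_restrict_iff' measurableSet_Ioc).2 (Eventually.of_forall fun t ht w hw => by
      rw [Complex.norm_exp, Real.exp_le_one_iff]
      have : 0 ≤ w.re * t := mul_nonneg (le_of_lt hw) ht.1.le
      simpa using this))
    (integrableOn_const (by simp))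
    ((ae_restrict_iff' measurableSet_Ioc).2 (Eventually.of_forall fun t ht w hw => by
      have ht0 : (t : ℂ) ≠ 0 := by exact_mod_cast ht.1.ne'
      have := ((((hasDerivAt_id' w).neg.mul_const (t : ℂ)).cexp).const_sub 1).div_const (t : ℂ)
      refine this.congr_deriv ?_
      simp
      field_simp))
  refine key.2.congr_deriv ?_
  rw [← intervalIntegral.integral_of_le zero_le_one,
    integral_exp_mul_complex (neg_ne_zero.2 hs0)]
  simp
  field_simp
  ring

/-- From eˣ ≥ x²/2 with x = b/μ. The factor μ² absorbs both the 1/μ in E₁ and the 1/μ² in its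
derivative. -/
theorem norm_exp_neg_div_le {w : ℂ} {b : ℝ} (hb : 0 < b) (hw : b ≤ w.re) {μ : ℝ} (hμ : 0 < μ) :
    ‖Complex.exp (-w / μ)‖ ≤ 2 / b ^ 2 * μ ^ 2 := by
  have h1 : ‖Complex.exp (-w / μ)‖ ≤ Real.exp (-(b / μ)) := by
    rw [Complex.norm_exp, Complex.div_ofReal_re, Complex.neg_re, neg_div]
    gcongr
  refine h1.trans ?_
  have h2 := Real.quadratic_le_exp_of_nonneg (x := b / μ) (by positivity)
  have h3 : (b / μ) ^ 2 / 2 ≤ Real.exp (b / μ) := by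
    have : 0 ≤ b / μ := by positivity
    linarith
  rw [Real.exp_neg, show 2 / b ^ 2 * μ ^ 2 = ((b / μ) ^ 2 / 2)⁻¹ by field_simp]
  gcongr

theorem aestronglyMeasurable_expInt_integrand (s : ℂ) :
    AEStronglyMeasurable (fun μ : ℝ => Complex.exp (-s / μ) / μ)
      volume := by
  refine Measurable.aestronglyMeasurable ?_
  fun_prop

theorem integrableOn_expInt {s : ℂ} (hs : 0 < s.re) :
    IntegrableOn (fun μ : ℝ => Complex.exp (-s / μ) / μ) (Set.Ioc (0 : ℝ) 1) := by
  refine Measure.integrableOn_of_bounded (M := 2 / s.re ^ 2) (by simp)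
    (aestronglyMeasurable_expInt_integrand s) ?_
  refine (ae_restrict_iff' measurableSet_Ioc).2 (Eventually.of_forall fun μ hμ => ?_)
  rw [norm_div, Complex.norm_real, Real.norm_of_nonneg hμ.1.le, div_le_iff₀ hμ.1]
  refine (norm_exp_neg_div_le hs le_rfl hμ.1).trans ?_
  have := mul_le_of_le_one_left hμ.1.le hμ.2
  rw [sq μ]
  gcongr

theorem hasDerivAt_exp_neg_div {s : ℂ} {x : ℝ} (hx : x ≠ 0) :
    HasDerivAt (fun μ : ℝ => Complex.exp (-s / μ)) (Complex.exp (-s / x) * (s / (x : ℂ) ^ 2)) x := by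
  have hx' : (x : ℂ) ≠ 0 := by exact_mod_cast hx
  have := ((((hasDerivAt_id (x : ℂ)).inv hx').const_mul (-s)).cexp).comp_ofReal
  simp only [id] at this
  refine (this.congr_deriv ?_).congr_of_eventuallyEq (Eventually.of_forall fun y => ?_)
  · simp [div_eq_mul_inv]
  · simp [div_eq_mul_inv]

theorem hasDerivAt_expInt {s : ℂ} (hs : 0 < s.re) :
    HasDerivAt expInt (-Complex.exp (-s) / s) s := by
  have hs0 : s ≠ 0 := by rintro rfl; simp at hs
  set b := s.re / 2
  have hb : 0 < b := by positivity
  have hmem : {w : ℂ | b < w.re} ∈ 𝓝 s :=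
    (isOpen_lt continuous_const Complex.continuous_re).mem_nhds (by simp [b]; linarith)
  have key := hasDerivAt_integral_of_dominated_loc_of_deriv_le (𝕜 := ℂ)
    (μ := volume.restrict (Set.Ioc (0 : ℝ) 1))
    (F := fun (w : ℂ) (μ : ℝ) => Complex.exp (-w / μ) / μ)
    (F' := fun (w : ℂ) (μ : ℝ) => -(Complex.exp (-w / μ) / μ ^ 2)) (x₀ := s)
    (bound := fun _ => 2 / b ^ 2) hmem
    (Eventually.of_forall fun w => (aestronglyMeasurable_expInt_integrand w).restrict)
    (integrableOn_expInt hs) (Measurable.aestronglyMeasurable (by fun_prop))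
    ((ae_restrict_iff' measurableSet_Ioc).2 (Eventually.of_forall fun μ hμ w hw => by
      have hμ2 : 0 < μ ^ 2 := by have := hμ.1; positivity
      rw [norm_neg, norm_div, norm_pow, Complex.norm_real, Real.norm_of_nonneg hμ.1.le,
        div_le_iff₀ hμ2]
      exact norm_exp_neg_div_le hb (le_of_lt hw) hμ.1))
    (integrableOn_const (by simp))
    ((ae_restrict_iff' measurableSet_Ioc).2 (Eventually.of_forall fun μ hμ w hw => by
      have ht0 : (μ : ℂ) ≠ 0 := by exact_mod_cast hμ.1.ne'
      have := (((hasDerivAt_id' w).neg.div_const (μ : ℂ)).cexp).div_const (μ : ℂ)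
      refine this.congr_deriv ?_
      simp
      field_simp))
  refine key.2.congr_deriv ?_
  have hi : IntervalIntegrable (fun μ : ℝ => -(Complex.exp (-s / μ) / (μ : ℂ) ^ 2)) volume 0 1 := by
    rw [intervalIntegrable_iff_integrableOn_Ioc_of_le zero_le_one]
    exact key.1
  rw [← intervalIntegral.integral_of_le zero_le_one]
  -- The integrand -e^{-s/μ}/μ² has the primitive -e^{-s/μ}/s, which tends to 0 as μ ↓ 0.
  refine (intervalIntegral.integral_eq_sub_of_hasDerivAt_of_tendsto (a := 0) (b := 1)
    (f := fun μ : ℝ => -(Complex.exp (-s / μ) / s)) (fa := 0) (fb := -(Complex.exp (-s) / s))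
    zero_lt_one (fun x hx => ?_) hi ?_ ?_).trans ?_
  · have hx0 : (x : ℂ) ≠ 0 := by exact_mod_cast hx.1.ne'
    refine (((hasDerivAt_exp_neg_div (s := s) hx.1.ne').div_const s).neg).congr_deriv ?_
    field_simp
  · have h0 : Tendsto (fun μ : ℝ => 2 / s.re ^ 2 * μ ^ 2) (𝓝[>] 0) (𝓝 0) := by
      have : Continuous fun μ : ℝ => 2 / s.re ^ 2 * μ ^ 2 := by fun_prop
      simpa using (this.tendsto 0).mono_left nhdsWithin_le_nhds
    have h1 : Tendsto (fun μ : ℝ => Complex.exp (-s / μ)) (𝓝[>] 0) (𝓝 0) := by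
      refine squeeze_zero_norm' ?_ h0
      filter_upwards [self_mem_nhdsWithin] with μ hμ
      exact norm_exp_neg_div_le hs le_rfl hμ
    simpa using (h1.div_const s).neg
  · have := (((hasDerivAt_exp_neg_div (s := s) one_ne_zero).continuousAt.tendsto).div_const s).neg
    simp only [Complex.ofReal_one, div_one] at this
    exact this.mono_left nhdsWithin_le_nhds
  · simp [neg_div]

/-! ### Euler's constant as the constant of integration in E₁ -/

theorem integrableOn_log_mul_exp_neg :
    IntegrableOn (fun t : ℝ => Real.log t * Real.exp (-t)) (Set.Ioi 0) := by
  have hm : Measurable fun t : ℝ => Real.log t * Real.exp (-t) := by fun_prop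
  rw [← Set.Ioc_union_Ioi_eq_Ioi zero_le_one]
  refine IntegrableOn.union ?_ ?_
  · have h1 : IntegrableOn Real.log (Set.Ioc 0 1) :=
      (intervalIntegrable_iff_integrableOn_Ioc_of_le zero_le_one).1 intervalIntegral.intervalIntegrable_log'
    refine h1.norm.mono' hm.aestronglyMeasurable
      ((ae_restrict_iff' measurableSet_Ioc).2 (Eventually.of_forall fun t ht => ?_))
    rw [norm_mul, Real.norm_of_nonneg (Real.exp_pos _).le]
    exact mul_le_of_le_one_right (norm_nonneg _) (Real.exp_le_one_iff.2 (by linarith [ht.1]))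
  · have h1 : IntegrableOn (fun t : ℝ => Real.exp (-t) * t ^ ((2 : ℝ) - 1)) (Set.Ioi 1) :=
      (Real.GammaIntegral_convergent two_pos).mono_set (Set.Ioi_subset_Ioi zero_le_one)
    refine h1.mono' hm.aestronglyMeasurable
      ((ae_restrict_iff' measurableSet_Ioi).2 (Eventually.of_forall fun t (ht : 1 < t) => ?_))
    rw [norm_mul, Real.norm_of_nonneg (Real.exp_pos _).le,
      Real.norm_of_nonneg (Real.log_nonneg ht.le), mul_comm]
    have := Real.log_le_sub_one_of_pos (zero_lt_one.trans ht)
    gcongr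
    rw [show (2 : ℝ) - 1 = 1 by norm_num, Real.rpow_one]
    linarith

/-- The integral is Γ′(1), obtained by differentiating Euler's integral under the integral sign, and
Γ′(1) = -γ. -/
theorem integral_log_mul_exp_neg :
    ∫ t in Set.Ioi (0 : ℝ), Real.log t * Real.exp (-t) = -Real.eulerMascheroniConstant := by
  have h1 := Complex.hasDerivAt_GammaIntegral (s := 1) (by simp)
  have h2 : HasDerivAt Complex.GammaIntegral (-Real.eulerMascheroniConstant : ℂ) 1 := by
    refine Complex.hasDerivAt_Gamma_one.congr_of_eventuallyEq ?_
    filter_upwards [(isOpen_lt continuous_const Complex.continuous_re).mem_nhds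
      (show (0 : ℝ) < (1 : ℂ).re by simp)] with w hw
    exact (Complex.Gamma_eq_integral hw).symm
  have h3 := h1.unique h2
  simp only [sub_self, Complex.cpow_zero, one_mul] at h3
  have h4 : ∫ t in Set.Ioi (0 : ℝ), ((Real.log t : ℂ) * (Real.exp (-t) : ℂ)) =
      ((∫ t in Set.Ioi (0 : ℝ), Real.log t * Real.exp (-t) : ℝ) : ℂ) := by
    rw [← integral_complex_ofReal]
    simp
  rw [h4] at h3
  exact_mod_cast h3

theorem expEin_one_eq :
    expEin 1 = ((∫ t in Set.Ioc (0 : ℝ) 1, (1 - Real.exp (-t)) / t : ℝ) : ℂ) := by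
  rw [expEin, ← integral_complex_ofReal]
  simp

/-- The substitution t = 1/x, performed on (0, ∞) with indicator functions so that the power
substitution applies. -/
theorem expInt_one_eq :
    expInt 1 = ((∫ t in Set.Ioi (1 : ℝ), Real.exp (-t) / t : ℝ) : ℂ) := by
  have h := integral_comp_rpow_Ioi
    (Set.indicator (Set.Ici 1) fun t : ℝ => Real.exp (-t) / t) (p := -1) (by norm_num)
  have e1 : ∀ x ∈ Set.Ioi (0 : ℝ), (|(-1 : ℝ)| * x ^ ((-1 : ℝ) - 1)) •
      Set.indicator (Set.Ici 1) (fun t : ℝ => Real.exp (-t) / t) (x ^ (-1 : ℝ)) =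
      Set.indicator (Set.Ioc 0 1) (fun x : ℝ => Real.exp (-1 / x) / x) x := by
    intro x (hx : 0 < x)
    have hx2 : x ^ ((-1 : ℝ) - 1) = (x ^ 2)⁻¹ := by
      rw [show (-1 : ℝ) - 1 = -(2 : ℕ) by norm_num, Real.rpow_neg hx.le, Real.rpow_natCast]
    rw [hx2, Real.rpow_neg_one]
    by_cases h1 : x ≤ 1
    · rw [Set.indicator_of_mem (show x⁻¹ ∈ Set.Ici (1 : ℝ) from (one_le_inv₀ hx).2 h1),
        Set.indicator_of_mem (show x ∈ Set.Ioc (0 : ℝ) 1 from ⟨hx, h1⟩)]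
      rw [show -1 / x = -x⁻¹ by ring]
      simp
      field_simp
    · rw [Set.indicator_of_notMem (fun h2 : x⁻¹ ∈ Set.Ici (1 : ℝ) => h1 ((one_le_inv₀ hx).1 h2)),
        Set.indicator_of_notMem (fun h2 : x ∈ Set.Ioc (0 : ℝ) 1 => h1 h2.2), smul_zero]
  rw [setIntegral_congr_fun measurableSet_Ioi e1, setIntegral_indicator measurableSet_Ioc,
    setIntegral_indicator measurableSet_Ici,
    Set.inter_eq_self_of_subset_right (Set.Ioc_subset_Ioi_self),
    Set.inter_eq_self_of_subset_right (Set.Ici_subset_Ioi.2 zero_lt_one),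
    integral_Ici_eq_integral_Ioi] at h
  rw [← h, expInt, ← integral_complex_ofReal]
  simp

theorem integral_Ioc_log_mul_exp_neg :
    ∫ t in Set.Ioc (0 : ℝ) 1, Real.log t * Real.exp (-t) =
      -∫ t in Set.Ioc (0 : ℝ) 1, (1 - Real.exp (-t)) / t := by
  have i1 : IntegrableOn (fun t : ℝ => Real.log t * Real.exp (-t)) (Set.Ioc 0 1) :=
    integrableOn_log_mul_exp_neg.mono_set Set.Ioc_subset_Ioi_self
  have i2 : IntegrableOn (fun t : ℝ => (1 - Real.exp (-t)) / t) (Set.Ioc 0 1) := by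
    refine (integrableOn_expEin (s := 1) (by simp)).re.congr (Eventually.of_forall fun t => ?_)
    simp [← Complex.ofReal_exp, ← Complex.ofReal_neg]
  rw [eq_neg_iff_add_eq_zero, ← integral_add i1 i2,
    ← intervalIntegral.integral_of_le zero_le_one]
  -- The sum of the two integrands is the derivative of (1 - e^{-t}) log t. This vanishes at 1, and
  -- also in the limit at 0, where it is dominated by |t log t|.
  refine (intervalIntegral.integral_eq_sub_of_hasDerivAt_of_tendsto (a := 0) (b := 1)
    (f := fun t : ℝ => (1 - Real.exp (-t)) * Real.log t) (fa := 0) (fb := 0)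
    zero_lt_one (fun x hx => ?_)
    ((intervalIntegrable_iff_integrableOn_Ioc_of_le zero_le_one).2 (i1.add i2)) ?_ ?_).trans
    (sub_zero 0)
  · have := (((hasDerivAt_id' x).neg.exp).const_sub 1).mul (Real.hasDerivAt_log hx.1.ne')
    refine this.congr_deriv ?_
    simp only [div_eq_mul_inv, Pi.add_apply, Pi.neg_apply]
    ring
  · have h0 : Tendsto (fun t : ℝ => ‖Real.log t * t‖) (𝓝[>] 0) (𝓝 0) := by
      have := (Real.continuous_mul_log.tendsto 0).norm.mono_left
        (nhdsWithin_le_nhds (s := Set.Ioi (0 : ℝ)))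
      simpa [mul_comm] using this
    refine squeeze_zero_norm' ?_ h0
    filter_upwards [self_mem_nhdsWithin] with t (ht : 0 < t)
    rw [norm_mul, norm_mul, mul_comm]
    gcongr
    have h1 := Real.one_sub_le_exp_neg t
    have h2 : Real.exp (-t) ≤ 1 := Real.exp_le_one_iff.2 (by linarith)
    rw [Real.norm_of_nonneg (by linarith), Real.norm_of_nonneg ht.le]
    linarith
  · have h1 : ContinuousAt (fun t : ℝ => (1 - Real.exp (-t)) * Real.log t) 1 :=
      (by fun_prop : ContinuousAt (fun t : ℝ => 1 - Real.exp (-t)) 1).mul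
        (Real.continuousAt_log one_ne_zero)
    have h2 := h1.tendsto
    simp only [Real.log_one, mul_zero] at h2
    exact h2.mono_left nhdsWithin_le_nhds

theorem integral_Ioi_one_log_mul_exp_neg :
    ∫ t in Set.Ioi (1 : ℝ), Real.log t * Real.exp (-t) =
      ∫ t in Set.Ioi (1 : ℝ), Real.exp (-t) / t := by
  have i1 : IntegrableOn (fun t : ℝ => Real.log t * Real.exp (-t)) (Set.Ioi 1) :=
    integrableOn_log_mul_exp_neg.mono_set (Set.Ioi_subset_Ioi zero_le_one)
  have i2 : IntegrableOn (fun t : ℝ => Real.exp (-t) / t) (Set.Ioi 1) := by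
    refine (integrableOn_exp_neg_Ioi 1).mono' (Measurable.aestronglyMeasurable (by fun_prop))
      ((ae_restrict_iff' measurableSet_Ioi).2 (Eventually.of_forall fun t (ht : 1 < t) => ?_))
    rw [Real.norm_of_nonneg (by positivity)]
    exact div_le_self (Real.exp_pos _).le ht.le
  rw [← sub_eq_zero, ← integral_sub i1 i2]
  refine (integral_Ioi_of_hasDerivAt_of_tendsto' (f := fun t : ℝ => -(Real.exp (-t) * Real.log t))
      (m := 0) (fun x (hx : 1 ≤ x) => ?_) (i1.sub i2) ?_).trans (by simp)
  · have := (((hasDerivAt_id' x).neg.exp).mul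
      (Real.hasDerivAt_log (zero_lt_one.trans_le hx).ne')).neg
    refine this.congr_deriv ?_
    simp only [div_eq_mul_inv, Pi.sub_apply, Pi.neg_apply]
    ring
  · have h0 : Tendsto (fun t : ℝ => t ^ 1 * Real.exp (-t)) atTop (𝓝 0) :=
      Real.tendsto_pow_mul_exp_neg_atTop_nhds_zero 1
    refine squeeze_zero_norm' ?_ h0
    filter_upwards [eventually_ge_atTop 1] with t ht
    rw [norm_neg, norm_mul, Real.norm_of_nonneg (Real.exp_pos _).le,
      Real.norm_of_nonneg (Real.log_nonneg ht), mul_comm, pow_one]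
    have := Real.log_le_sub_one_of_pos (zero_lt_one.trans_le ht)
    gcongr
    linarith

/-- Splitting ∫₀^∞ log t e^{-t} dt = -γ at t = 1 and integrating by parts on each piece gives
-Ein(1) and E₁(1). -/
theorem expInt_one_sub_expEin_one : expInt 1 - expEin 1 = -Real.eulerMascheroniConstant := by
  have h := integral_log_mul_exp_neg
  rw [← Set.Ioc_union_Ioi_eq_Ioi (zero_le_one (α := ℝ)), setIntegral_union
    (Set.Ioc_disjoint_Ioi le_rfl) measurableSet_Ioi
    (integrableOn_log_mul_exp_neg.mono_set Set.Ioc_subset_Ioi_self)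
    (integrableOn_log_mul_exp_neg.mono_set (Set.Ioi_subset_Ioi zero_le_one)),
    integral_Ioc_log_mul_exp_neg, integral_Ioi_one_log_mul_exp_neg] at h
  rw [expInt_one_eq, expEin_one_eq, ← Complex.ofReal_neg, ← h]
  push_cast
  ring

/-- `E₁(s) = -γ - log s + Ein(s)` in the right half-plane. -/
theorem expInt_eq {s : ℂ} (hs : 0 < s.re) :
    expInt s = -Real.eulerMascheroniConstant - Complex.log s + expEin s := by
  have hopen : IsOpen {w : ℂ | 0 < w.re} := isOpen_lt continuous_const Complex.continuous_re
  -- The derivatives -e^{-w}/w, 1/w and -(1 - e^{-w})/w add up to zero. On the convex half-plane the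
  -- combination is therefore constant, and its value is read off at 1.
  have hd : ∀ w ∈ {w : ℂ | 0 < w.re},
      HasDerivAt (fun w => expInt w + Complex.log w - expEin w) 0 w := by
    intro w hw
    have hw0 : w ≠ 0 := by rintro rfl; simp at hw
    have h := ((hasDerivAt_expInt hw).add (Complex.hasDerivAt_log (Or.inl hw))).sub
      (hasDerivAt_expEin hw)
    refine h.congr_deriv ?_
    field_simp
    ring
  have h := (convex_halfSpace_re_gt 0).is_const_of_fderivWithin_eq_zero (𝕜 := ℂ)
    (f := fun w => expInt w + Complex.log w - expEin w)
    (fun w hw => (hd w hw).differentiableAt.differentiableWithinAt)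
    (fun w hw => by
      have h1 := (hd w hw).hasFDerivAt.hasFDerivWithinAt (s := {w : ℂ | 0 < w.re})
      rw [h1.fderivWithin (hopen.uniqueDiffWithinAt hw)]
      ext
      simp)
    (show s ∈ {w : ℂ | 0 < w.re} from hs) (show (1 : ℂ) ∈ {w : ℂ | 0 < w.re} by simp)
  simp only [Complex.log_one, add_zero, expInt_one_sub_expEin_one] at h
  linear_combination h

end ExponentialIntegral

/-! ### Hilbert–Schmidt integral operators -/

section KernelOperators

variable {α : Type*} [MeasurableSpace α] {ν : Measure α}

theorem eLpNorm_two_sq {F : Type*} [NormedAddCommGroup F] (f : α → F) :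
    eLpNorm f 2 ν ^ 2 = ∫⁻ x, ‖f x‖ₑ ^ 2 ∂ν := by
  have := eLpNorm_nnreal_pow_eq_lintegral (f := f) (μ := ν) (p := 2) (by norm_num)
  simpa using this

theorem memLp_two_of_lintegral_lt_top {F : Type*} [NormedAddCommGroup F] {f : α → F}
    (hf : AEStronglyMeasurable f ν) (h : ∫⁻ x, ‖f x‖ₑ ^ 2 ∂ν < ∞) : MemLp f 2 ν := by
  refine ⟨hf, ?_⟩
  rw [← eLpNorm_two_sq] at h
  exact (ENNReal.pow_lt_top_iff.1 h).resolve_right (by norm_num)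

theorem MemLp.lintegral_sq_lt_top {F : Type*} [NormedAddCommGroup F] {f : α → F}
    (hf : MemLp f 2 ν) : ∫⁻ x, ‖f x‖ₑ ^ 2 ∂ν < ∞ := by
  rw [← eLpNorm_two_sq]
  exact ENNReal.pow_lt_top hf.2

theorem enorm_integral_mul_le {f g : α → ℂ} (hf : AEStronglyMeasurable f ν)
    (hg : AEStronglyMeasurable g ν) :
    ‖∫ x, f x * g x ∂ν‖ₑ ≤ eLpNorm f 2 ν * eLpNorm g 2 ν := by
  refine (enorm_integral_le_lintegral_enorm _).trans ?_
  rw [← eLpNorm_one_eq_lintegral_enorm]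
  change eLpNorm (f • g) 1 ν ≤ _
  exact eLpNorm_smul_le_mul_eLpNorm (p := 2) (q := 2) (r := 1) hg hf

variable [SFinite ν]

theorem ae_memLp_section {κ : α × α → ℂ} (hκ : MemLp κ 2 (ν.prod ν)) :
    ∀ᵐ x ∂ν, MemLp (fun y => κ (x, y)) 2 ν := by
  have h1 := MemLp.lintegral_sq_lt_top hκ
  rw [lintegral_prod _ (hκ.1.enorm.pow_const 2)] at h1
  filter_upwards [ae_lt_top' ((hκ.1.enorm.pow_const 2).lintegral_prod_right') h1.ne,
    hκ.1.prodMk_left] with x hx hm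
  exact memLp_two_of_lintegral_lt_top hm hx

theorem ae_integrable_kernel {κ : α × α → ℂ} (hκ : MemLp κ 2 (ν.prod ν)) {v : α → ℂ}
    (hv : MemLp v 2 ν) : ∀ᵐ x ∂ν, Integrable (fun y => κ (x, y) * v y) ν := by
  filter_upwards [ae_memLp_section hκ] with x hx
  exact hx.integrable_mul hv

theorem aestronglyMeasurable_kernel {κ : α × α → ℂ} (hκ : AEStronglyMeasurable κ (ν.prod ν))
    {v : α → ℂ} (hv : AEStronglyMeasurable v ν) :
    AEStronglyMeasurable (fun x => ∫ y, κ (x, y) * v y ∂ν) ν :=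
  (hκ.mul hv.comp_snd).integral_prod_right'

/-- Cauchy–Schwarz in y for almost every x: the operator norm is at most the Hilbert–Schmidt norm.
-/
theorem eLpNorm_kernel_le {κ : α × α → ℂ} (hκ : MemLp κ 2 (ν.prod ν)) {v : α → ℂ}
    (hv : MemLp v 2 ν) :
    eLpNorm (fun x => ∫ y, κ (x, y) * v y ∂ν) 2 ν ≤
      eLpNorm κ 2 (ν.prod ν) * eLpNorm v 2 ν := by
  refine (ENNReal.pow_le_pow_left_iff two_ne_zero).1 ?_
  rw [mul_pow, eLpNorm_two_sq, eLpNorm_two_sq κ, lintegral_prod _ (hκ.1.enorm.pow_const 2),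
    ← lintegral_mul_const'' _ (hκ.1.enorm.pow_const 2).lintegral_prod_right']
  refine lintegral_mono_ae ?_
  filter_upwards [ae_memLp_section hκ] with x hx
  have := enorm_integral_mul_le hx.1 hv.1
  rw [← eLpNorm_two_sq, ← mul_pow]
  gcongr

theorem memLp_kernel {κ : α × α → ℂ} (hκ : MemLp κ 2 (ν.prod ν)) {v : α → ℂ}
    (hv : MemLp v 2 ν) : MemLp (fun x => ∫ y, κ (x, y) * v y ∂ν) 2 ν :=
  ⟨aestronglyMeasurable_kernel hκ.1 hv.1,
    (eLpNorm_kernel_le hκ hv).trans_lt (ENNReal.mul_lt_top hκ.2 hv.2)⟩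

/-- The integral operator with kernel `κ ∈ L²`, as a function of `κ`. -/
def kernelOp : Lp ℂ 2 (ν.prod ν) →L[ℂ] Lp ℂ 2 ν →L[ℂ] Lp ℂ 2 ν :=
  LinearMap.mkContinuous₂
    (LinearMap.mk₂ ℂ (fun κ v => (memLp_kernel (Lp.memLp κ) (Lp.memLp v)).toLp)
      (by
        intro κ κ' v
        rw [← MemLp.toLp_add]
        refine MemLp.toLp_congr _ _ ?_
        filter_upwards [Measure.ae_ae_of_ae_prod (Lp.coeFn_add κ κ'),
          ae_integrable_kernel (Lp.memLp κ) (Lp.memLp v),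
          ae_integrable_kernel (Lp.memLp κ') (Lp.memLp v)] with x h1 h2 h3
        rw [Pi.add_apply, ← integral_add h2 h3]
        refine integral_congr_ae ?_
        filter_upwards [h1] with y hy
        simp only [hy, Pi.add_apply, add_mul])
      (by
        intro r κ v
        rw [← MemLp.toLp_const_smul]
        refine MemLp.toLp_congr _ _ ?_
        filter_upwards [Measure.ae_ae_of_ae_prod (Lp.coeFn_smul r κ)] with x h1
        rw [Pi.smul_apply, smul_eq_mul, ← integral_const_mul]
        refine integral_congr_ae ?_
        filter_upwards [h1] with y hy
        simp only [hy, Pi.smul_apply, smul_eq_mul, mul_assoc])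
      (by
        intro κ v v'
        rw [← MemLp.toLp_add]
        refine MemLp.toLp_congr _ _ ?_
        filter_upwards [ae_integrable_kernel (Lp.memLp κ) (Lp.memLp v),
          ae_integrable_kernel (Lp.memLp κ) (Lp.memLp v')] with x h2 h3
        rw [Pi.add_apply, ← integral_add h2 h3]
        refine integral_congr_ae ?_
        filter_upwards [Lp.coeFn_add v v'] with y hy
        simp only [hy, Pi.add_apply, mul_add])
      (by
        intro r κ v
        rw [← MemLp.toLp_const_smul]
        refine MemLp.toLp_congr _ _ (Eventually.of_forall fun x => ?_)
        rw [Pi.smul_apply, smul_eq_mul, ← integral_const_mul]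
        refine integral_congr_ae ?_
        filter_upwards [Lp.coeFn_smul r v] with y hy
        simp only [hy, Pi.smul_apply, smul_eq_mul]
        ring))
    1 (by
      intro κ v
      rw [one_mul]
      simp only [LinearMap.mk₂_apply, Lp.norm_toLp]
      rw [Lp.norm_def, Lp.norm_def, ← ENNReal.toReal_mul]
      exact ENNReal.toReal_mono (ENNReal.mul_ne_top (Lp.memLp κ).2.ne (Lp.memLp v).2.ne)
        (eLpNorm_kernel_le (Lp.memLp κ) (Lp.memLp v)))

theorem coeFn_kernelOp (κ : Lp ℂ 2 (ν.prod ν)) (v : Lp ℂ 2 ν) :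
    kernelOp κ v =ᵐ[ν] fun x => ∫ y, κ (x, y) * v y ∂ν :=
  MemLp.coeFn_toLp (memLp_kernel (Lp.memLp κ) (Lp.memLp v))

theorem coeFn_kernelOp_toLp {κ : α × α → ℂ} (hκ : MemLp κ 2 (ν.prod ν)) (v : Lp ℂ 2 ν) :
    kernelOp hκ.toLp v =ᵐ[ν] fun x => ∫ y, κ (x, y) * v y ∂ν := by
  refine (coeFn_kernelOp _ _).trans ?_
  filter_upwards [Measure.ae_ae_of_ae_prod hκ.coeFn_toLp] with x hx
  refine integral_congr_ae ?_
  filter_upwards [hx] with y hy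
  rw [hy]

theorem norm_kernelOp_le (κ : Lp ℂ 2 (ν.prod ν)) : ‖kernelOp κ‖ ≤ ‖κ‖ := by
  have h : ‖(kernelOp : Lp ℂ 2 (ν.prod ν) →L[ℂ] _)‖ ≤ 1 :=
    LinearMap.mkContinuous₂_norm_le _ zero_le_one _
  exact (kernelOp.le_of_opNorm_le h κ).trans_eq (one_mul _)

open ComplexConjugate in
theorem memLp_tensor {u v : α → ℂ} (hu : MemLp u 2 ν) (hv : MemLp v 2 ν) :
    MemLp (fun p : α × α => u p.1 * v p.2) 2 (ν.prod ν) := by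
  refine memLp_two_of_lintegral_lt_top (hu.1.comp_fst.mul hv.1.comp_snd) ?_
  have h1 : ∫⁻ p : α × α, ‖u p.1 * v p.2‖ₑ ^ 2 ∂ν.prod ν =
      (∫⁻ x, ‖u x‖ₑ ^ 2 ∂ν) * ∫⁻ y, ‖v y‖ₑ ^ 2 ∂ν := by
    rw [← lintegral_prod_mul (hu.1.enorm.pow_const 2) (hv.1.enorm.pow_const 2)]
    simp only [enorm_mul, mul_pow]
  rw [h1]
  exact ENNReal.mul_lt_top (MemLp.lintegral_sq_lt_top hu) (MemLp.lintegral_sq_lt_top hv)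

open ComplexConjugate in
theorem integrable_conj_mul_kernel {κ : α × α → ℂ} (hκ : MemLp κ 2 (ν.prod ν)) {u v : α → ℂ}
    (hu : MemLp u 2 ν) (hv : MemLp v 2 ν) :
    Integrable (fun p : α × α => conj (u p.1) * (κ p * v p.2)) (ν.prod ν) := by
  have h := hκ.integrable_mul (memLp_tensor hu.star hv)
  refine h.congr (Eventually.of_forall fun p => ?_)
  simp only [Pi.mul_apply, Pi.star_apply, RCLike.star_def]
  ring

open ComplexConjugate in
theorem inner_kernelOp_toLp {κ : α × α → ℂ} (hκ : MemLp κ 2 (ν.prod ν)) (u v : Lp ℂ 2 ν) :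
    inner ℂ u (kernelOp hκ.toLp v) = ∫ p, conj (u p.1) * (κ p * v p.2) ∂(ν.prod ν) := by
  rw [integral_prod _ (integrable_conj_mul_kernel hκ (Lp.memLp u) (Lp.memLp v)), L2.inner_def]
  refine integral_congr_ae ?_
  filter_upwards [coeFn_kernelOp_toLp hκ v] with x hx
  rw [hx, integral_const_mul]
  simp [mul_comm]

open ComplexConjugate in
/-- The integral operator with a Hermitian kernel is symmetric. -/
theorem inner_kernelOp_symm {κ : α × α → ℂ} (hκ : MemLp κ 2 (ν.prod ν))
    (hsymm : ∀ p, κ p.swap = conj (κ p)) (u v : Lp ℂ 2 ν) :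
    inner ℂ u (kernelOp hκ.toLp v) = inner ℂ (kernelOp hκ.toLp u) v := by
  rw [← inner_conj_symm (kernelOp hκ.toLp u), inner_kernelOp_toLp, inner_kernelOp_toLp,
    ← integral_conj, ← integral_prod_swap]
  refine integral_congr_ae (Eventually.of_forall fun p => ?_)
  simp only [hsymm, Prod.fst_swap, Prod.snd_swap, map_mul, Complex.conj_conj]
  ring

open ComplexConjugate in
/-- Integral operators with kernel in `L²` are compact. -/
theorem isCompactOperator_kernelOp (κ : Lp ℂ 2 (ν.prod ν)) : IsCompactOperator (kernelOp κ) := by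
  -- The kernels with compact operator form a closed subspace that contains the tensors u ⊗ v̄,
  -- whose operators have rank at most one.
  set S : Submodule ℂ (Lp ℂ 2 (ν.prod ν)) :=
    (compactOperator (RingHom.id ℂ) (Lp ℂ 2 ν) (Lp ℂ 2 ν)).comap
      (kernelOp (ν := ν)).toLinearMap
  have hS : ∀ κ, κ ∈ S ↔ IsCompactOperator (kernelOp κ) := fun κ => Iff.rfl
  have hclosed : IsClosed (S : Set (Lp ℂ 2 (ν.prod ν))) := by
    have := (isClosed_setOfPred_isCompactOperator (𝕜₁ := ℂ) (𝕜₂ := ℂ) (σ₁₂ := RingHom.id ℂ)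
      (M₁ := Lp ℂ 2 ν) (M₂ := Lp ℂ 2 ν)).preimage (kernelOp (ν := ν)).continuous
    exact this
  have htensor : ∀ u v : Lp ℂ 2 ν, (memLp_tensor (Lp.memLp u) (Lp.memLp v).star).toLp ∈ S := by
    intro u v
    rw [hS]
    have e : kernelOp (memLp_tensor (Lp.memLp u) (Lp.memLp v).star).toLp =
        (innerSL ℂ v).smulRight u := by
      ext1 w
      refine Lp.ext ?_
      filter_upwards [coeFn_kernelOp_toLp (memLp_tensor (Lp.memLp u) (Lp.memLp v).star) w,
        Lp.coeFn_smul (inner ℂ v w) u] with x h1 h2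
      rw [h1]
      change _ = (inner ℂ v w • u : Lp ℂ 2 ν) x
      rw [h2, Pi.smul_apply, L2.inner_def, smul_eq_mul, ← integral_mul_const]
      refine integral_congr_ae (Eventually.of_forall fun y => ?_)
      simp only [Pi.star_apply, RCLike.star_def, RCLike.inner_apply]
      ring
    rw [e]
    have hc : IsCompactOperator (innerSL ℂ v : Lp ℂ 2 ν →L[ℂ] ℂ) :=
      isCompactOperator_of_locallyCompactSpace_dom (innerSL ℂ v : Lp ℂ 2 ν →L[ℂ] ℂ)
    exact hc.clm_comp (ContinuousLinearMap.toSpanSingleton ℂ u)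
  -- A kernel orthogonal to S is orthogonal to all tensors, so its operator has vanishing matrix
  -- elements and is zero. Zero is compact, so the kernel also lies in S and must vanish.
  have horth : Sᗮ = ⊥ := by
    rw [Submodule.eq_bot_iff]
    intro κ hκ
    have hz : kernelOp κ = 0 := by
      ext1 v
      refine ext_inner_left ℂ fun u => ?_
      have h1 := (Submodule.mem_orthogonal _ _).1 hκ _ (htensor u v)
      have h2 : kernelOp κ = kernelOp (Lp.memLp κ).toLp := by rw [Lp.toLp_coeFn]
      rw [h2, inner_kernelOp_toLp, zero_apply, inner_zero_right, ← h1,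
        L2.inner_def]
      refine integral_congr_ae ?_
      filter_upwards [(memLp_tensor (Lp.memLp u) (Lp.memLp v).star).coeFn_toLp] with p hp
      rw [hp]
      simp only [Pi.star_apply, RCLike.star_def, RCLike.inner_apply, map_mul, Complex.conj_conj]
      ring
    have hmem : κ ∈ S := by
      rw [hS, hz]
      exact isCompactOperator_zero
    exact inner_self_eq_zero.1 ((Submodule.mem_orthogonal _ _).1 hκ κ hmem)
  have : CompleteSpace S := hclosed.completeSpace_coe
  have htop : S = ⊤ := Submodule.orthogonal_eq_bot_iff.1 horth
  rw [← hS, htop]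
  trivial

end KernelOperators

/-! ### Weighted convolution operators in the slab -/

section WeightedConvolution

/-- A bounded, nonnegative, compactly supported Borel function on the line. -/
structure Weight where
  toFun : ℝ → ℝ
  measurable' : Measurable toFun
  nonneg' : ∀ x, 0 ≤ toFun x
  bound : ℝ
  le_bound' : ∀ x, toFun x ≤ bound
  radius : ℝ
  radius_pos : 0 < radius
  supp' : ∀ x, radius < |x| → toFun x = 0

instance : CoeFun Weight fun _ => ℝ → ℝ := ⟨Weight.toFun⟩

namespace Weight

variable (w : Weight)

theorem measurable : Measurable w := w.measurable'

theorem nonneg (x : ℝ) : 0 ≤ w x := w.nonneg' x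

theorem le_bound (x : ℝ) : w x ≤ w.bound := w.le_bound' x

theorem supp {x : ℝ} (h : w.radius < |x|) : w x = 0 := w.supp' x h

theorem bound_nonneg : 0 ≤ w.bound := (w.nonneg 0).trans (w.le_bound 0)

end Weight

/-- `√c` has a representative which is a weight. -/
theorem exists_weight (c : Lp ℝ ∞ (volume : Measure ℝ))
    (hc_supp : ∃ a : ℝ, ∀ᵐ x : ℝ, a < |x| → c x = 0) :
    ∃ w : Weight, ∀ᵐ x : ℝ, w x = √(c x) := by
  obtain ⟨a, ha⟩ := hc_supp
  have hm : Measurable (c : ℝ → ℝ) := (Lp.stronglyMeasurable c).measurable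
  have hb : ∀ᵐ x : ℝ, ‖c x‖ ≤ ‖c‖ := by
    have h : ∀ᵐ x : ℝ, ‖c x‖ₑ ≤ eLpNorm c ∞ volume := by
      rw [eLpNorm_exponent_top]
      exact ae_le_eLpNormEssSup
    filter_upwards [h] with x hx
    rw [Lp.norm_def, ← toReal_enorm]
    exact ENNReal.toReal_mono (Lp.memLp c).2.ne hx
  refine ⟨{
    -- Truncation turns the almost everywhere bounds into bounds at every point; the maximum with 1
    -- keeps the radius positive.
    toFun := fun x => if |x| ≤ max a 1 then min (√(c x)) (√‖c‖) else 0
    measurable' := Measurable.ite (measurableSet_le (by fun_prop) measurable_const)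
      (by fun_prop) measurable_const
    nonneg' := fun x => by
      split_ifs
      · exact le_min (Real.sqrt_nonneg _) (Real.sqrt_nonneg _)
      · exact le_rfl
    bound := √‖c‖
    le_bound' := fun x => by
      split_ifs
      · exact min_le_right _ _
      · exact Real.sqrt_nonneg _
    radius := max a 1
    radius_pos := lt_max_of_lt_right one_pos
    supp' := fun x hx => if_neg (not_le.2 hx) }, ?_⟩
  filter_upwards [ha, hb] with x h1 h2
  split_ifs with h
  · exact min_eq_left (Real.sqrt_le_sqrt ((le_abs_self _).trans h2))
  · rw [h1 ((le_max_left a 1).trans_lt (not_le.1 h)), Real.sqrt_zero]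

theorem lintegral_slab_fst {f : ℝ → ℝ≥0∞} (hf : AEMeasurable f) :
    ∫⁻ q, f q.1 ∂slabMeasure = 2 * ∫⁻ x, f x := by
  rw [slabMeasure, lintegral_prod _ hf.comp_fst]
  simp only [lintegral_const, angleMeasure_univ]
  rw [lintegral_mul_const'' _ hf, mul_comm]

instance : SFinite slabMeasure := by unfold slabMeasure; infer_instance

variable (w : Weight)

/-- The kernel `½ w(x) φ(x - y) w(y)` on the phase space. -/
def convKernel (φ : ℝ → ℂ) (p : (ℝ × ℝ) × (ℝ × ℝ)) : ℂ :=
  1 / 2 * w p.1.1 * φ (p.1.1 - p.2.1) * w p.2.1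

/-- Measurable functions which are square integrable on the interval where the differences of
points of the support of the weight lie. -/
structure IsAdmissible (φ : ℝ → ℂ) : Prop where
  measurable : Measurable φ
  memLp : MemLp φ 2 (volume.restrict (Set.Icc (-(2 * w.radius)) (2 * w.radius)))

variable {w} {φ ψ : ℝ → ℂ}

theorem IsAdmissible.add (hφ : IsAdmissible w φ) (hψ : IsAdmissible w ψ) :
    IsAdmissible w (fun t => φ t + ψ t) :=
  ⟨hφ.1.add hψ.1, hφ.2.add hψ.2⟩

theorem IsAdmissible.const_mul (hφ : IsAdmissible w φ) (r : ℂ) :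
    IsAdmissible w (fun t => r * φ t) :=
  ⟨hφ.1.const_mul r, hφ.2.const_mul r⟩

theorem isAdmissible_of_bounded (hφ : Measurable φ) {m : ℝ}
    (hm : ∀ t, |t| ≤ 2 * w.radius → ‖φ t‖ ≤ m) : IsAdmissible w φ := by
  refine ⟨hφ, MemLp.of_bound hφ.aestronglyMeasurable m
    ((ae_restrict_iff' measurableSet_Icc).2 (Eventually.of_forall fun t ht => hm t ?_))⟩
  exact abs_le.2 ht

theorem measurable_convKernel (hφ : Measurable φ) : Measurable (convKernel w φ) := by
  have := w.measurable
  unfold convKernel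
  fun_prop

/-- Where the kernel is nonzero both points lie in [-r, r], so |x - y| ≤ 2r. By translation
invariance only the L² norm of φ on [-2r, 2r] enters. -/
theorem memLp_convKernel (hφ : IsAdmissible w φ) :
    MemLp (convKernel w φ) 2 (slabMeasure.prod slabMeasure) := by
  have hm := measurable_convKernel (w := w) hφ.1
  refine memLp_two_of_lintegral_lt_top hm.aestronglyMeasurable ?_
  set ψ : ℝ → ℝ≥0∞ := (Set.Icc (-(2 * w.radius)) (2 * w.radius)).indicator fun t => ‖φ t‖ₑ ^ 2
  have hψ : Measurable ψ := (hφ.1.enorm.pow_const 2).indicator measurableSet_Icc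
  have hψi : ∫⁻ t, ψ t < ∞ := by
    rw [lintegral_indicator measurableSet_Icc]
    exact MemLp.lintegral_sq_lt_top hφ.2
  set χ : ℝ → ℝ≥0∞ := (Set.Icc (-w.radius) w.radius).indicator fun _ => ENNReal.ofReal (w.bound ^ 2) ^ 2
  have hχ : Measurable χ := measurable_const.indicator measurableSet_Icc
  have hle : ∀ p : (ℝ × ℝ) × (ℝ × ℝ), ‖convKernel w φ p‖ₑ ^ 2 ≤ χ p.1.1 * ψ (p.1.1 - p.2.1) := by
    intro p
    by_cases h1 : w.radius < |p.1.1|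
    · simp [convKernel, w.supp h1]
    by_cases h2 : w.radius < |p.2.1|
    · simp [convKernel, w.supp h2]
    have h1' := abs_le.1 (not_lt.1 h1)
    have h2' := abs_le.1 (not_lt.1 h2)
    have e1 : χ p.1.1 = ENNReal.ofReal (w.bound ^ 2) ^ 2 :=
      Set.indicator_of_mem (Set.mem_Icc.2 h1') _
    have e2 : ψ (p.1.1 - p.2.1) = ‖φ (p.1.1 - p.2.1)‖ₑ ^ 2 :=
      Set.indicator_of_mem (Set.mem_Icc.2 (by constructor <;> linarith [h1'.1, h1'.2, h2'.1, h2'.2])) _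
    rw [e1, e2, ← mul_pow]
    gcongr
    rw [← ofReal_norm, ← ofReal_norm, ← ENNReal.ofReal_mul (by positivity)]
    refine ENNReal.ofReal_le_ofReal ?_
    have hw1 := w.nonneg p.1.1
    have hw2 := w.nonneg p.2.1
    simp only [convKernel, norm_mul, Complex.norm_real, Real.norm_of_nonneg hw1,
      Real.norm_of_nonneg hw2]
    have hb1 := w.le_bound p.1.1
    have hb2 := w.le_bound p.2.1
    have hb := w.bound_nonneg
    have h3 : w p.1.1 * w p.2.1 ≤ w.bound ^ 2 := by rw [sq]; gcongr
    have h4 : ‖(1 / 2 : ℂ)‖ ≤ 1 := by norm_num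
    calc ‖(1 / 2 : ℂ)‖ * w p.1.1 * ‖φ (p.1.1 - p.2.1)‖ * w p.2.1
        = ‖(1 / 2 : ℂ)‖ * ((w p.1.1 * w p.2.1) * ‖φ (p.1.1 - p.2.1)‖) := by ring
      _ ≤ 1 * (w.bound ^ 2 * ‖φ (p.1.1 - p.2.1)‖) := by gcongr
      _ = _ := one_mul _
  refine (lintegral_mono hle).trans_lt ?_
  have hmeas : Measurable fun p : (ℝ × ℝ) × (ℝ × ℝ) => χ p.1.1 * ψ (p.1.1 - p.2.1) := by fun_prop
  rw [lintegral_prod _ hmeas.aemeasurable]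
  have hin : ∀ q : ℝ × ℝ, ∫⁻ q', χ q.1 * ψ (q.1 - q'.1) ∂slabMeasure = χ q.1 * (2 * ∫⁻ t, ψ t) := by
    intro q
    rw [lintegral_const_mul _ (by fun_prop),
      lintegral_slab_fst (f := fun y => ψ (q.1 - y)) (by fun_prop), lintegral_sub_left_eq_self]
  simp only [hin]
  rw [lintegral_mul_const _ (by fun_prop), lintegral_slab_fst hχ.aemeasurable,
    lintegral_indicator measurableSet_Icc]
  refine ENNReal.mul_lt_top (ENNReal.mul_lt_top (by simp) ?_) (ENNReal.mul_lt_top (by simp) hψi)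
  simp only [lintegral_const, Measure.restrict_apply MeasurableSet.univ, Set.univ_inter,
    Real.volume_Icc]
  exact ENNReal.mul_lt_top (ENNReal.pow_lt_top (by simp)) (by simp)

variable (w) in
open Classical in
/-- The integral operator with kernel `½ w(x) φ(x - y) w(y)` in the slab. -/
def convOp (φ : ℝ → ℂ) : Slab →L[ℂ] Slab :=
  if h : MemLp (convKernel w φ) 2 (slabMeasure.prod slabMeasure) then kernelOp h.toLp else 0

theorem convOp_eq (hφ : IsAdmissible w φ) : convOp w φ = kernelOp (memLp_convKernel hφ).toLp :=
  dif_pos (memLp_convKernel hφ)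

theorem isCompactOperator_convOp (hφ : IsAdmissible w φ) : IsCompactOperator (convOp w φ) := by
  rw [convOp_eq hφ]
  exact isCompactOperator_kernelOp _

theorem convOp_add (hφ : IsAdmissible w φ) (hψ : IsAdmissible w ψ) :
    convOp w (fun t => φ t + ψ t) = convOp w φ + convOp w ψ := by
  rw [convOp_eq hφ, convOp_eq hψ, convOp_eq (hφ.add hψ), ← map_add, ← MemLp.toLp_add]
  congr 1
  refine MemLp.toLp_congr _ _ (Eventually.of_forall fun p => ?_)
  simp only [convKernel, Pi.add_apply]
  ring

theorem convOp_const_mul (hφ : IsAdmissible w φ) (r : ℂ) :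
    convOp w (fun t => r * φ t) = r • convOp w φ := by
  rw [convOp_eq hφ, convOp_eq (hφ.const_mul r), ← map_smul, ← MemLp.toLp_const_smul]
  congr 1
  refine MemLp.toLp_congr _ _ (Eventually.of_forall fun p => ?_)
  simp only [convKernel, Pi.smul_apply, smul_eq_mul]
  ring

theorem isAdmissible_one : IsAdmissible w (fun _ => 1) :=
  isAdmissible_of_bounded measurable_const (m := 1) (by simp)

variable (w) in
/-- The Hilbert–Schmidt norm of the operator with kernel `½ w(x) w(y)`. -/
def Weight.opBound : ℝ := ‖(memLp_convKernel (isAdmissible_one (w := w))).toLp‖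

/-- Pointwise domination of kernels dominates Hilbert–Schmidt norms. A uniform estimate of a symbol
on [-2r, 2r] thus becomes an operator norm estimate. -/
theorem norm_convOp_le (hφ : Measurable φ) {m : ℝ}
    (hm : ∀ t, |t| ≤ 2 * w.radius → ‖φ t‖ ≤ m) : ‖convOp w φ‖ ≤ m * w.opBound := by
  rw [convOp_eq (isAdmissible_of_bounded hφ hm)]
  refine (norm_kernelOp_le _).trans (Lp.norm_le_mul_norm_of_ae_le_mul ?_)
  filter_upwards [(memLp_convKernel (isAdmissible_of_bounded hφ hm)).coeFn_toLp,
    (memLp_convKernel (isAdmissible_one (w := w))).coeFn_toLp] with p h1 h2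
  rw [h1, h2]
  by_cases h1 : w.radius < |p.1.1|
  · simp [convKernel, w.supp h1]
  by_cases h2 : w.radius < |p.2.1|
  · simp [convKernel, w.supp h2]
  have h1' := abs_le.1 (not_lt.1 h1)
  have h2' := abs_le.1 (not_lt.1 h2)
  have h3 := hm (p.1.1 - p.2.1) (abs_le.2 (by constructor <;> linarith [h1'.1, h1'.2, h2'.1, h2'.2]))
  simp only [convKernel, norm_mul, norm_one]
  calc _ ≤ ‖(1 / 2 : ℂ)‖ * ‖(w p.1.1 : ℂ)‖ * m * ‖(w p.2.1 : ℂ)‖ := by gcongr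
    _ = _ := by ring

open ComplexConjugate in
theorem inner_convOp_symm (hφ : IsAdmissible w φ) (hsymm : ∀ t, φ (-t) = conj (φ t)) (u v : Slab) :
    inner ℂ u (convOp w φ v) = inner ℂ (convOp w φ u) v := by
  rw [convOp_eq hφ]
  refine inner_kernelOp_symm _ (fun p => ?_) u v
  have h2 : conj (1 / 2 : ℂ) = 1 / 2 := by
    have := Complex.conj_ofReal (1 / 2)
    push_cast at this
    exact this
  simp only [convKernel, Prod.fst_swap, Prod.snd_swap, map_mul, Complex.conj_ofReal, ← hsymm, h2]
  rw [neg_sub]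
  ring

theorem integral_slab {f : ℝ × ℝ → ℂ} (hf : Integrable f slabMeasure) :
    ∫ q, f q ∂slabMeasure = ∫ x, ∫ μ, f (x, μ) ∂angleMeasure :=
  integral_prod _ hf

/-- The mean value of `f(y, ·)`. -/
def angleMean (f : ℝ × ℝ → ℂ) (y : ℝ) : ℂ := 1 / 2 * ∫ μ, f (y, μ) ∂angleMeasure

theorem coeFn_convOp (hφ : IsAdmissible w φ) (f : Slab) :
    convOp w φ f =ᵐ[slabMeasure] fun q =>
      w q.1 * ∫ y, φ (q.1 - y) * (w y * angleMean f y) := by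
  rw [convOp_eq hφ]
  filter_upwards [coeFn_kernelOp_toLp (memLp_convKernel hφ) f,
    ae_integrable_kernel (memLp_convKernel hφ) (Lp.memLp f)] with q h1 h2
  rw [h1, integral_slab h2, ← integral_const_mul]
  refine integral_congr_ae (Eventually.of_forall fun y => ?_)
  simp only [convKernel, angleMean]
  rw [integral_const_mul]
  ring

/-- Since |log t| t^{1/4} ≤ 4 on (0, 1], the square of the logarithm is at most 16 t^{-1/2}. -/
theorem integrable_sq_log : IntegrableOn (fun t : ℝ => Real.log t ^ 2) (Set.Ioc 0 1) := by
  have h1 : IntegrableOn (fun t : ℝ => t ^ (-(1 / 2) : ℝ) * 16) (Set.Ioc 0 1) := by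
    rw [← intervalIntegrable_iff_integrableOn_Ioc_of_le zero_le_one]
    exact (intervalIntegral.intervalIntegrable_rpow' (by norm_num)).mul_const 16
  refine h1.mono' (Measurable.aestronglyMeasurable (by fun_prop))
    ((ae_restrict_iff' measurableSet_Ioc).2 (Eventually.of_forall fun t ht => ?_))
  have h2 := Real.abs_log_mul_self_rpow_lt t (1 / 4) ht.1 ht.2 (by norm_num)
  have h3 : 0 < t ^ (1 / 4 : ℝ) := Real.rpow_pos_of_pos ht.1 _
  have h4 : t ^ (-(1 / 2) : ℝ) = ((t ^ (1 / 4 : ℝ)) ^ 2)⁻¹ := by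
    rw [← Real.rpow_natCast, ← Real.rpow_mul ht.1.le, Real.rpow_neg ht.1.le]
    norm_num
  have h5 : |Real.log t * t ^ (1 / 4 : ℝ)| ^ 2 ≤ 16 := by
    have : |Real.log t * t ^ (1 / 4 : ℝ)| ≤ 4 := by
      refine h2.le.trans (by norm_num)
    nlinarith [abs_nonneg (Real.log t * t ^ (1 / 4 : ℝ))]
  rw [Real.norm_of_nonneg (sq_nonneg _), h4, ← div_eq_inv_mul, le_div_iff₀ (by positivity)]
  rw [sq_abs, mul_pow] at h5
  exact h5

theorem isAdmissible_log : IsAdmissible w (fun t => (Real.log |t| : ℂ)) := by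
  refine ⟨by fun_prop, ?_⟩
  set R := 2 * w.radius
  have hm : Measurable fun t : ℝ => (Real.log |t| : ℂ) := by fun_prop
  rw [memLp_two_iff_integrable_sq_norm hm.aestronglyMeasurable]
  have hm2 : Measurable fun t : ℝ => ‖(Real.log |t| : ℂ)‖ ^ 2 := hm.norm.pow_const 2
  have h0 : IntegrableOn (fun t : ℝ => ‖(Real.log |t| : ℂ)‖ ^ 2) (Set.Ioc 0 1) := by
    refine integrable_sq_log.congr (Eventually.of_forall fun t => ?_)
    simp [Complex.norm_real]
  have h1 : IntegrableOn (fun t : ℝ => ‖(Real.log |t| : ℂ)‖ ^ 2) (Set.Icc (-1) 1) := by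
    have h2 := h0.comp_neg
    have h3 : IntegrableOn (fun t : ℝ => ‖(Real.log |t| : ℂ)‖ ^ 2) (Set.Icc (-1) 0) := by
      rw [integrableOn_Icc_iff_integrableOn_Ico]
      simpa using h2
    have := h3.union ((integrableOn_Icc_iff_integrableOn_Ioc (by simp)).2 h0)
    rwa [Set.Icc_union_Icc_eq_Icc (by norm_num) (by norm_num)] at this
  have h2 : IntegrableOn (fun t : ℝ => ‖(Real.log |t| : ℂ)‖ ^ 2) (Set.Icc (-R) R \ Set.Icc (-1) 1) := by
    refine Measure.integrableOn_of_bounded (M := (R) ^ 2)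
      ((measure_mono Set.sdiff_subset).trans_lt (by simp)).ne hm2.aestronglyMeasurable
      ((ae_restrict_iff' (measurableSet_Icc.diff measurableSet_Icc)).2
        (Eventually.of_forall fun t ht => ?_))
    have h3 : |t| ≤ R := abs_le.2 ht.1
    have h4 : 1 < |t| := by
      by_contra hlt
      exact ht.2 (abs_le.1 (not_lt.1 hlt))
    have h5 := Real.log_nonneg h4.le
    have h6 := Real.log_le_sub_one_of_pos (zero_lt_one.trans h4)
    rw [Real.norm_of_nonneg (by positivity), Complex.norm_real, Real.norm_of_nonneg h5]
    gcongr
    linarith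
  exact (h1.union h2).mono_set (by rw [Set.union_sdiff_self]; exact Set.subset_union_right)

end WeightedConvolution

/-! ### Absolutely continuous complex functions on the line -/

section AbsolutelyContinuous

theorem absolutelyContinuous_conj {g : ℝ → ℂ} {a b : ℝ} (hg : AbsolutelyContinuousOnInterval g a b) :
    AbsolutelyContinuousOnInterval (fun x => star (g x)) a b := by
  simpa only [AbsolutelyContinuousOnInterval, dist_star_star] using hg

/-- The real statement is applied to the real and imaginary parts on an interval containing a, b and
the base point 0. -/
theorem absolutelyContinuous_integral {f : ℝ → ℂ} (hf : LocallyIntegrable f) (a b : ℝ) :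
    AbsolutelyContinuousOnInterval (fun x => ∫ t in (0 : ℝ)..x, f t) a b := by
  have hi : ∀ p q : ℝ, IntervalIntegrable f volume p q := fun p q =>
    intervalIntegrable_iff.2 ((hf.integrableOn_isCompact isCompact_uIcc).mono_set Set.uIoc_subset_uIcc)
  have hre : IntervalIntegrable (fun t => (f t).re) volume (a ⊓ b ⊓ 0) (a ⊔ b ⊔ 0) :=
    ⟨(hi _ _).1.re, (hi _ _).2.re⟩
  have him : IntervalIntegrable (fun t => (f t).im) volume (a ⊓ b ⊓ 0) (a ⊔ b ⊔ 0) :=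
    ⟨(hi _ _).1.im, (hi _ _).2.im⟩
  have hle : a ⊓ b ⊓ 0 ≤ a ⊔ b ⊔ 0 := inf_le_right.trans le_sup_right
  have hmem : (0 : ℝ) ∈ Set.uIcc (a ⊓ b ⊓ 0) (a ⊔ b ⊔ 0) := by
    rw [Set.uIcc_of_le hle]
    exact ⟨inf_le_right, le_sup_right⟩
  have hsub : Set.uIcc a b ⊆ Set.uIcc (a ⊓ b ⊓ 0) (a ⊔ b ⊔ 0) := by
    rw [Set.uIcc_of_le hle, Set.uIcc]
    exact Set.Icc_subset_Icc inf_le_left le_sup_left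
  have hconst : ∀ k : ℂ, AbsolutelyContinuousOnInterval (fun _ : ℝ => k) a b := fun k => by
    simpa [AbsolutelyContinuousOnInterval] using tendsto_const_nhds
  have h1 := (hre.absolutelyContinuousOnInterval_intervalIntegral hmem).mono hsub
  have h2 := (him.absolutelyContinuousOnInterval_intervalIntegral hmem).mono hsub
  have h3 := (h1.smul (hconst 1)).add (h2.smul (hconst Complex.I))
  refine Eq.subst (motive := fun g : ℝ → ℂ => AbsolutelyContinuousOnInterval g a b) ?_ h3
  funext x
  have e1 := integral_re_add_im (hi 0 x).1
  have e2 := integral_re_add_im (hi 0 x).2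
  simp only [RCLike.re_to_complex, RCLike.im_to_complex, Complex.coe_algebraMap,
    RCLike.I_to_complex] at e1 e2
  simp only [intervalIntegral, Pi.add_apply, Pi.smul_apply', Complex.real_smul]
  rw [← e1, ← e2]
  push_cast
  simp
  ring

/-- The difference of h and the primitive of its derivative is absolutely continuous with zero
derivative almost everywhere, hence constant. -/
theorem intervalIntegral_deriv_eq_sub {h : ℝ → ℂ} {a b : ℝ}
    (hac : ∀ a b, AbsolutelyContinuousOnInterval h a b) (hd : LocallyIntegrable (deriv h)) :
    ∫ x in a..b, deriv h x = h b - h a := by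
  have hi : ∀ p q : ℝ, IntervalIntegrable (deriv h) volume p q := fun p q =>
    intervalIntegrable_iff.2 ((hd.integrableOn_isCompact isCompact_uIcc).mono_set Set.uIoc_subset_uIcc)
  have h1 := (hac a b).sub (absolutelyContinuous_integral hd a b)
  obtain ⟨C, hC⟩ := h1.const_of_ae_hasDerivAt_zero (by
    filter_upwards [LocallyIntegrable.ae_hasDerivAt_integral hd, ae_differentiableAt_of_absolutelyContinuous hac]
      with x hx1 hx2 _
    simpa using hx2.hasDerivAt.sub (hx1 0))
  have ha := hC a Set.left_mem_uIcc
  have hb := hC b Set.right_mem_uIcc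
  simp only [Pi.sub_apply] at ha hb
  have h2 := intervalIntegral.integral_add_adjacent_intervals (hi 0 a) (hi a b)
  linear_combination h2 + ha - hb

/-- The integral of the derivative of an absolutely continuous integrable function vanishes. -/
theorem integral_deriv_eq_zero {h : ℝ → ℂ} (hac : ∀ a b, AbsolutelyContinuousOnInterval h a b)
    (hi : Integrable h) (hd : Integrable (deriv h)) : ∫ x, deriv h x = 0 := by
  have hftc : ∀ a b : ℝ, ∫ x in a..b, deriv h x = h b - h a := fun a b =>
    intervalIntegral_deriv_eq_sub hac hd.locallyIntegrable
  -- Integrability of the derivative gives a limit at infinity; integrability of h forces that limit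
  -- to be 0.
  have htop : Tendsto h atTop (𝓝 0) := by
    have h1 : Tendsto h atTop (𝓝 (h 0 + ∫ x in Set.Ioi (0 : ℝ), deriv h x)) := by
      refine (tendsto_const_nhds.add (intervalIntegral_tendsto_integral_Ioi 0 hd.integrableOn
        tendsto_id)).congr fun x => ?_
      simp [hftc]
    have h2 := IntegrableAtFilter.eq_zero_of_tendsto
      (hi.integrableAtFilter atTop) (fun s hs => by
        obtain ⟨a, ha⟩ := mem_atTop_sets.1 hs
        rw [← top_le_iff, ← Real.volume_Ici (a := a)]
        exact measure_mono ha) h1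
    rwa [h2] at h1
  have hbot : Tendsto h atBot (𝓝 0) := by
    have h1 : Tendsto h atBot (𝓝 (h 0 - ∫ x in Set.Iic (0 : ℝ), deriv h x)) := by
      refine (tendsto_const_nhds.sub (intervalIntegral_tendsto_integral_Iic 0 hd.integrableOn
        tendsto_id)).congr fun x => ?_
      simp [hftc]
    have h2 := IntegrableAtFilter.eq_zero_of_tendsto
      (hi.integrableAtFilter atBot) (fun s hs => by
        obtain ⟨a, ha⟩ := mem_atBot_sets.1 hs
        rw [← top_le_iff, ← Real.volume_Iic (a := a)]
        exact measure_mono ha) h1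
    rwa [h2] at h1
  have h1 := intervalIntegral_tendsto_integral hd tendsto_neg_atTop_atBot tendsto_id
  have h2 : Tendsto (fun R : ℝ => ∫ x in (-R)..R, deriv h x) atTop (𝓝 (0 - 0)) :=
    (htop.sub (hbot.comp tendsto_neg_atTop_atBot)).congr fun R => (hftc (-R) R).symm
  simpa using tendsto_nhds_unique h1 h2

end AbsolutelyContinuous

/-! ### The resolvent of free transport along one direction -/

section Characteristics

/-- `i ∫₀^∞ e^{iwt} f(x + mt) dt`. -/
def raySol (w : ℂ) (m : ℝ) (f : ℝ → ℂ) (x : ℝ) : ℂ :=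
  Complex.I * ∫ t in Set.Ioi (0 : ℝ), Complex.exp (Complex.I * w * t) * f (x + m * t)

variable {w : ℂ} {m : ℝ} {f : ℝ → ℂ}

theorem norm_exp_I_mul (w : ℂ) (t : ℝ) :
    ‖Complex.exp (Complex.I * w * t)‖ = Real.exp (-w.im * t) := by
  rw [Complex.norm_exp]
  simp

theorem memLp_exp_Ioi (hw : 0 < w.im) (a : ℝ) :
    MemLp (fun t : ℝ => Complex.exp (Complex.I * w * t)) 2 (volume.restrict (Set.Ioi a)) := by
  have hc : Continuous fun t : ℝ => Complex.exp (Complex.I * w * t) := by fun_prop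
  rw [memLp_two_iff_integrable_sq_norm hc.aestronglyMeasurable]
  have h := integrableOn_exp_mul_Ioi (a := -(2 * w.im)) (by linarith) a
  refine h.congr (Eventually.of_forall fun t => ?_)
  simp only [norm_exp_I_mul]
  rw [← Real.exp_nat_mul]
  congr 1
  push_cast
  ring

theorem memLp_comp_scale (hm : m ≠ 0) (hf : MemLp f 2 volume) (x : ℝ) :
    MemLp (fun t => f (x + m * t)) 2 volume := by
  have h1 : MemLp (fun t => f (x + t)) 2 volume :=
    hf.comp_measurePreserving (measurePreserving_add_left volume x)
  have hq : Measure.QuasiMeasurePreserving (fun t : ℝ => m * t) volume volume := by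
    refine ⟨by fun_prop, ?_⟩
    rw [Real.map_volume_mul_left hm]
    exact Measure.smul_absolutelyContinuous
  have h2 := (memLp_two_iff_integrable_sq_norm h1.1).1 h1
  exact (memLp_two_iff_integrable_sq_norm (h1.1.comp_quasiMeasurePreserving hq)).2
    (h2.comp_mul_left' hm)

/-- The solution along a ray is absolutely continuous and solves `i m u' = w u + f`. -/
theorem raySol_spec (hw : 0 < w.im) (hm : m ≠ 0) (hf : MemLp f 2 volume) :
    (∀ a b, AbsolutelyContinuousOnInterval (raySol w m f) a b) ∧
      ∀ᵐ x, Complex.I * m * deriv (raySol w m f) x = w * raySol w m f x + f x := by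
  have hm' : (m : ℂ) ≠ 0 := by exact_mod_cast hm
  set G : ℝ → ℂ := fun y => Complex.exp (Complex.I * w * (y / m : ℝ)) * f y
  have hG : LocallyIntegrable G :=
    (hf.locallyIntegrable (by norm_num)).continuous_mul (by fun_prop)
  set Φ : ℝ → ℂ := fun t => Complex.exp (Complex.I * w * t) * f (m * t)
  have hΦ : ∀ a : ℝ, IntegrableOn Φ (Set.Ioi a) := fun a => by
    have := memLp_comp_scale hm hf 0
    simp only [zero_add] at this
    exact (memLp_exp_Ioi hw a).integrable_mul (this.restrict _)
  set C : ℂ := ∫ t in Set.Ioi (0 : ℝ), Φ t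
  -- The variable y = x + mt turns the ray integral into an exponential times a constant minus a
  -- primitive, both visibly absolutely continuous. The oriented integral covers both signs of m.
  have key : raySol w m f = fun x : ℝ => (Complex.I * Complex.exp (-(Complex.I * w * (x / m : ℝ)))) *
      (C - (m : ℂ)⁻¹ * ∫ y in (0 : ℝ)..x, G y) := by
    funext x
    have h1 : ∫ t in Set.Ioi (0 : ℝ), Complex.exp (Complex.I * w * t) * f (x + m * t) =
        Complex.exp (-(Complex.I * w * (x / m : ℝ))) * ∫ t in Set.Ioi (0 : ℝ), Φ (t + x / m) := by
      rw [← integral_const_mul]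
      refine integral_congr_ae (Eventually.of_forall fun t => ?_)
      simp only [Φ]
      rw [← mul_assoc, ← Complex.exp_add]
      congr 2
      · push_cast
        ring
      · field_simp
        ring
    have h2 : ∫ t in Set.Ioi (0 : ℝ), Φ (t + x / m) = ∫ t in Set.Ioi (x / m), Φ t := by
      have := (measurePreserving_add_right volume (x / m)).setIntegral_preimage_emb
        (measurableEmbedding_addRight (x / m)) Φ (Set.Ioi (x / m))
      simpa using this
    have h3 : ∫ t in (0 : ℝ)..x / m, Φ t = (m : ℂ)⁻¹ * ∫ y in (0 : ℝ)..x, G y := by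
      have h4 := intervalIntegral.integral_comp_div (a := 0) (b := x) Φ hm
      have h5 : ∀ y : ℝ, Φ (y / m) = G y := fun y => by
        simp only [Φ, G]
        congr 2
        field_simp
      simp only [h5, zero_div, Complex.real_smul] at h4
      rw [h4, inv_mul_cancel_left₀ hm']
    have h6 := intervalIntegral.integral_Ioi_sub_Ioi' (μ := volume) (f := Φ) (hΦ 0) (hΦ (x / m))
    rw [raySol, h1, h2, ← h3, ← h6]
    simp only [C]
    ring
  have hprim := absolutelyContinuous_integral hG
  have hconst : ∀ (k : ℂ) (a b : ℝ), AbsolutelyContinuousOnInterval (fun _ : ℝ => k) a b :=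
    fun k a b => by simpa [AbsolutelyContinuousOnInterval] using tendsto_const_nhds
  have hexp : ContDiff ℝ 1 fun x : ℝ =>
      Complex.I * Complex.exp (-(Complex.I * w * (x / m : ℝ))) := by
    have : ContDiff ℝ 1 fun x : ℝ => ((x / m : ℝ) : ℂ) :=
      Complex.ofRealCLM.contDiff.comp (contDiff_id.div_const m)
    fun_prop
  have hac : ∀ a b, AbsolutelyContinuousOnInterval (raySol w m f) a b := by
    intro a b
    rw [key]
    exact (hexp.contDiffOn.absolutelyContinuousOnInterval).smul
      ((hconst C a b).sub ((hprim a b).const_smul (m : ℂ)⁻¹))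
  refine ⟨hac, ?_⟩
  filter_upwards [LocallyIntegrable.ae_hasDerivAt_integral hG] with x hx
  have e1 : HasDerivAt (fun x : ℝ => Complex.I * Complex.exp (-(Complex.I * w * (x / m : ℝ))))
      (Complex.I * (Complex.exp (-(Complex.I * w * (x / m : ℝ))) * (-(Complex.I * w * (1 / m : ℝ))))) x := by
    have h1 : HasDerivAt (fun x : ℝ => ((x / m : ℝ) : ℂ)) ((1 / m : ℝ) : ℂ) x :=
      ((hasDerivAt_id' x).div_const m).ofReal_comp
    exact ((h1.const_mul (Complex.I * w)).neg.cexp).const_mul Complex.I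
  have e2 := e1.mul (((hx 0).const_mul (m : ℂ)⁻¹).const_sub C)
  have e3 := e2.congr_of_eventuallyEq (Eventually.of_forall fun y => congrFun key y)
  rw [e3.deriv, congrFun key x]
  have e4 : Complex.exp (-(Complex.I * w * (x / m : ℝ))) * G x = f x := by
    simp only [G]
    rw [← mul_assoc, ← Complex.exp_add]
    simp
  have hn : (m : ℂ) * (m : ℂ)⁻¹ = 1 := mul_inv_cancel₀ hm'
  have hn' : ((1 / m : ℝ) : ℂ) = (m : ℂ)⁻¹ := by simp
  have hI := Complex.I_sq
  rw [hn']
  generalize G x = g at *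
  generalize Complex.exp (-(Complex.I * w * (x / m : ℝ))) = e at *
  generalize C - (m : ℂ)⁻¹ * ∫ y in (0 : ℝ)..x, G y = A at *
  linear_combination (-(Complex.I ^ 3 * w * e * A + Complex.I ^ 2 * e * g)) * hn -
    (Complex.I * w * e * A + e * g) * hI + e4

end Characteristics

/-! ### Free transport: symmetry and solvability -/

section FreeTransport

/-- The solution of `iμ ∂ₓu - z u = f` in the phase space; here `σ = ±1` is the sign of `Im z`. -/
def slabSol (σ : ℝ) (z : ℂ) (f : ℝ × ℝ → ℂ) (q : ℝ × ℝ) : ℂ :=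
  σ * raySol (σ * z) (σ * q.2) (fun y => f (y, q.2)) q.1

theorem lintegral_slab_symm {F : ℝ × ℝ → ℝ≥0∞} (hF : Measurable F) :
    ∫⁻ q, F q ∂slabMeasure = ∫⁻ μ, (∫⁻ x, F (x, μ)) ∂angleMeasure :=
  lintegral_prod_symm' _ hF

theorem integral_slab_symm {F : ℝ × ℝ → ℂ} (hF : Integrable F slabMeasure) :
    ∫ q, F q ∂slabMeasure = ∫ μ, (∫ x, F (x, μ)) ∂angleMeasure :=
  integral_prod_symm _ hF

theorem lintegral_shear {F : ℝ × ℝ → ℝ≥0∞} (hF : Measurable F) (s : ℝ) :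
    ∫⁻ q, F (q.1 + s * q.2, q.2) ∂slabMeasure = ∫⁻ q, F q ∂slabMeasure := by
  rw [slabMeasure, lintegral_prod_symm' _ (by fun_prop), lintegral_prod_symm' _ hF]
  refine lintegral_congr fun μ => ?_
  exact lintegral_add_right_eq_self (fun x => F (x, μ)) (s * μ)

/-- The exponential is split into two equal factors. Cauchy–Schwarz in t spends one on a finite
constant; the other remains as an integrable weight. Tonelli and invariance of the measure under the
shear (x, μ) ↦ (x + sμ, μ) finish the estimate. -/
theorem memLp_slabSol {σ : ℝ} {z : ℂ} (hz : 0 < (σ * z : ℂ).im) (f : Slab) :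
    MemLp (slabSol σ z f) 2 slabMeasure := by
  have hf : StronglyMeasurable (f : ℝ × ℝ → ℂ) := Lp.stronglyMeasurable f
  have hfm : Measurable (f : ℝ × ℝ → ℂ) := hf.measurable
  set w : ℂ := σ * z
  have hmeas : Measurable fun p : (ℝ × ℝ) × ℝ =>
      Complex.exp (Complex.I * w * p.2) * f (p.1.1 + σ * p.1.2 * p.2, p.1.2) := by
    have : Measurable fun p : (ℝ × ℝ) × ℝ => f (p.1.1 + σ * p.1.2 * p.2, p.1.2) :=
      hfm.comp (by fun_prop)
    exact Measurable.mul (by fun_prop) this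
  have hsol : StronglyMeasurable (slabSol σ z f) :=
    ((hmeas.stronglyMeasurable.integral_prod_right'
      (ν := volume.restrict (Set.Ioi (0 : ℝ)))).const_mul Complex.I).const_mul (σ : ℂ)
  refine memLp_two_of_lintegral_lt_top hsol.aestronglyMeasurable ?_
  set e : ℝ → ℂ := fun t => Complex.exp (Complex.I * (w / 2) * t)
  have he2 : ∀ t : ℝ, Complex.exp (Complex.I * w * t) = e t * e t := fun t => by
    simp only [e]
    rw [← Complex.exp_add]
    congr 1
    ring
  have hw2 : 0 < (w / 2).im := by
    simp only [Complex.div_ofNat_im]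
    linarith
  have he : MemLp e 2 (volume.restrict (Set.Ioi (0 : ℝ))) := memLp_exp_Ioi hw2 0
  set A := ∫⁻ t in Set.Ioi (0 : ℝ), ‖e t‖ₑ ^ 2
  have hA : A < ∞ := MemLp.lintegral_sq_lt_top he
  have hem : Measurable e := by fun_prop
  have hbound : ∀ q : ℝ × ℝ, ‖slabSol σ z f q‖ₑ ^ 2 ≤
      ‖(σ : ℂ)‖ₑ ^ 2 * (A * ∫⁻ t in Set.Ioi (0 : ℝ), ‖e t‖ₑ ^ 2 * ‖f (q.1 + σ * t * q.2, q.2)‖ₑ ^ 2) := by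
    intro q
    have hg : Measurable fun t : ℝ => e t * f (q.1 + σ * q.2 * t, q.2) :=
      hem.mul (hfm.comp (by fun_prop))
    have h1 := enorm_integral_mul_le (ν := volume.restrict (Set.Ioi (0 : ℝ)))
      hem.aestronglyMeasurable hg.aestronglyMeasurable
    have h2 : slabSol σ z f q = σ * (Complex.I *
        ∫ t in Set.Ioi (0 : ℝ), e t * (e t * f (q.1 + σ * q.2 * t, q.2))) := by
      rw [slabSol, raySol]
      congr 2
      refine integral_congr_ae (Eventually.of_forall fun t => ?_)
      simp only
      rw [← mul_assoc (e t), ← he2]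
    have hI : ‖Complex.I‖ₑ = 1 := by rw [← ofReal_norm]; simp
    rw [h2, enorm_mul, enorm_mul, hI, one_mul, mul_pow]
    gcongr
    refine (pow_le_pow_left' h1 2).trans (le_of_eq ?_)
    rw [mul_pow, eLpNorm_two_sq, eLpNorm_two_sq]
    congr 1
    refine lintegral_congr fun t => ?_
    rw [enorm_mul, mul_pow, mul_right_comm σ]
  refine (lintegral_mono hbound).trans_lt ?_
  have hm3 : Measurable fun p : (ℝ × ℝ) × ℝ =>
      ‖e p.2‖ₑ ^ 2 * ‖f (p.1.1 + σ * p.2 * p.1.2, p.1.2)‖ₑ ^ 2 := by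
    have : Measurable fun p : (ℝ × ℝ) × ℝ => f (p.1.1 + σ * p.2 * p.1.2, p.1.2) :=
      hfm.comp (by fun_prop)
    fun_prop
  rw [lintegral_const_mul _ ((hm3.lintegral_prod_right').const_mul A),
    lintegral_const_mul _ hm3.lintegral_prod_right', lintegral_lintegral_swap hm3.aemeasurable]
  have hin : ∀ t : ℝ, ∫⁻ q, ‖e t‖ₑ ^ 2 * ‖f (q.1 + σ * t * q.2, q.2)‖ₑ ^ 2 ∂slabMeasure =
      ‖e t‖ₑ ^ 2 * ∫⁻ q, ‖f q‖ₑ ^ 2 ∂slabMeasure := by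
    intro t
    have hfm2 : Measurable fun q => ‖f q‖ₑ ^ 2 := hfm.enorm.pow_const 2
    have hfm3 : Measurable fun q : ℝ × ℝ => ‖f (q.1 + σ * t * q.2, q.2)‖ₑ ^ 2 :=
      hfm2.comp (by fun_prop : Measurable fun q : ℝ × ℝ => (q.1 + σ * t * q.2, q.2))
    rw [lintegral_const_mul _ hfm3, lintegral_shear hfm2]
  simp only [hin]
  rw [lintegral_mul_const _ (by fun_prop)]
  exact ENNReal.mul_lt_top (ENNReal.pow_lt_top (by simp)) (ENNReal.mul_lt_top hA
    (ENNReal.mul_lt_top hA (MemLp.lintegral_sq_lt_top (Lp.memLp f))))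

theorem ae_angle_ne_zero : ∀ᵐ μ ∂angleMeasure, μ ≠ 0 :=
  ae_restrict_of_ae (by simp [ae_iff])

theorem ae_memLp_ray (f : Slab) : ∀ᵐ μ ∂angleMeasure, MemLp (fun x => f (x, μ)) 2 volume := by
  have hf : Measurable (f : ℝ × ℝ → ℂ) := (Lp.stronglyMeasurable f).measurable
  have h1 := MemLp.lintegral_sq_lt_top (Lp.memLp f)
  rw [lintegral_slab_symm (hf.enorm.pow_const 2)] at h1
  filter_upwards [ae_lt_top ((hf.enorm.pow_const 2).lintegral_prod_left') h1.ne] with μ hμ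
  exact memLp_two_of_lintegral_lt_top (hf.comp (by fun_prop)).aestronglyMeasurable hμ

/-- Changing the signs of z and μ together reduces Im z < 0 to Im z > 0, so one ray formula solves
the equation in both half-planes. The exceptional direction μ = 0 is a null set. -/
theorem slabSol_mem_graph {σ : ℝ} (hσ : σ ^ 2 = 1) {z : ℂ} (hz : 0 < (σ * z : ℂ).im) (f : Slab) :
    ((memLp_slabSol hz f).toLp, f + z • (memLp_slabSol hz f).toLp) ∈ freeTransportGraph := by
  set u : Slab := (memLp_slabSol hz f).toLp
  change IsFreeTransport u (f + z • u)
  have hσ0 : σ ≠ 0 := by rintro rfl; norm_num at hσ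
  have hσ' : (σ : ℂ) * σ = 1 := by rw [← sq]; exact_mod_cast hσ
  filter_upwards [ae_angle_ne_zero, ae_memLp_ray f,
    ae_ae_of_ae_slab (memLp_slabSol hz f).coeFn_toLp,
    ae_ae_of_ae_slab (Lp.coeFn_add f (z • u)), ae_ae_of_ae_slab (Lp.coeFn_smul z u)]
    with μ h0 hf hu h1 h2
  obtain ⟨hac, hd⟩ := raySol_spec hz (mul_ne_zero hσ0 h0) hf
  refine ⟨fun x => (σ : ℂ) • raySol (σ * z) (σ * μ) (fun y => f (y, μ)) x,
    fun a b => (hac a b).const_smul (σ : ℂ), ?_, ?_⟩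
  · filter_upwards [hu] with x hx
    exact hx
  · filter_upwards [hu, h1, h2, hd] with x hx h1x h2x hdx
    have hds : deriv (fun x => (σ : ℂ) • raySol (σ * z) (σ * μ) (fun y => f (y, μ)) x) x =
        σ * deriv (raySol (σ * z) (σ * μ) fun y => f (y, μ)) x := by simp
    rw [h1x, Pi.add_apply, h2x, Pi.smul_apply, hx, slabSol, hds]
    simp only [smul_eq_mul]
    push_cast at hdx
    linear_combination (-1 : ℂ) * hdx

open ComplexConjugate in
/-- Free transport is symmetric. -/
theorem inner_freeTransport_symm {u w u' w' : Slab} (h : (u, w) ∈ freeTransportGraph)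
    (h' : (u', w') ∈ freeTransportGraph) : inner ℂ w u' = (inner ℂ u w' : ℂ) := by
  rw [← sub_eq_zero, L2.inner_def, L2.inner_def,
    ← integral_sub (L2.integrable_inner w u') (L2.integrable_inner u w')]
  refine (integral_slab_symm ((L2.integrable_inner w u').sub (L2.integrable_inner u w'))).trans ?_
  refine integral_eq_zero_of_ae ?_
  filter_upwards [h, h', ae_angle_ne_zero, ae_memLp_ray u, ae_memLp_ray w, ae_memLp_ray u',
    ae_memLp_ray w'] with μ ⟨g, hg, hu, hw⟩ ⟨g', hg', hu', hw'⟩ h0 m1 m2 m3 m4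
  have h0' : Complex.I * μ ≠ 0 := mul_ne_zero Complex.I_ne_zero (by exact_mod_cast h0)
  have n1 : MemLp g 2 volume := m1.ae_eq hu
  have n3 : MemLp g' 2 volume := m3.ae_eq hu'
  have n2 : MemLp (deriv g) 2 volume := by
    refine (m2.const_mul (Complex.I * μ)⁻¹).ae_eq ?_
    filter_upwards [hw] with x hx
    rw [hx, inv_mul_cancel_left₀ h0']
  have n4 : MemLp (deriv g') 2 volume := by
    refine (m4.const_mul (Complex.I * μ)⁻¹).ae_eq ?_
    filter_upwards [hw'] with x hx
    rw [hx, inv_mul_cancel_left₀ h0']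
  -- For fixed μ ≠ 0 the defect of symmetry is a multiple of the derivative of k. Dividing by iμ
  -- puts both derivatives in L², so k and its derivative are integrable and the integral of the
  -- derivative vanishes.
  set k : ℝ → ℂ := fun x => star (g x) * g' x
  have hk : ∀ᵐ x, deriv k x = star (deriv g x) * g' x + star (g x) * deriv g' x := by
    filter_upwards [ae_differentiableAt_of_absolutelyContinuous hg,
      ae_differentiableAt_of_absolutelyContinuous hg'] with x d1 d2
    exact (d1.hasDerivAt.star.mul d2.hasDerivAt).deriv
  have hkint : Integrable k := n1.star.integrable_mul n3
  have hkd : Integrable (deriv k) :=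
    ((n2.star.integrable_mul n3).add (n1.star.integrable_mul n4)).congr (by
      filter_upwards [hk] with x hx
      exact hx.symm)
  have hz : ∫ x, deriv k x = 0 := integral_deriv_eq_zero (fun a b => (absolutelyContinuous_conj (hg a b)).smul (hg' a b))
    hkint hkd
  have e : ∀ᵐ x, inner ℂ (w (x, μ)) (u' (x, μ)) - inner ℂ (u (x, μ)) (w' (x, μ)) =
      -(Complex.I * μ) * deriv k x := by
    filter_upwards [hu, hw, hu', hw', hk] with x a1 a2 a3 a4 a5
    rw [a1, a2, a3, a4, a5]
    simp only [RCLike.inner_apply, map_mul, Complex.conj_I, Complex.conj_ofReal, RCLike.star_def]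
    ring
  simp only [Pi.sub_apply, Pi.zero_apply]
  rw [integral_congr_ae e, integral_const_mul, hz, mul_zero]

end FreeTransport

/-! ### Symmetric operators with full range and their resolvents -/

section SymmetricOperators

variable {H : Type*} [NormedAddCommGroup H] [InnerProductSpace ℂ H]

/-- A symmetric operator `A` for which `A - z` is onto for all nonreal `z`. -/
structure IsFullySymmetric (A : H →ₗ.[ℂ] H) : Prop where
  symm : ∀ u v : A.domain, inner ℂ (A u) (v : H) = inner ℂ (u : H) (A v)
  surj : ∀ z : ℂ, z.im ≠ 0 → ∀ f : H, ∃ u : A.domain, A u - z • (u : H) = f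

variable {A : H →ₗ.[ℂ] H}

theorem IsFullySymmetric.inner_sub_smul (hA : IsFullySymmetric A) (z : ℂ) (u v : A.domain) :
    inner ℂ (A u - z • (u : H)) (v : H) =
      inner ℂ (u : H) (A v - (starRingEnd ℂ z) • (v : H)) := by
  rw [inner_sub_left, inner_sub_right, hA.symm, inner_smul_left, inner_smul_right]

theorem IsFullySymmetric.im_inner (hA : IsFullySymmetric A) (u : A.domain) :
    (inner ℂ (A u) (u : H)).im = 0 := by
  have h := inner_conj_symm (𝕜 := ℂ) (u : H) (A u)
  rw [← hA.symm] at h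
  exact Complex.conj_eq_iff_im.1 h

theorem IsFullySymmetric.mul_norm_le (hA : IsFullySymmetric A) (z : ℂ)
    (u : A.domain) : z.im * ‖(u : H)‖ ≤ ‖A u - z • (u : H)‖ := by
  -- The inner product is conjugate linear in its first slot, so -z contributes +Im z.
  have h1 : (inner ℂ (A u - z • (u : H)) (u : H)).im = z.im * ‖(u : H)‖ ^ 2 := by
    rw [inner_sub_left, inner_smul_left, inner_self_eq_norm_sq_to_K, Complex.sub_im, hA.im_inner]
    change 0 - (starRingEnd ℂ z * ((‖(u : H)‖ : ℝ) : ℂ) ^ 2).im = _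
    rw [← Complex.ofReal_pow, Complex.im_mul_ofReal]
    simp
  have h2 : z.im * ‖(u : H)‖ ^ 2 ≤ ‖A u - z • (u : H)‖ * ‖(u : H)‖ := by
    rw [← h1]
    exact ((le_abs_self _).trans (Complex.abs_im_le_norm _)).trans (norm_inner_le_norm _ _)
  rcases (norm_nonneg (u : H)).eq_or_lt with h0 | h0
  · rw [← h0, mul_zero]; exact norm_nonneg _
  · nlinarith

variable [CompleteSpace H]

/-- If v is orthogonal to the domain and (A - i)u = v, then u is orthogonal to the range of A + i,
which is everything; so u = 0 and v = 0. -/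
theorem IsFullySymmetric.dense (hA : IsFullySymmetric A) : Dense (A.domain : Set H) := by
  rw [Submodule.dense_iff_topologicalClosure_eq_top, Submodule.topologicalClosure_eq_top_iff,
    Submodule.eq_bot_iff]
  intro v hv
  obtain ⟨u, hu⟩ := hA.surj Complex.I (by simp) v
  have h1 : ∀ f : H, inner ℂ (u : H) f = 0 := by
    intro f
    obtain ⟨t, rfl⟩ := hA.surj (starRingEnd ℂ Complex.I) (by simp) f
    rw [← hA.inner_sub_smul, hu, ← inner_conj_symm, (Submodule.mem_orthogonal _ _).1 hv t t.2,
      map_zero]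
  have h2 : (u : H) = 0 := inner_self_eq_zero.1 (h1 u)
  have h3 : u = 0 := Subtype.ext h2
  rw [← hu, h3]
  simp

/-- The classical criterion for selfadjointness, with a bounded perturbation carried along. Used
twice, it identifies T* = L** with L. -/
theorem IsFullySymmetric.adjoint_vadd (hA : IsFullySymmetric A) (B : H →L[ℂ] H) :
    (B.toLinearMap +ᵥ A)† = B.adjoint.toLinearMap +ᵥ A := by
  have hd : Dense ((B.toLinearMap +ᵥ A).domain : Set H) := hA.dense
  have hf : (B.toLinearMap +ᵥ A).IsFormalAdjoint (B.adjoint.toLinearMap +ᵥ A) := by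
    intro u v
    rw [LinearPMap.vadd_apply, LinearPMap.vadd_apply, inner_add_left, inner_add_right]
    congr 1
    · exact (ContinuousLinearMap.adjoint_inner_right B _ _).symm
    · exact hA.symm u v
  refine le_antisymm ?_ (hf.le_adjoint hd)
  have key : ∀ y : ((B.toLinearMap +ᵥ A)†).domain, (y : H) ∈ A.domain := by
    intro y
    set w := (B.toLinearMap +ᵥ A)† y with hw
    -- The vector v in the domain of A satisfies the equation that y satisfies weakly; hence v - y
    -- is orthogonal to the range of A + i, and y = v.
    obtain ⟨v, hv⟩ := hA.surj Complex.I (by simp)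
      (w - B.adjoint (y : H) - Complex.I • (y : H))
    have h1 : ∀ u : A.domain, inner ℂ ((v : H) - y) (A u - starRingEnd ℂ Complex.I • (u : H)) = 0 := by
      intro u
      have h2 : inner ℂ w (u : H) = inner ℂ (y : H) (B (u : H) + A u) :=
        LinearPMap.adjoint_isFormalAdjoint hd y u
      rw [inner_sub_left, ← hA.inner_sub_smul, hv, inner_sub_left, inner_sub_left, h2,
        ContinuousLinearMap.adjoint_inner_left, inner_smul_left, inner_add_right, inner_sub_right,
        inner_smul_right]
      ring
    obtain ⟨u, hu⟩ := hA.surj (starRingEnd ℂ Complex.I) (by simp) ((v : H) - y)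
    have h3 := h1 u
    rw [hu, inner_self_eq_zero, sub_eq_zero] at h3
    rw [← h3]
    exact v.2
  refine ⟨fun y hy => key ⟨y, hy⟩, fun y y' hyy => ?_⟩
  have hle := hf.le_adjoint hd
  exact (hle.2 (x := y') (y := y) hyy.symm).symm

omit [CompleteSpace H] in
theorem IsResolventAt.unique {z : ℂ} {R R' : H →L[ℂ] H} (h : IsResolventAt A z R)
    (h' : IsResolventAt A z R') : R = R' := by
  ext f
  obtain ⟨u, hu, hf⟩ := h.1 f
  rw [← hu, ← h'.2 u, hf]

omit [CompleteSpace H] in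
theorem IsResolventAt.resolventOp_eq {z : ℂ} {R : H →L[ℂ] H} (h : IsResolventAt A z R) :
    resolventOp A z = R := by
  have hex : ∃ R : H →L[ℂ] H, IsResolventAt A z R := ⟨R, h⟩
  rw [resolventOp, dif_pos hex]
  exact hex.choose_spec.unique h

omit [CompleteSpace H] in
theorem IsFullySymmetric.exists_isResolventAt (hA : IsFullySymmetric A) {z : ℂ} (hz : 0 < z.im) :
    ∃ R : H →L[ℂ] H, IsResolventAt A z R := by
  choose u hu using hA.surj z hz.ne'
  have huniq : ∀ v : A.domain, u (A v - z • (v : H)) = v := by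
    intro v
    have h1 := hA.mul_norm_le z (u (A v - z • (v : H)) - v)
    have h2 : A (u (A v - z • (v : H)) - v) -
        z • ((u (A v - z • (v : H)) - v : A.domain) : H) = 0 := by
      have := hu (A v - z • (v : H))
      rw [LinearPMap.map_sub, Submodule.coe_sub, smul_sub]
      rw [sub_sub_sub_comm, this, sub_self]
    rw [h2, norm_zero] at h1
    have h3 : ‖((u (A v - z • (v : H)) - v : A.domain) : H)‖ = 0 :=
      le_antisymm (by nlinarith [norm_nonneg ((u (A v - z • (v : H)) - v : A.domain) : H)])
        (norm_nonneg _)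
    rw [norm_eq_zero] at h3
    have h4 : u (A v - z • (v : H)) - v = 0 := Subtype.ext h3
    exact sub_eq_zero.1 h4
  let R : H →L[ℂ] H := LinearMap.mkContinuous
    { toFun := fun f => (u f : H)
      map_add' := by
        intro f g
        have : u (f + g) = u f + u g := by
          rw [← huniq (u f + u g)]
          congr 1
          rw [LinearPMap.map_add, Submodule.coe_add, smul_add, add_sub_add_comm, hu, hu]
        rw [this]; rfl
      map_smul' := by
        intro r f
        have : u (r • f) = r • u f := by
          rw [← huniq (r • u f)]
          congr 1
          rw [LinearPMap.map_smul, Submodule.coe_smul, smul_comm z r, ← smul_sub, hu]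
        rw [this]; rfl }
    (z.im⁻¹) (by
      intro f
      have := hA.mul_norm_le z (u f)
      rw [hu] at this
      change ‖(u f : H)‖ ≤ _
      rw [inv_mul_eq_div, le_div_iff₀ hz]
      linarith)
  refine ⟨R, fun f => ⟨u f, rfl, hu f⟩, fun v => ?_⟩
  change ((u (A v - z • (v : H)) : A.domain) : H) = v
  rw [huniq]

end SymmetricOperators

/-! ### Compressions to a subspace -/

section Compression

variable {H : Type*} [NormedAddCommGroup H] [InnerProductSpace ℂ H]

/-- The part of a bounded operator in the subspace `K`. -/
def compress (K : Submodule ℂ H) [K.HasOrthogonalProjection] (X : H →L[ℂ] H) : K →L[ℂ] K :=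
  K.orthogonalProjectionOnto ∘L X ∘L K.subtypeL

variable (K : Submodule ℂ H) [K.HasOrthogonalProjection] (X Y : H →L[ℂ] H)

theorem inner_compress (u v : K) : inner ℂ u (compress K X v) = inner ℂ (u : H) (X (v : H)) :=
  Submodule.inner_orthogonalProjectionOnto_eq_of_mem_left u _

theorem compress_add : compress K (X + Y) = compress K X + compress K Y := by
  ext v; simp [compress]

theorem compress_sub : compress K (X - Y) = compress K X - compress K Y := by
  ext v; simp [compress]

theorem compress_neg : compress K (-X) = -compress K X := by
  ext v; simp [compress]

theorem compress_smul (r : ℂ) : compress K (r • X) = r • compress K X := by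
  ext v; simp [compress]

theorem compress_one : compress K (1 : H →L[ℂ] H) = 1 := by
  ext v; simp [compress]

theorem norm_compress_le : ‖compress K X‖ ≤ ‖X‖ := by
  refine ContinuousLinearMap.opNorm_le_bound _ (norm_nonneg _) fun v => ?_
  exact (K.norm_orthogonalProjectionOnto_apply_le _).trans (X.le_opNorm _)

variable {K X Y}

theorem coe_compress_apply (hX : ∀ v, X v ∈ K) (v : K) : (compress K X v : H) = X v :=
  congrArg Subtype.val (K.orthogonalProjectionOnto_mem_subspace_eq_self ⟨X v, hX v⟩)

theorem compress_mul (hY : ∀ v, Y v ∈ K) : compress K (X * Y) = compress K X * compress K Y := by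
  ext v
  change ((K.orthogonalProjectionOnto (X (Y v)) : K) : H) =
    ((K.orthogonalProjectionOnto (X (compress K Y v)) : K) : H)
  rw [coe_compress_apply hY]

theorem isCompactOperator_compress (hX : IsCompactOperator X) :
    IsCompactOperator (compress K X) :=
  (hX.comp_clm K.subtypeL).clm_comp K.orthogonalProjectionOnto

end Compression

/-! ### The Cayley transform formula for the characteristic function -/

section CharacteristicFunctionFormula

variable {H : Type*} [NormedAddCommGroup H] [InnerProductSpace ℂ H] {A : H →ₗ.[ℂ] H}

/-- `-i W R W`. -/
def sandwich (W R : H →L[ℂ] H) : H →L[ℂ] H := -(Complex.I • (W * R * W))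

/-- Coercivity ‖u‖² ≤ Re⟨u, (1 + B)u⟩ gives invertibility, and with Cauchy–Schwarz the norm bound.
-/
theorem isUnit_one_add_of_re_inner_nonneg {B : H →L[ℂ] H} [CompleteSpace H]
    (hB : ∀ u, 0 ≤ (inner ℂ u (B u)).re) :
    IsUnit (1 + B) ∧ ‖Ring.inverse (1 + B)‖ ≤ 1 := by
  have h1 : ∀ u, ‖u‖ ^ 2 ≤ ‖inner ℂ ((1 + B) u) u‖ := by
    intro u
    have h2 : (inner ℂ u ((1 + B) u)).re = ‖u‖ ^ 2 + (inner ℂ u (B u)).re := by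
      change (inner ℂ u (u + B u)).re = _
      rw [inner_add_right, Complex.add_re]
      congr 1
      exact inner_self_eq_norm_sq (𝕜 := ℂ) u
    rw [norm_inner_symm]
    calc ‖u‖ ^ 2 ≤ (inner ℂ u ((1 + B) u)).re := by rw [h2]; linarith [hB u]
      _ ≤ _ := (le_abs_self _).trans (Complex.abs_re_le_norm _)
  have hu : IsUnit (1 + B) :=
    ContinuousLinearMap.isUnit_of_forall_le_norm_inner_map (c := 1) _ one_pos (fun u => by
      rw [NNReal.coe_one, mul_one]; exact h1 u)
  refine ⟨hu, ContinuousLinearMap.opNorm_le_bound _ zero_le_one fun v => ?_⟩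
  set u := Ring.inverse (1 + B) v
  have h3 : (1 + B) u = v := congrArg (fun X : H →L[ℂ] H => X v) (Ring.mul_inverse_cancel _ hu)
  have h4 := (h1 u).trans (norm_inner_le_norm _ _)
  rw [h3] at h4
  rw [one_mul]
  rcases (norm_nonneg u).eq_or_lt with h0 | h0
  · rw [← h0]; exact norm_nonneg _
  · nlinarith

variable [CompleteSpace H]

/-- With g = RWu the real part equals Im⟨(A - z)g, g⟩ = Im z ‖g‖². -/
theorem IsFullySymmetric.re_inner_sandwich_nonneg (hA : IsFullySymmetric A) {z : ℂ} (hz : 0 < z.im)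
    {R W : H →L[ℂ] H} (hR : IsResolventAt A z R) (hW : IsSelfAdjoint W) (u : H) :
    0 ≤ (inner ℂ u (sandwich W R u)).re := by
  obtain ⟨g, hg, hf⟩ := hR.1 (W u)
  have h1 : inner ℂ u (W (R (W u))) = inner ℂ (W u) (R (W u)) := by
    rw [← ContinuousLinearMap.adjoint_inner_left, ← ContinuousLinearMap.star_eq_adjoint,
      hW.star_eq]
  change 0 ≤ (inner ℂ u (-(Complex.I • W (R (W u))))).re
  rw [inner_neg_right, inner_smul_right, h1, ← hg, ← hf, inner_sub_left, inner_smul_left,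
    inner_self_eq_norm_sq_to_K]
  change 0 ≤ (-(Complex.I * (inner ℂ (A g) (g : H) -
    starRingEnd ℂ z * ((‖(g : H)‖ : ℝ) : ℂ) ^ 2))).re
  have h2 := hA.im_inner g
  rw [← Complex.ofReal_pow, Complex.neg_re, Complex.mul_re, Complex.I_re, Complex.I_im,
    Complex.sub_im, h2, Complex.im_mul_ofReal]
  simp only [Complex.conj_im]
  nlinarith [mul_nonneg hz.le (sq_nonneg ‖(g : H)‖)]

/-- The resolvent of `A - i W²`. -/
theorem IsFullySymmetric.isResolventAt_sub (hA : IsFullySymmetric A) {z : ℂ} (hz : 0 < z.im)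
    {R W V : H →L[ℂ] H} (hR : IsResolventAt A z R) (hW : IsSelfAdjoint W) (hV : W * W = V) :
    IsResolventAt ((-(Complex.I • V) : H →L[ℂ] H).toLinearMap +ᵥ A) z
      (R + Complex.I • (R * W * Ring.inverse (1 + sandwich W R) * (W * R))) := by
  obtain ⟨hu, -⟩ := isUnit_one_add_of_re_inner_nonneg (hA.re_inner_sandwich_nonneg hz hR hW)
  set N := Ring.inverse (1 + sandwich W R) with hN
  have hNl : N * (1 + sandwich W R) = 1 := Ring.inverse_mul_cancel _ hu
  have hNr : (1 + sandwich W R) * N = 1 := Ring.mul_inverse_cancel _ hu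
  have hVa : ∀ x, V x = W (W x) := fun x => by rw [← hV]; rfl
  -- If (A - z)d = iVd with V = W², then d = iRW(Wd). Applying W gives (1 + B)Wd = 0 for B = -iWRW,
  -- so Wd = 0 and d = 0.
  have hinj : ∀ d : A.domain, A d - z • (d : H) - Complex.I • V d = 0 → (d : H) = 0 := by
    intro d hd
    have h1 : (d : H) = Complex.I • R (W (W d)) := by
      calc (d : H) = R (A d - z • (d : H)) := (hR.2 d).symm
        _ = _ := by rw [sub_eq_zero.1 hd, map_smul, hVa]
    have h2 : (1 + sandwich W R) (W d) = 0 := by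
      change W d + -(Complex.I • W (R (W (W d)))) = 0
      rw [← sub_eq_add_neg, ← map_smul]
      exact sub_eq_zero.2 (congrArg W h1)
    have h3 : W d = 0 := by
      have := congrArg (fun X : H →L[ℂ] H => X (W d)) hNl
      change N ((1 + sandwich W R) (W d)) = W d at this
      rw [← this, h2, map_zero]
    rw [h1, h3]; simp
  have hex : ∀ f : H, ∃ u : A.domain,
      (u : H) = (R + Complex.I • (R * W * N * (W * R))) f ∧
        A u - z • (u : H) - Complex.I • V u = f := by
    intro f
    -- The solution is u₁ + iu₂: the free solution plus the correction that the factorisation V =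
    -- W·W reduces to inverting 1 + B.
    obtain ⟨u1, hu1, hf1⟩ := hR.1 f
    obtain ⟨u2, hu2, hf2⟩ := hR.1 (W (N (W (R f))))
    have hval : ((u1 + Complex.I • u2 : A.domain) : H) =
        (R + Complex.I • (R * W * N * (W * R))) f := by
      rw [Submodule.coe_add, Submodule.coe_smul, hu1, hu2]; rfl
    refine ⟨u1 + Complex.I • u2, hval, ?_⟩
    have h3 : A (u1 + Complex.I • u2) - z • ((u1 + Complex.I • u2 : A.domain) : H) =
        f + Complex.I • W (N (W (R f))) := by
      rw [← hf2, ← hf1, LinearPMap.map_add, LinearPMap.map_smul, Submodule.coe_add,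
        Submodule.coe_smul, smul_add, smul_sub, smul_comm z Complex.I]
      abel
    rw [h3, hVa, Submodule.coe_add, Submodule.coe_smul, hu1, hu2]
    have h4 := congrArg (fun X : H →L[ℂ] H => W (X (W (R f)))) hNr
    change W (N (W (R f)) + -(Complex.I • W (R (W (N (W (R f))))))) = W (W (R f)) at h4
    rw [map_add, map_neg, map_smul] at h4
    rw [map_add, map_add, map_smul, map_smul, ← h4]
    simp only [smul_add, smul_neg]
    abel
  have happ : ∀ u : A.domain, ((-(Complex.I • V) : H →L[ℂ] H).toLinearMap +ᵥ A) u - z • (u : H) =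
      A u - z • (u : H) - Complex.I • V u := by
    intro u
    rw [LinearPMap.vadd_apply]
    change -(Complex.I • V u) + A u - z • (u : H) = _
    abel
  refine ⟨fun f => ?_, fun u => ?_⟩
  · obtain ⟨u, h1, h2⟩ := hex f
    exact ⟨u, h1, (happ u).trans h2⟩
  · obtain ⟨v, h1, h2⟩ := hex (((-(Complex.I • V) : H →L[ℂ] H).toLinearMap +ᵥ A) u - z • (u : H))
    rw [← h1]
    have h3 := h2.trans (happ u)
    have h4 : A (v - u) - z • ((v - u : A.domain) : H) - Complex.I • V ((v - u : A.domain) : H)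
        = 0 := by
      rw [LinearPMap.map_sub, Submodule.coe_sub, map_sub, smul_sub, smul_sub,
        ← sub_eq_zero.2 h3]
      abel
    have h5 := hinj _ h4
    rw [Submodule.coe_sub, sub_eq_zero] at h5
    exact h5

theorem IsFullySymmetric.adjoint_adjoint (hA : IsFullySymmetric A) (V : H →L[ℂ] H) :
    ((-(Complex.I • V) : H →L[ℂ] H).toLinearMap +ᵥ A)†† =
      (-(Complex.I • V) : H →L[ℂ] H).toLinearMap +ᵥ A := by
  rw [hA.adjoint_vadd, hA.adjoint_vadd, ContinuousLinearMap.adjoint_adjoint]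

/-- With N = (1 + B)⁻¹ the resolvent formula gives W(T* - z)⁻¹W = iBN, so S = 1 - 2BN and S(1 + B) =
1 - B. In product form the identity passes to E because B maps into E; no inverse has to be
compressed. -/
theorem characteristicFunction_mul (hA : IsFullySymmetric A) {V W : H →L[ℂ] H} (hW0 : 0 ≤ W)
    (hmul : W * W = V) {z : ℂ} (hz : 0 < z.im) {R : H →L[ℂ] H} (hR : IsResolventAt A z R) :
    characteristicFunction ((-(Complex.I • V) : H →L[ℂ] H).toLinearMap +ᵥ A)† V z *
      (1 + compress (defectSpace V) (sandwich W R)) =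
      1 - compress (defectSpace V) (sandwich W R) := by
  have hW : IsSelfAdjoint W := IsSelfAdjoint.of_nonneg hW0
  have hV : 0 ≤ V := hmul ▸ hW.mul_self_nonneg
  have hsqrt : CFC.sqrt V = W := CFC.sqrt_unique hmul hW0
  have hran : ∀ v, W v ∈ defectSpace V := fun v => hsqrt ▸ sqrt_apply_mem_defectSpace hV v
  rw [characteristicFunction, hsqrt, hA.adjoint_adjoint,
    (hA.isResolventAt_sub hz hR hW hmul).resolventOp_eq]
  obtain ⟨hu, -⟩ := isUnit_one_add_of_re_inner_nonneg (hA.re_inner_sandwich_nonneg hz hR hW)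
  set N := Ring.inverse (1 + sandwich W R) with hN
  have hNl : N * (1 + sandwich W R) = 1 := Ring.inverse_mul_cancel _ hu
  set B := sandwich W R with hB
  have hmem : ∀ v, B v ∈ defectSpace V := fun v =>
    Submodule.neg_mem _ (Submodule.smul_mem _ _ (hran _))
  have hNB : N * B = 1 - N := by
    rw [mul_add, mul_one] at hNl
    exact eq_sub_of_add_eq' hNl
  have hBNB : B * N * B = B - B * N := by rw [mul_assoc, hNB, mul_sub, mul_one]
  have hX : W * (R + Complex.I • (R * W * N * (W * R))) * W = Complex.I • (B * N) := by
    have h1 : W * R * W = Complex.I • B := by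
      rw [hB, sandwich, smul_neg, smul_smul, Complex.I_mul_I]; simp
    calc W * (R + Complex.I • (R * W * N * (W * R))) * W
        = W * R * W + Complex.I • ((W * R * W) * N * (W * R * W)) := by
          simp only [mul_add, add_mul, mul_smul_comm, smul_mul_assoc, mul_assoc]
      _ = Complex.I • (B * N) := by
          rw [h1, smul_mul_assoc, smul_mul_assoc, mul_smul_comm, smul_smul Complex.I Complex.I,
            Complex.I_mul_I, neg_one_smul, ← sub_eq_add_neg, hBNB, smul_sub,
            sub_sub_cancel]
  change (1 + (2 * Complex.I) • compress (defectSpace V)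
    (W * (R + Complex.I • (R * W * N * (W * R))) * W)) * _ = _
  have h3 : (2 * Complex.I) • (Complex.I • (B * N)) = -((2 : ℂ) • (B * N)) := by
    rw [smul_smul, mul_assoc, Complex.I_mul_I, mul_neg_one, neg_smul]
  have h4 : -((2 : ℂ) • (B * N)) * B = (2 : ℂ) • (B * N) - (2 : ℂ) • B := by
    rw [neg_mul, smul_mul_assoc, hBNB, smul_sub, neg_sub]
  rw [hX, ← compress_smul, h3, mul_add, mul_one, add_mul, one_mul, ← compress_mul hmem, h4,
    compress_neg, compress_sub, compress_smul, compress_smul]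
  module

end CharacteristicFunctionFormula

/-! ### The free resolvent between weights -/

section Kernel

/-- For `Im z > 0`, this is `½ E₁(-iz|t|)`; the formula makes sense for `Im z ≥ 0`, `z ≠ 0`. -/
def transportSymbol (z : ℂ) (t : ℝ) : ℂ :=
  1 / 2 * (-Real.eulerMascheroniConstant - Complex.log (-(Complex.I * z)) - Real.log |t| +
    expEin (-(Complex.I * z) * (|t| : ℝ)))

theorem transportSymbol_eq_expInt {z : ℂ} (hz : 0 < z.im) {t : ℝ} (ht : t ≠ 0) :
    transportSymbol z t = 1 / 2 * expInt (-(Complex.I * z) * (|t| : ℝ)) := by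
  have ht' : 0 < |t| := abs_pos.2 ht
  have h0 : -(Complex.I * z) ≠ 0 := by
    rw [neg_ne_zero]
    refine mul_ne_zero Complex.I_ne_zero ?_
    rintro rfl
    simp at hz
  rw [expInt_eq (by simpa using mul_pos hz ht'), Complex.log_mul_ofReal _ ht' _ h0, transportSymbol]
  ring

theorem re_neg_I_mul_abs_nonneg {z : ℂ} (hz : 0 ≤ z.im) (t : ℝ) :
    0 ≤ (-(Complex.I * z) * (|t| : ℝ)).re := by
  simpa using mul_nonneg hz (abs_nonneg t)

theorem continuous_expEin_abs {z : ℂ} (hz : 0 ≤ z.im) :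
    Continuous fun t : ℝ => expEin (-(Complex.I * z) * (|t| : ℝ)) := by
  rw [continuous_iff_continuousAt]
  intro t
  rw [ContinuousAt, tendsto_iff_norm_sub_tendsto_zero]
  have hc : Continuous fun s : ℝ => -(Complex.I * z) * ((|s| : ℝ) : ℂ) := by fun_prop
  have h := tendsto_iff_norm_sub_tendsto_zero.1 (hc.tendsto t)
  exact squeeze_zero (fun _ => norm_nonneg _)
    (fun s => norm_expEin_sub_le (re_neg_I_mul_abs_nonneg hz s) (re_neg_I_mul_abs_nonneg hz t)) h

variable {w : Weight}

theorem isAdmissible_expEin {z : ℂ} (hz : 0 ≤ z.im) :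
    IsAdmissible w fun t : ℝ => expEin (-(Complex.I * z) * (|t| : ℝ)) := by
  refine isAdmissible_of_bounded (continuous_expEin_abs hz).measurable
    (m := ‖z‖ * (2 * w.radius)) fun t ht => ?_
  refine (norm_expEin_le (re_neg_I_mul_abs_nonneg hz t)).trans ?_
  rw [norm_mul, norm_neg, norm_mul, Complex.norm_I, one_mul, Complex.norm_real, Real.norm_eq_abs,
    abs_abs]
  gcongr

theorem isAdmissible_const (r : ℂ) : IsAdmissible w fun _ => r := by
  simpa using (isAdmissible_one (w := w)).const_mul r

theorem isAdmissible_transportSymbol {z : ℂ} (hz : 0 ≤ z.im) :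
    IsAdmissible w (transportSymbol z) := by
  have h := (((isAdmissible_const (w := w) (-Real.eulerMascheroniConstant - Complex.log (-(Complex.I * z)))).add
    (isAdmissible_log.const_mul (-1))).add (isAdmissible_expEin hz)).const_mul (1 / 2)
  refine (funext fun t => ?_ : _ = transportSymbol z) ▸ h
  rw [transportSymbol]
  ring

theorem IsAdmissible.integrable_mul {φ q : ℝ → ℂ} (hφ : IsAdmissible w φ) (hq : MemLp q 2 volume)
    (h0 : ∀ t, 2 * w.radius < |t| → q t = 0) : Integrable fun t => φ t * q t := by
  have h1 : IntegrableOn (fun t => φ t * q t) (Set.Icc (-(2 * w.radius)) (2 * w.radius)) :=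
    hφ.2.integrable_mul (hq.restrict _)
  refine (integrableOn_iff_integrable_of_support_subset fun t ht => ?_).1 h1
  by_contra h
  refine ht ?_
  have : 2 * w.radius < |t| := by
    by_contra h'
    exact h (abs_le.1 (not_lt.1 h'))
  simp [h0 t this]

theorem integral_norm_exp_div (z : ℂ) (s : ℝ) :
    ∫ μ in Set.Ioc (0 : ℝ) 1, ‖Complex.exp (Complex.I * z * (s / μ : ℝ)) / μ‖ =
      ‖expInt ((z.im * s : ℝ) : ℂ)‖ := by
  have h1 : expInt ((z.im * s : ℝ) : ℂ) =
      ((∫ μ in Set.Ioc (0 : ℝ) 1, ‖Complex.exp (Complex.I * z * (s / μ : ℝ)) / μ‖ : ℝ) : ℂ) := by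
    rw [expInt, ← integral_complex_ofReal]
    refine setIntegral_congr_fun measurableSet_Ioc fun μ hμ => ?_
    simp only [norm_div, Complex.norm_exp, Complex.norm_real, Real.norm_of_nonneg hμ.1.le]
    push_cast
    congr 2
    have : (Complex.I * z * (s / μ : ℝ)).re = -(z.im * s) / μ := by
      simp; ring
    rw [← Complex.ofReal_div, this]
    push_cast
    rfl
  rw [h1, Complex.norm_real, Real.norm_of_nonneg (integral_nonneg fun _ => norm_nonneg _)]

/-- Fubini after s = μt: integrating e^{izs/μ}/μ over μ in (0, 1] yields E₁(-izs). Absolute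
integrability involves the same integral with z replaced by i Im z, which explains the hypothesis.
-/
theorem integral_angle_ray {z : ℂ} (hz : 0 < z.im) {q : ℝ → ℂ} (hq : Measurable q)
    (hint : IntegrableOn (fun s : ℝ => expInt ((z.im * s : ℝ) : ℂ) * q s) (Set.Ioi 0)) :
    IntegrableOn (fun μ : ℝ => ∫ t in Set.Ioi (0 : ℝ), Complex.exp (Complex.I * z * t) * q (μ * t))
        (Set.Ioc 0 1) ∧
      ∫ μ in Set.Ioc (0 : ℝ) 1, ∫ t in Set.Ioi (0 : ℝ), Complex.exp (Complex.I * z * t) * q (μ * t) =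
        ∫ s in Set.Ioi (0 : ℝ), expInt (-(Complex.I * z) * s) * q s := by
  set F : ℝ × ℝ → ℂ := fun p => Complex.exp (Complex.I * z * (p.2 / p.1 : ℝ)) / p.1 * q p.2
  have hFm : Measurable F := by
    have : Measurable fun p : ℝ × ℝ => q p.2 := hq.comp measurable_snd
    exact Measurable.mul (by fun_prop) this
  have hdiv : ∀ s μ : ℝ, Complex.exp (Complex.I * z * (s / μ : ℝ)) / μ =
      Complex.exp (-(-(Complex.I * z) * s) / μ) / μ := by
    intro s μ
    congr 2
    push_cast
    ring
  have hFi : Integrable F ((volume.restrict (Set.Ioc (0 : ℝ) 1)).prod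
      (volume.restrict (Set.Ioi (0 : ℝ)))) := by
    rw [integrable_prod_iff' hFm.aestronglyMeasurable]
    constructor
    · refine (ae_restrict_iff' measurableSet_Ioi).2 (Eventually.of_forall fun s hs => ?_)
      have := integrableOn_expInt (s := -(Complex.I * z) * s) (by simpa using mul_pos hz hs)
      have h2 : IntegrableOn (fun μ : ℝ => Complex.exp (Complex.I * z * (s / μ : ℝ)) / μ)
          (Set.Ioc 0 1) := this.congr (Eventually.of_forall fun μ => (hdiv s μ).symm)
      exact Integrable.mul_const h2 (q s)
    · refine hint.norm.congr ((ae_restrict_iff' measurableSet_Ioi).2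
        (Eventually.of_forall fun s hs => ?_))
      simp only [F, norm_mul]
      rw [integral_mul_const, integral_norm_exp_div]
  have hinner : ∀ μ ∈ Set.Ioc (0 : ℝ) 1,
      ∫ s in Set.Ioi (0 : ℝ), F (μ, s) =
        ∫ t in Set.Ioi (0 : ℝ), Complex.exp (Complex.I * z * t) * q (μ * t) := by
    intro μ hμ
    have h1 := integral_comp_mul_left_Ioi (fun s => F (μ, s)) 0 hμ.1
    rw [mul_zero] at h1
    have hμ0 : (μ : ℂ) ≠ 0 := by exact_mod_cast hμ.1.ne'
    have h2 : ∫ s in Set.Ioi (0 : ℝ), F (μ, s) = (μ : ℂ) * ∫ t in Set.Ioi (0 : ℝ), F (μ, μ * t) := by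
      rw [h1, Complex.real_smul, Complex.ofReal_inv, mul_inv_cancel_left₀ hμ0]
    rw [h2, ← integral_const_mul]
    refine integral_congr_ae (Eventually.of_forall fun t => ?_)
    simp only [F]
    rw [mul_div_cancel_left₀ t hμ.1.ne']
    field_simp
  constructor
  · refine hFi.integral_prod_left.congr ((ae_restrict_iff' measurableSet_Ioc).2
      (Eventually.of_forall hinner))
  · rw [← setIntegral_congr_fun measurableSet_Ioc hinner, integral_integral_swap hFi]
    refine setIntegral_congr_fun measurableSet_Ioi fun s _ => ?_
    simp only [F]
    rw [integral_mul_const]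
    congr 1
    rw [expInt]
    exact integral_congr_ae (Eventually.of_forall fun μ => hdiv s μ)

theorem measurable_angleMean (f : Slab) : Measurable (angleMean f) :=
  ((Lp.stronglyMeasurable f).integral_prod_right' (ν := angleMeasure)).measurable.const_mul _

theorem memLp_angleMean (f : Slab) : MemLp (angleMean f) 2 volume := by
  have hm := measurable_angleMean f
  refine memLp_two_of_lintegral_lt_top hm.aestronglyMeasurable ?_
  have h1 := MemLp.lintegral_sq_lt_top (memLp_angleAverage (Lp.memLp f))
  have h2 := lintegral_slab_fst (f := fun x => ‖angleMean f x‖ₑ ^ 2)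
    (hm.enorm.pow_const 2).aemeasurable
  have h3 : ∫⁻ q, ‖angleAverage f q‖ₑ ^ 2 ∂slabMeasure =
      ∫⁻ q, ‖angleMean f q.1‖ₑ ^ 2 ∂slabMeasure := rfl
  rw [h3, h2] at h1
  exact ENNReal.lt_top_of_mul_ne_top_right h1.ne (by norm_num)

theorem memLp_weight_mul {p : ℝ → ℂ} (hp : MemLp p 2 volume) :
    MemLp (fun x => (w x : ℂ) * p x) 2 volume := by
  have hwm : Measurable fun x => (w x : ℂ) := by have := w.measurable; fun_prop
  refine MemLp.of_le_mul (c := w.bound) hp (hwm.aestronglyMeasurable.mul hp.1)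
    (Eventually.of_forall fun x => ?_)
  rw [norm_mul, Complex.norm_real, Real.norm_of_nonneg (w.nonneg x)]
  exact mul_le_mul_of_nonneg_right (w.le_bound x) (norm_nonneg _)

theorem integral_angle_eq {J : ℝ → ℂ} (h1 : IntegrableOn J (Set.Ioc 0 1))
    (h2 : IntegrableOn (fun μ => J (-μ)) (Set.Ioc 0 1)) :
    ∫ μ, J μ ∂angleMeasure = (∫ μ in Set.Ioc (0 : ℝ) 1, J μ) + ∫ μ in Set.Ioc (0 : ℝ) 1, J (-μ) := by
  have i1 : IntervalIntegrable J volume 0 1 :=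
    (intervalIntegrable_iff_integrableOn_Ioc_of_le zero_le_one).2 h1
  have i2 : IntervalIntegrable (fun μ => J (-μ)) volume 0 1 :=
    (intervalIntegrable_iff_integrableOn_Ioc_of_le zero_le_one).2 h2
  have i3 : IntervalIntegrable J volume (-1) 0 := by
    have := i2.comp_sub_left 0
    simp only [zero_sub, neg_neg, sub_zero] at this
    exact this.symm
  rw [angleMeasure, integral_Icc_eq_integral_Ioc, ← intervalIntegral.integral_of_le (by norm_num),
    ← intervalIntegral.integral_add_adjacent_intervals i3 i1,
    ← intervalIntegral.integral_of_le zero_le_one, ← intervalIntegral.integral_of_le zero_le_one,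
    intervalIntegral.integral_comp_neg, neg_zero, add_comm]

theorem integral_eq_integral_Ioi_add {g : ℝ → ℂ} (hg : Integrable g) :
    ∫ s, g s = (∫ s in Set.Ioi (0 : ℝ), g s) + ∫ s in Set.Ioi (0 : ℝ), g (-s) := by
  rw [integral_comp_neg_Ioi, neg_zero, add_comm,
    intervalIntegral.integral_Iic_add_Ioi hg.integrableOn hg.integrableOn]

/-- Positive and negative directions produce the parts of the convolution with y > x and y < x. As x
and the support of p lie in [-r, r], only differences up to 2r matter. -/
theorem half_integral_ray_eq {z : ℂ} (hz : 0 < z.im) {p : ℝ → ℂ} (hp : MemLp p 2 volume)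
    (hpm : Measurable p) (h0 : ∀ y, w.radius < |y| → p y = 0) {x : ℝ} (hx : |x| ≤ w.radius) :
    1 / 2 * ∫ μ, (∫ t in Set.Ioi (0 : ℝ), Complex.exp (Complex.I * z * t) * p (x + μ * t))
      ∂angleMeasure = ∫ y, transportSymbol z (x - y) * p y := by
  have hfar : ∀ σ : ℝ, σ ^ 2 = 1 → ∀ t, 2 * w.radius < |t| → p (x + σ * t) = 0 := by
    intro σ hσ t ht
    refine h0 _ ?_
    have hσ' : |σ| = 1 := by
      rcases mul_self_eq_one_iff.1 ((sq σ).symm.trans hσ) with rfl | rfl <;> simp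
    have h1 : |σ * t| = |t| := by rw [abs_mul, hσ', one_mul]
    have h2 : |σ * t| ≤ |x + σ * t| + |x| := by
      simpa using abs_sub (x + σ * t) x
    linarith
  have hmem : ∀ σ : ℝ, σ ^ 2 = 1 → MemLp (fun t => p (x + σ * t)) 2 volume := by
    intro σ hσ
    exact memLp_comp_scale (by rintro rfl; simp at hσ) hp x
  -- At the purely imaginary point i Im z the symbol is half of E₁(Im z |t|), which dominates the
  -- absolute values.
  have hyim : 0 < (((z.im : ℝ) : ℂ) * Complex.I).im := by simpa using hz
  have hint : ∀ σ : ℝ, σ ^ 2 = 1 → IntegrableOn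
      (fun s : ℝ => expInt ((z.im * s : ℝ) : ℂ) * p (x + σ * s)) (Set.Ioi 0) := by
    intro σ hσ
    have h1 := ((isAdmissible_transportSymbol (w := w) hyim.le).const_mul 2).integrable_mul
      (hmem σ hσ) (hfar σ hσ)
    refine h1.integrableOn.congr ((ae_restrict_iff' measurableSet_Ioi).2
      (Eventually.of_forall fun s hs => ?_))
    have hs' : (0 : ℝ) < s := hs
    simp only
    rw [transportSymbol_eq_expInt hyim hs'.ne', abs_of_pos hs']
    have : -(Complex.I * ((z.im : ℂ) * Complex.I)) * (s : ℂ) = ((z.im * s : ℝ) : ℂ) := by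
      push_cast
      linear_combination (-(z.im : ℂ) * s) * Complex.I_mul_I
    rw [this]
    ring
  have hray : ∀ σ : ℝ, σ ^ 2 = 1 → _ := fun σ hσ =>
    integral_angle_ray hz (q := fun s => p (x + σ * s)) (by fun_prop) (hint σ hσ)
  obtain ⟨a1, a2⟩ := hray 1 (by norm_num)
  obtain ⟨b1, b2⟩ := hray (-1) (by norm_num)
  simp only [one_mul, neg_mul] at a1 a2 b1 b2
  have hsym : Integrable fun s => transportSymbol z s * p (x + -1 * s) :=
    (isAdmissible_transportSymbol (w := w) hz.le).integrable_mul
      (hmem _ (by norm_num)) (hfar _ (by norm_num))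
  have hR : ∫ y, transportSymbol z (x - y) * p y = ∫ s, transportSymbol z s * p (x + -1 * s) := by
    rw [← integral_sub_left_eq_self _ volume x]
    refine integral_congr_ae (Eventually.of_forall fun s => ?_)
    simp only
    congr 2 <;> ring
  rw [hR, integral_eq_integral_Ioi_add hsym, integral_angle_eq a1 (by simpa only [neg_mul] using b1)]
  simp only [neg_mul, one_mul, neg_neg]
  rw [a2, b2, mul_add, add_comm, ← integral_const_mul, ← integral_const_mul]
  congr 1
  · refine setIntegral_congr_fun measurableSet_Ioi fun s hs => ?_
    have hs' : (0 : ℝ) < s := hs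
    rw [transportSymbol_eq_expInt hz hs'.ne', abs_of_pos hs']
    ring_nf
  · refine setIntegral_congr_fun measurableSet_Ioi fun s hs => ?_
    have hs' : (0 : ℝ) < s := hs
    rw [transportSymbol_eq_expInt hz (neg_ne_zero.2 hs'.ne'), abs_neg, abs_of_pos hs']
    ring_nf

theorem isFullySymmetric_freeTransport : IsFullySymmetric freeTransport := by
  refine ⟨fun u v => ?_, fun z hz f => ?_⟩
  · refine inner_freeTransport_symm (u := u) (w := freeTransport u) (u' := v)
      (w' := freeTransport v) ?_ ?_
    · rw [← freeTransport_graph]; exact freeTransport.mem_graph u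
    · rw [← freeTransport_graph]; exact freeTransport.mem_graph v
  · obtain ⟨σ, hσ, hσz⟩ : ∃ σ : ℝ, σ ^ 2 = 1 ∧ 0 < (σ * z : ℂ).im := by
      rcases hz.lt_or_gt with h | h
      · exact ⟨-1, by norm_num, by simpa using h⟩
      · exact ⟨1, by norm_num, by simpa using h⟩
    have h := slabSol_mem_graph hσ hσz f
    rw [← freeTransport_graph, LinearPMap.mem_graph_iff] at h
    obtain ⟨u, h1, h2⟩ := h
    simp only at h1 h2
    exact ⟨u, by rw [h1, h2, add_sub_cancel_right]⟩

theorem coeFn_resolvent {z : ℂ} (hz : 0 < z.im) {R : Slab →L[ℂ] Slab}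
    (hR : IsResolventAt freeTransport z R) (f : Slab) :
    R f =ᵐ[slabMeasure] slabSol 1 z f := by
  have hz' : 0 < (((1 : ℝ) : ℂ) * z).im := by simpa using hz
  have h := slabSol_mem_graph (by norm_num) hz' f
  rw [← freeTransport_graph, LinearPMap.mem_graph_iff] at h
  obtain ⟨u, h1, h2⟩ := h
  simp only at h1 h2
  have h3 := hR.2 u
  rw [h1, h2, add_sub_cancel_right] at h3
  rw [h3]
  exact MemLp.coeFn_toLp _

/-- W averages over angles, so WRW sees only the mean over directions of the ray solution; the
factor i of the ray solution cancels against -i. -/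
theorem sandwich_eq_convOp {z : ℂ} (hz : 0 < z.im) {R W : Slab →L[ℂ] Slab}
    (hR : IsResolventAt freeTransport z R)
    (hW : ∀ f, W f =ᵐ[slabMeasure] fun q => w q.1 * angleMean f q.1) :
    sandwich W R = convOp w (transportSymbol z) := by
  ext1 f
  set p : ℝ → ℂ := fun y => w y * angleMean f y with hp
  have hpL : MemLp p 2 volume := memLp_weight_mul (memLp_angleMean f)
  have hwm : Measurable fun x => (w x : ℂ) := by have := w.measurable; fun_prop
  have hpm : Measurable p := hwm.mul (measurable_angleMean f)
  have hp0 : ∀ y, w.radius < |y| → p y = 0 := fun y hy => by simp [hp, w.supp hy]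
  have h1 : ∀ᵐ μ ∂angleMeasure, ∀ x, slabSol 1 z (W f) (x, μ) =
      Complex.I * ∫ t in Set.Ioi (0 : ℝ), Complex.exp (Complex.I * z * t) * p (x + μ * t) := by
    filter_upwards [ae_ae_of_ae_slab (hW f), ae_angle_ne_zero] with μ hμ hμ0 x
    simp only [slabSol, raySol, Complex.ofReal_one, one_mul]
    congr 1
    refine integral_congr_ae (ae_restrict_of_ae ?_)
    -- For μ ≠ 0 the parametrisation of the ray pulls null sets back to null sets, so the
    -- representative of Wf may be replaced along it.
    have hq : Measure.QuasiMeasurePreserving (fun t : ℝ => x + μ * t) volume volume := by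
      have hq1 : Measure.QuasiMeasurePreserving (fun t : ℝ => μ * t) volume volume := by
        refine ⟨by fun_prop, ?_⟩
        rw [Real.map_volume_mul_left hμ0]
        exact Measure.smul_absolutelyContinuous
      exact (measurePreserving_add_left volume x).quasiMeasurePreserving.comp hq1
    filter_upwards [hq.ae hμ] with t ht
    rw [ht]
  have h2 : ∀ᵐ x : ℝ, angleMean (R (W f)) x = Complex.I * (1 / 2 *
      ∫ μ, (∫ t in Set.Ioi (0 : ℝ), Complex.exp (Complex.I * z * t) * p (x + μ * t))
        ∂angleMeasure) := by
    have h3 : ∀ᵐ x : ℝ, ∀ᵐ μ ∂angleMeasure, R (W f) (x, μ) = slabSol 1 z (W f) (x, μ) :=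
      Measure.ae_ae_of_ae_prod (coeFn_resolvent hz hR (W f))
    filter_upwards [h3] with x hx
    have h4 : ∀ᵐ μ ∂angleMeasure, R (W f) (x, μ) = Complex.I *
        ∫ t in Set.Ioi (0 : ℝ), Complex.exp (Complex.I * z * t) * p (x + μ * t) := by
      filter_upwards [hx, h1] with μ a1 a2
      rw [a1, a2]
    rw [angleMean, integral_congr_ae h4, integral_const_mul]
    ring
  have h5 := (Measure.quasiMeasurePreserving_fst (μ := (volume : Measure ℝ))
    (ν := angleMeasure)).ae h2
  refine Lp.ext ?_
  have e1 : sandwich W R f = -(Complex.I • W (R (W f))) := rfl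
  rw [e1]
  filter_upwards [Lp.coeFn_neg (Complex.I • W (R (W f))), Lp.coeFn_smul Complex.I (W (R (W f))),
    hW (R (W f)), h5, coeFn_convOp (isAdmissible_transportSymbol (w := w) hz.le) f]
    with q a1 a2 a3 a4 a5
  rw [a1, Pi.neg_apply, a2, Pi.smul_apply, a3, a4, a5, smul_eq_mul]
  by_cases hq : |q.1| ≤ w.radius
  · rw [half_integral_ray_eq hz hpL hpm hp0 hq]
    linear_combination (-(w q.1 : ℂ) * ∫ y, transportSymbol z (q.1 - y) * p y) * Complex.I_mul_I
  · rw [w.supp (not_le.1 hq)]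
    simp

end Kernel

/-! ### The square root of the imaginary part -/

section SquareRoot

theorem ae_fst {p : ℝ → Prop} (h : ∀ᵐ x, p x) : ∀ᵐ q ∂slabMeasure, p q.1 :=
  (Measure.quasiMeasurePreserving_fst (μ := (volume : Measure ℝ)) (ν := angleMeasure)).ae h

theorem coeFn_imaginaryPart (d : Lp ℝ ∞ (volume : Measure ℝ)) (f : Slab) :
    imaginaryPart d f =ᵐ[slabMeasure] fun q => d q.1 * angleMean f q.1 := by
  filter_upwards [coeFn_multiplication d (collision f), coeFn_collision f] with q h1 h2
  change multiplication d (collision f) q = _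
  rw [h1, h2]
  rfl

theorem angleMean_ae_eq {f : Slab} {g : ℝ → ℂ} (h : f =ᵐ[slabMeasure] fun q => g q.1) :
    ∀ᵐ x, angleMean f x = g x := by
  have h1 : ∀ᵐ x : ℝ, ∀ᵐ μ ∂angleMeasure, f (x, μ) = g x := Measure.ae_ae_of_ae_prod h
  filter_upwards [h1] with x hx
  rw [angleMean, integral_congr_ae hx, integral_const, Measure.real, angleMeasure_univ]
  simp

/-- The angular average is idempotent and commutes with multiplication by functions of x. Hence √V =
√c(x)K. -/
theorem imaginaryPart_mul {d d' d'' : Lp ℝ ∞ (volume : Measure ℝ)}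
    (h : ∀ᵐ x, d'' x = d x * d' x) : imaginaryPart d * imaginaryPart d' = imaginaryPart d'' := by
  ext1 f
  refine Lp.ext ?_
  change imaginaryPart d (imaginaryPart d' f) =ᵐ[slabMeasure] _
  filter_upwards [coeFn_imaginaryPart d (imaginaryPart d' f), coeFn_imaginaryPart d'' f, ae_fst h,
    ae_fst (angleMean_ae_eq (g := fun x => d' x * angleMean f x) (coeFn_imaginaryPart d' f))] with q h1 h2 h3 h4
  rw [h1, h2, h3, h4]
  push_cast
  ring

theorem inner_eq_integral_angleMean {f g : Slab} {p : ℝ → ℂ} (h : f =ᵐ[slabMeasure] fun q => p q.1) :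
    inner ℂ f g = 2 * ∫ x, starRingEnd ℂ (p x) * angleMean g x := by
  have hi := L2.integrable_inner (𝕜 := ℂ) f g
  rw [L2.inner_def, integral_slab hi, ← integral_const_mul]
  have h1 : ∀ᵐ x : ℝ, ∀ᵐ μ ∂angleMeasure, f (x, μ) = p x := Measure.ae_ae_of_ae_prod h
  refine integral_congr_ae ?_
  filter_upwards [h1] with x hx
  have h2 : ∀ᵐ μ ∂angleMeasure, inner ℂ (f (x, μ)) (g (x, μ)) = starRingEnd ℂ (p x) * g (x, μ) := by
    filter_upwards [hx] with μ hμ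
    rw [hμ, RCLike.inner_apply, mul_comm]
  rw [integral_congr_ae h2, integral_const_mul, angleMean]
  ring

theorem isSelfAdjoint_imaginaryPart (d : Lp ℝ ∞ (volume : Measure ℝ)) :
    IsSelfAdjoint (imaginaryPart d) := by
  rw [ContinuousLinearMap.isSelfAdjoint_iff_isSymmetric]
  intro f g
  change inner ℂ (imaginaryPart d f) g = inner ℂ f (imaginaryPart d g)
  rw [inner_eq_integral_angleMean (p := fun x => d x * angleMean f x) (coeFn_imaginaryPart d f),
    ← inner_conj_symm,
    inner_eq_integral_angleMean (p := fun x => d x * angleMean g x) (coeFn_imaginaryPart d g),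
    map_mul, ← integral_conj, map_ofNat]
  congr 1
  refine integral_congr_ae (Eventually.of_forall fun x => ?_)
  simp only [map_mul, Complex.conj_ofReal, Complex.conj_conj]
  ring

theorem imaginaryPart_nonneg {d s : Lp ℝ ∞ (volume : Measure ℝ)} (h : ∀ᵐ x, d x = s x * s x) :
    0 ≤ imaginaryPart d := by
  rw [← imaginaryPart_mul h]
  exact (isSelfAdjoint_imaginaryPart s).mul_self_nonneg

theorem exists_sqrt_coefficient (w : Weight) : ∃ d s : Lp ℝ ∞ (volume : Measure ℝ),
    (∀ᵐ x, d x = w x) ∧ ∀ᵐ x, d x = s x * s x := by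
  have h1 : MemLp (fun x => w x) ∞ (volume : Measure ℝ) :=
    memLp_top_of_bound w.measurable.aestronglyMeasurable w.bound
      (Eventually.of_forall fun x => by
        rw [Real.norm_of_nonneg (w.nonneg x)]; exact w.le_bound x)
  have h2 : MemLp (fun x => √(w x)) ∞ (volume : Measure ℝ) :=
    memLp_top_of_bound (w.measurable.sqrt).aestronglyMeasurable (√w.bound)
      (Eventually.of_forall fun x => by
        rw [Real.norm_of_nonneg (Real.sqrt_nonneg _)]; exact Real.sqrt_le_sqrt (w.le_bound x))
  refine ⟨h1.toLp, h2.toLp, h1.coeFn_toLp, ?_⟩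
  filter_upwards [h1.coeFn_toLp, h2.coeFn_toLp] with x a1 a2
  rw [a1, a2, Real.mul_self_sqrt (w.nonneg x)]

variable {c : Lp ℝ ∞ (volume : Measure ℝ)} {w : Weight}

/-- Positivity of √c(x)K is seen by taking one more root: it is the square of the selfadjoint
operator c^{1/4}(x)K. -/
theorem exists_sqrt_imaginaryPart (hc : ∀ᵐ x : ℝ, 0 ≤ c x) (hw : ∀ᵐ x, w x = √(c x)) :
    ∃ W : Slab →L[ℂ] Slab, 0 ≤ W ∧ W * W = imaginaryPart c ∧
      ∀ f, W f =ᵐ[slabMeasure] fun q => w q.1 * angleMean f q.1 := by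
  obtain ⟨d, s, hd, hs⟩ := exists_sqrt_coefficient w
  refine ⟨imaginaryPart d, imaginaryPart_nonneg hs, imaginaryPart_mul ?_, fun f => ?_⟩
  · filter_upwards [hc, hw, hd] with x a1 a2 a3
    rw [a3, a2, Real.mul_self_sqrt a1]
  · filter_upwards [coeFn_imaginaryPart d f, ae_fst hd] with q a1 a2
    rw [a1, a2]

end SquareRoot

/-! ### Lower bounds for perturbed compact operators -/

section LowerBound

variable {E : Type*} [NormedAddCommGroup E] [InnerProductSpace ℂ E]

/-- The core of the lower bound. The rank one coefficient l diverges, but more slowly than 1/z. A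
limit vector is therefore orthogonal to e, and the first order term -½G, of size z, can still be
isolated. -/
theorem false_of_approximate_kernel {Y D : E →L[ℂ] E} (hYc : IsCompactOperator Y)
    (hYs : ∀ u v, inner ℂ (Y u) v = inner ℂ u (Y v)) {e : E}
    (hD : ∀ u, u ≠ 0 → inner ℂ e u = 0 → inner ℂ u (D u) ≠ 0)
    {z l : ℕ → ℂ} (hz0 : ∀ n, z n ≠ 0) (hl : Tendsto (fun n => ‖l n‖) atTop atTop)
    (hzl : Tendsto (fun n => z n * l n) atTop (𝓝 0)) (hz : Tendsto z atTop (𝓝 0))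
    {G : ℕ → E →L[ℂ] E} (hG : Tendsto (fun n => (z n)⁻¹ • G n) atTop (𝓝 (-(Complex.I • D))))
    {v : ℕ → E} (hv : ∀ n, ‖v n‖ = 1)
    (hr : Tendsto (fun n => (z n)⁻¹ • (v n + Y (v n) + (l n * inner ℂ e (v n)) • e -
      (1 / 2 : ℂ) • G n (v n))) atTop (𝓝 0)) : False := by
  set r : ℕ → E := fun n => v n + Y (v n) + (l n * inner ℂ e (v n)) • e - (1 / 2 : ℂ) • G n (v n)
    with hrdef
  set b : ℕ → ℂ := fun n => l n * inner ℂ e (v n) with hb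
  have hGv : Tendsto (fun n => G n (v n)) atTop (𝓝 0) := by
    have h1 : Tendsto (fun n => z n • ((z n)⁻¹ • G n)) atTop (𝓝 ((0 : ℂ) • (-(Complex.I • D)))) :=
      hz.smul hG
    rw [zero_smul] at h1
    have h2 : Tendsto (fun n => ‖G n‖) atTop (𝓝 0) := by
      refine (tendsto_zero_iff_norm_tendsto_zero.1 h1).congr fun n => ?_
      rw [smul_inv_smul₀ (hz0 n)]
    refine squeeze_zero_norm (fun n => ?_) h2
    simpa [hv n] using (G n).le_opNorm (v n)
  have hr0 : Tendsto r atTop (𝓝 0) := by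
    have h1 := hz.smul hr
    rw [smul_zero] at h1
    refine h1.congr fun n => ?_
    rw [smul_inv_smul₀ (hz0 n)]
  have hbe : ∀ n, b n • e = r n - v n - Y (v n) + (1 / 2 : ℂ) • G n (v n) := by
    intro n
    simp only [hrdef, hb]
    abel
  -- All other terms of the equation are bounded, hence so is b n • e; if e = 0, then b n = 0.
  obtain ⟨M, hM⟩ : ∃ M, ∀ n, ‖b n‖ ≤ M := by
    by_cases he : e = 0
    · exact ⟨0, fun n => by simp [hb, he]⟩
    · obtain ⟨M1, h1⟩ := hr0.norm.bddAbove_range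
      obtain ⟨M2, h2⟩ := hGv.norm.bddAbove_range
      refine ⟨(M1 + 1 + ‖Y‖ + 1 / 2 * M2) / ‖e‖, fun n => ?_⟩
      rw [le_div_iff₀ (norm_pos_iff.2 he), ← norm_smul, hbe]
      refine (norm_add_le _ _).trans (add_le_add ((norm_sub_le _ _).trans (add_le_add
        ((norm_sub_le _ _).trans (add_le_add (h1 ⟨n, rfl⟩) (hv n).le)) ?_)) ?_)
      · simpa [hv n] using Y.le_opNorm (v n)
      · rw [norm_smul]
        have := h2 ⟨n, rfl⟩
        simp only at this
        norm_num
        linarith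
  obtain ⟨b0, -, φ, hφ, hbφ⟩ := (isCompact_closedBall (0 : ℂ) M).tendsto_subseq
    (x := b) (fun n => by simpa using hM n)
  have hK := hYc.isCompact_closure_image_closedBall (f := Y.toLinearMap) 1
  obtain ⟨y, -, ψ, hψ, hyψ⟩ := hK.tendsto_subseq (x := fun n => Y (v (φ n)))
    (fun n => subset_closure ⟨v (φ n), by simp [hv], rfl⟩)
  set σ := φ ∘ ψ
  have hσ : Tendsto σ atTop atTop := (hφ.comp hψ).tendsto_atTop
  have hbσ : Tendsto (fun n => b (σ n)) atTop (𝓝 b0) := hbφ.comp hψ.tendsto_atTop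
  have hyσ : Tendsto (fun n => Y (v (σ n))) atTop (𝓝 y) := hyψ
  -- Solving the equation for v n expresses it through convergent quantities, so v n itself
  -- converges in norm along the subsequence.
  set u : E := 0 - y + (1 / 2 : ℂ) • (0 : E) - b0 • e with hu
  have hvσ : Tendsto (fun n => v (σ n)) atTop (𝓝 u) := by
    refine (((((hr0.comp hσ).sub hyσ).add ((hGv.comp hσ).const_smul (1 / 2 : ℂ))).sub
      (hbσ.smul_const e))).congr fun n => ?_
    simp only [Function.comp_apply]
    rw [hbe]
    abel
  have hun : ‖u‖ = 1 := tendsto_nhds_unique hvσ.norm (by simp [hv])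
  have hu0 : u ≠ 0 := by
    rintro h
    rw [h, norm_zero] at hun
    exact zero_ne_one hun
  have hYu : y = Y u := tendsto_nhds_unique hyσ ((Y.continuous.tendsto u).comp hvσ)
  have heq : u + Y u = -(b0 • e) := by
    rw [← hYu, hu, smul_zero]
    abel
  have ha : Tendsto (fun n => inner ℂ e (v (σ n))) atTop (𝓝 0) := by
    rw [tendsto_zero_iff_norm_tendsto_zero]
    have h1 := (hbσ.norm).mul ((hl.comp hσ).inv_tendsto_atTop)
    rw [mul_zero] at h1
    refine h1.congr' ?_
    filter_upwards [(hl.comp hσ).eventually_gt_atTop 0] with n hn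
    simp only [Function.comp_apply] at hn
    simp only [hb, Pi.inv_apply, Function.comp_apply, norm_mul]
    field_simp
  have heu : inner ℂ e u = 0 :=
    tendsto_nhds_unique ((tendsto_const_nhds (x := e)).inner hvσ) ha
  have hue : inner ℂ u e = 0 := by rw [← inner_conj_symm, heu, map_zero]
  -- Symmetry of Y moves I + Y onto u, where it gives -b0 • e; orthogonality of u and e removes the
  -- divergent term.
  have hpair : ∀ n, starRingEnd ℂ b0 * inner ℂ e (v n) =
      -inner ℂ u (r n) - 1 / 2 * inner ℂ u (G n (v n)) := by
    intro n
    have h1 : inner ℂ u (v n + Y (v n)) = -(starRingEnd ℂ b0 * inner ℂ e (v n)) := by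
      rw [inner_add_right, ← hYs, ← inner_add_left, heq, inner_neg_left, inner_smul_left]
    simp only [hrdef]
    rw [inner_sub_right, inner_add_right, h1, inner_smul_right, inner_smul_right, hue]
    ring
  have hGlim : Tendsto (fun n => (z (σ n))⁻¹ • G (σ n) (v (σ n))) atTop (𝓝 ((-(Complex.I • D)) u)) :=
    (isBoundedBilinearMap_apply (𝕜 := ℂ) (E := E) (F := E)).continuous.continuousAt.tendsto.comp
      ((hG.comp hσ).prodMk_nhds hvσ)
  have hlim : Tendsto (fun n => (z (σ n))⁻¹ * (starRingEnd ℂ b0 * inner ℂ e (v (σ n)))) atTop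
      (𝓝 (-inner ℂ u 0 - 1 / 2 * inner ℂ u ((-(Complex.I • D)) u))) := by
    refine (((tendsto_const_nhds (x := u)).inner (hr.comp hσ)).neg.sub
      (((tendsto_const_nhds (x := u)).inner hGlim).const_mul (1 / 2 : ℂ))).congr fun n => ?_
    rw [hpair]
    simp only [Function.comp_apply, inner_smul_right]
    ring
  -- After division by z n the pairing has a finite limit. Multiplying it by z n * l n → 0 turns the
  -- left side into conj(b0) b n, which tends to |b0|².
  have hb0 : b0 = 0 := by
    have h1 := (hzl.comp hσ).mul hlim
    rw [zero_mul] at h1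
    have h2 : Tendsto (fun n => starRingEnd ℂ b0 * b (σ n)) atTop (𝓝 (starRingEnd ℂ b0 * b0)) :=
      hbσ.const_mul _
    have h3 := tendsto_nhds_unique h2 (h1.congr fun n => ?_)
    · simpa using h3
    · simp only [Function.comp_apply, hb]
      have := hz0 (σ n)
      field_simp
  rw [hb0] at hlim
  simp only [map_zero, zero_mul, mul_zero] at hlim
  have h4 := tendsto_nhds_unique hlim tendsto_const_nhds
  refine hD u hu0 heu ?_
  simpa [inner_smul_right] using h4

theorem exists_lower_bound {Y D : E →L[ℂ] E} (hYc : IsCompactOperator Y)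
    (hYs : ∀ u v, inner ℂ (Y u) v = inner ℂ u (Y v)) {e : E}
    (hD : ∀ u, u ≠ 0 → inner ℂ e u = 0 → inner ℂ u (D u) ≠ 0)
    {s : Set ℂ} {l : ℂ → ℂ} (hl : Tendsto (fun z => ‖l z‖) (𝓝[≠] 0) atTop)
    (hzl : Tendsto (fun z => z * l z) (𝓝[≠] 0) (𝓝 0))
    {G : ℂ → E →L[ℂ] E}
    (hG : Tendsto (fun z => z⁻¹ • G z) (𝓝[s \ {0}] 0) (𝓝 (-(Complex.I • D)))) :
    ∃ δ : ℝ, 0 < δ ∧ ∃ C : ℝ, 0 < C ∧ ∀ z ∈ s, z ≠ 0 → ‖z‖ ≤ δ → ∀ u : E,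
      ‖z‖ * ‖u‖ ≤ C * ‖u + Y u + (l z * inner ℂ e u) • e - (1 / 2 : ℂ) • G z u‖ := by
  by_contra! h
  have h1 : ∀ n : ℕ, ∃ z ∈ s, z ≠ 0 ∧ ‖z‖ ≤ 1 / ((n : ℝ) + 1) ∧ ∃ u : E,
      ((n : ℝ) + 1) * ‖u + Y u + (l z * inner ℂ e u) • e - (1 / 2 : ℂ) • G z u‖ < ‖z‖ * ‖u‖ :=
    fun n => by
      -- Failure of the bound with radius 1/(n + 1) and constant n + 1 makes the residual of the
      -- normalised vectors o(z).
      obtain ⟨z, hz, h0, hle, u, hu⟩ := h (1 / ((n : ℝ) + 1)) (by positivity) ((n : ℝ) + 1)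
        (by positivity)
      exact ⟨z, hz, h0, hle, u, hu⟩
  choose z hzs hz0 hzle u hu using h1
  have hu0 : ∀ n, 0 < ‖u n‖ := fun n => by
    by_contra h0
    have : u n = 0 := norm_le_zero_iff.1 (not_lt.1 h0)
    have h2 := hu n
    simp [this] at h2
  have hz : Tendsto z atTop (𝓝 0) :=
    squeeze_zero_norm hzle tendsto_one_div_add_atTop_nhds_zero_nat
  have hzne : Tendsto z atTop (𝓝[≠] 0) :=
    tendsto_nhdsWithin_iff.2 ⟨hz, Eventually.of_forall hz0⟩
  have hzsn : Tendsto z atTop (𝓝[s \ {0}] 0) :=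
    tendsto_nhdsWithin_iff.2 ⟨hz, Eventually.of_forall fun n => ⟨hzs n, hz0 n⟩⟩
  refine false_of_approximate_kernel hYc hYs hD hz0 (hl.comp hzne) (hzl.comp hzne) hz
    (hG.comp hzsn) (v := fun n => ((‖u n‖ : ℂ)⁻¹) • u n) (fun n => ?_) ?_
  · rw [norm_smul, norm_inv, Complex.norm_real, norm_norm, inv_mul_cancel₀ (hu0 n).ne']
  · refine squeeze_zero_norm (fun n => ?_) tendsto_one_div_add_atTop_nhds_zero_nat
    have hn : (0 : ℝ) < (n : ℝ) + 1 := by positivity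
    have e1 : ((‖u n‖ : ℂ)⁻¹) • u n + Y (((‖u n‖ : ℂ)⁻¹) • u n) +
        (l (z n) * inner ℂ e (((‖u n‖ : ℂ)⁻¹) • u n)) • e -
          (1 / 2 : ℂ) • G (z n) (((‖u n‖ : ℂ)⁻¹) • u n) =
        ((‖u n‖ : ℂ)⁻¹) • (u n + Y (u n) + (l (z n) * inner ℂ e (u n)) • e -
          (1 / 2 : ℂ) • G (z n) (u n)) := by
      simp only [map_smul, inner_smul_right]
      module
    rw [e1, norm_smul, norm_smul, norm_inv, norm_inv, Complex.norm_real, norm_norm,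
      inv_mul_le_iff₀ (norm_pos_iff.2 (hz0 n)), inv_mul_le_iff₀ (hu0 n), mul_one_div, mul_div_assoc',
      le_div_iff₀ hn]
    linarith [hu n]

end LowerBound

/-! ### The kernel `|x - y|` -/

section DistanceKernel

/-- The value at `x` of the indicator function of `(t, ∞)`. -/
def tailInd (t x : ℝ) : ℂ := if t < x then 1 else 0

theorem measurable_tailInd : Measurable fun p : ℝ × ℝ => tailInd p.1 p.2 :=
  Measurable.ite (measurableSet_lt measurable_fst measurable_snd) measurable_const measurable_const

theorem norm_tailInd_le (t x : ℝ) : ‖tailInd t x‖ ≤ 1 := by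
  rw [tailInd]; split_ifs <;> simp

theorem conj_tailInd (t x : ℝ) : starRingEnd ℂ (tailInd t x) = tailInd t x := by
  rw [tailInd]; split_ifs <;> simp

theorem integral_tailInd_mul {r x y : ℝ} (hx : |x| ≤ r) (hy : |y| ≤ r) :
    ∫ t in Set.Ioc (-r) r, tailInd t x * tailInd t y = ((min x y + r : ℝ) : ℂ) := by
  have h1 : (fun t => tailInd t x * tailInd t y) =
      (Set.Iio (min x y)).indicator fun _ => (1 : ℂ) := by
    funext t
    simp only [tailInd, Set.indicator_apply, Set.mem_Iio, lt_min_iff]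
    split_ifs <;> simp_all
  have h2 : Set.Iio (min x y) ∩ Set.Ioc (-r) r = Set.Ioo (-r) (min x y) := by
    ext t
    simp only [Set.mem_inter_iff, Set.mem_Iio, Set.mem_Ioc, Set.mem_Ioo]
    refine ⟨fun h => ⟨h.2.1, h.1⟩, fun h => ⟨h.2, h.1, ?_⟩⟩
    exact (h.2.le.trans (min_le_left _ _)).trans (abs_le.1 hx).2
  have h3 : -r ≤ min x y := le_min (abs_le.1 hx).1 (abs_le.1 hy).1
  rw [h1, integral_indicator measurableSet_Iio, Measure.restrict_restrict measurableSet_Iio, h2,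
    integral_const]
  simp only [Measure.real, Measure.restrict_apply_univ, Real.volume_Ioo, Complex.real_smul, mul_one]
  rw [ENNReal.toReal_ofReal (by linarith), sub_neg_eq_add]

variable {p : ℝ → ℂ} {r : ℝ}

/-- The kernel min(x, y) + r is the Gram kernel of the indicators of (t, ∞), so its quadratic form
is the integral of the squared modulus of the tail function. -/
theorem integral_min_mul (hp : Integrable p) (hpm : Measurable p)
    (h0 : ∀ y, r < |y| → p y = 0) :
    Integrable (fun x => starRingEnd ℂ (p x) * ∫ y, ((min x y + r : ℝ) : ℂ) * p y) ∧
      ∫ x, starRingEnd ℂ (p x) * ∫ y, ((min x y + r : ℝ) : ℂ) * p y =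
        ∫ t in Set.Ioc (-r) r, starRingEnd ℂ (∫ x, tailInd t x * p x) * ∫ x, tailInd t x * p x := by
  have htm := measurable_tailInd
  set ν : Measure ℝ := volume.restrict (Set.Ioc (-r) r)
  set F : ℝ → ℂ := fun t => ∫ x, tailInd t x * p x
  have hFm : Measurable F := by
    have : Measurable fun q : ℝ × ℝ => tailInd q.1 q.2 * p q.2 := htm.mul (hpm.comp measurable_snd)
    exact (this.stronglyMeasurable.integral_prod_right' (ν := volume)).measurable
  have hFb : ∀ t, ‖F t‖ ≤ ∫ x, ‖p x‖ := by
    intro t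
    refine norm_integral_le_of_norm_le hp.norm (Eventually.of_forall fun x => ?_)
    rw [norm_mul]
    exact mul_le_of_le_one_left (norm_nonneg _) (norm_tailInd_le _ _)
  have h1 : ∀ x, |x| ≤ r → ∫ y, ((min x y + r : ℝ) : ℂ) * p y = ∫ t, tailInd t x * F t ∂ν := by
    intro x hx
    have hi : Integrable (fun q : ℝ × ℝ => tailInd q.2 x * tailInd q.2 q.1 * p q.1)
        ((volume : Measure ℝ).prod ν) := by
      refine (hp.norm.mul_prod (integrable_const (1 : ℝ) (μ := ν))).mono' ?_
        (Eventually.of_forall fun q => ?_)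
      · refine Measurable.aestronglyMeasurable (Measurable.mul (Measurable.mul ?_ ?_) ?_)
        · exact htm.comp (measurable_snd.prodMk measurable_const)
        · exact htm.comp (measurable_snd.prodMk measurable_fst)
        · exact hpm.comp measurable_fst
      · rw [norm_mul, norm_mul, mul_one]
        exact mul_le_of_le_one_left (norm_nonneg _)
          (mul_le_one₀ (norm_tailInd_le _ _) (norm_nonneg _) (norm_tailInd_le _ _))
    have h2 : ∀ y, ((min x y + r : ℝ) : ℂ) * p y = ∫ t, tailInd t x * tailInd t y * p y ∂ν := by
      intro y
      by_cases hy : |y| ≤ r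
      · rw [integral_mul_const, integral_tailInd_mul hx hy]
      · simp [h0 y (not_le.1 hy)]
    simp_rw [h2]
    rw [integral_integral_swap hi]
    refine integral_congr_ae (Eventually.of_forall fun t => ?_)
    simp only [F, mul_assoc, integral_const_mul]
  have h3 : ∀ x, starRingEnd ℂ (p x) * ∫ y, ((min x y + r : ℝ) : ℂ) * p y =
      ∫ t, starRingEnd ℂ (p x) * (tailInd t x * F t) ∂ν := by
    intro x
    by_cases hx : |x| ≤ r
    · rw [h1 x hx, integral_const_mul]
    · simp [h0 x (not_le.1 hx)]
  have hi : Integrable (fun q : ℝ × ℝ => starRingEnd ℂ (p q.1) * (tailInd q.2 q.1 * F q.2))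
      ((volume : Measure ℝ).prod ν) := by
    refine (hp.norm.mul_prod (integrable_const (∫ x, ‖p x‖) (μ := ν))).mono' ?_
      (Eventually.of_forall fun q => ?_)
    · refine Measurable.aestronglyMeasurable (Measurable.mul ?_ (Measurable.mul ?_ ?_))
      · exact Complex.continuous_conj.measurable.comp (hpm.comp measurable_fst)
      · exact htm.comp (measurable_snd.prodMk measurable_fst)
      · exact hFm.comp measurable_snd
    · rw [norm_mul, norm_mul, RCLike.norm_conj]
      gcongr
      exact (mul_le_of_le_one_left (norm_nonneg _) (norm_tailInd_le _ _)).trans (hFb _)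
  simp_rw [h3]
  refine ⟨hi.integral_prod_left, ?_⟩
  rw [integral_integral_swap hi]
  refine integral_congr_ae (Eventually.of_forall fun t => ?_)
  simp only
  rw [← integral_conj, ← integral_mul_const]
  refine integral_congr_ae (Eventually.of_forall fun x => ?_)
  simp only [map_mul, conj_tailInd]
  ring

/-- The kernel `|x - y|` is strictly negative definite on functions with mean zero. -/
theorem ae_eq_zero_of_integral_abs_eq_zero (hp : Integrable p) (hpm : Measurable p)
    (h0 : ∀ y, r < |y| → p y = 0) (hmean : ∫ y, p y = 0)
    (h : ∫ x, starRingEnd ℂ (p x) * ∫ y, ((|x - y| : ℝ) : ℂ) * p y = 0) : p =ᵐ[volume] 0 := by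
  have hbd : ∀ f : ℝ → ℝ, Continuous f → Integrable fun y => (f y : ℂ) * p y := by
    intro f hf
    obtain ⟨M, hM⟩ := isCompact_Icc.exists_bound_of_continuousOn (s := Set.Icc (-r) r)
      hf.continuousOn
    refine (hp.norm.const_mul M).mono'
      ((by fun_prop : Measurable fun y => (f y : ℂ)).mul hpm).aestronglyMeasurable
      (Eventually.of_forall fun y => ?_)
    by_cases hy : |y| ≤ r
    · rw [norm_mul, Complex.norm_real]
      exact mul_le_mul_of_nonneg_right (hM y (abs_le.1 hy)) (norm_nonneg _)
    · simp [h0 y (not_le.1 hy)]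
  set M1 := ∫ y : ℝ, (y : ℂ) * p y
  have h1 : ∀ x, ∫ y, ((|x - y| : ℝ) : ℂ) * p y = M1 - 2 * ∫ y, ((min x y + r : ℝ) : ℂ) * p y := by
    intro x
    -- Since |x - y| = x + y - 2 min(x, y) and p has mean zero, only the part with min survives in
    -- the quadratic form.
    have e : ∀ y, ((|x - y| : ℝ) : ℂ) * p y =
        ((y : ℂ) * p y + (x + 2 * r) * p y) - 2 * (((min x y + r : ℝ) : ℂ) * p y) := by
      intro y
      have : |x - y| = x + y - 2 * min x y := by
        rcases le_total x y with hxy | hxy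
        · rw [min_eq_left hxy, abs_of_nonpos (by linarith)]; ring
        · rw [min_eq_right hxy, abs_of_nonneg (by linarith)]; ring
      rw [this]
      push_cast
      ring
    have i1 : Integrable fun y : ℝ => (y : ℂ) * p y := hbd (fun y => y) continuous_id
    have i2 : Integrable fun y => ((x : ℂ) + 2 * r) * p y := hp.const_mul _
    have i3 := (hbd (fun y => min x y + r) (by fun_prop)).const_mul 2
    simp_rw [e]
    have s1 := integral_sub (i1.add i2) i3
    simp only [Pi.add_apply] at s1
    rw [s1, integral_add i1 i2, integral_const_mul, integral_const_mul, hmean]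
    ring
  obtain ⟨hmi, hme⟩ := integral_min_mul hp hpm h0
  set F : ℝ → ℂ := fun t => ∫ x, tailInd t x * p x
  -- The tail function is minus a primitive of p. It is therefore continuous and vanishes outside
  -- [-r, r], and its vanishing forces p = 0 almost everywhere by differentiation.
  have hFI : ∀ t, F t = -∫ x in Set.Iic t, p x := by
    intro t
    have e : F t = ∫ x in Set.Ioi t, p x := by
      rw [← integral_indicator measurableSet_Ioi]
      refine integral_congr_ae (Eventually.of_forall fun x => ?_)
      simp [tailInd, Set.indicator_apply]
    have := intervalIntegral.integral_Iic_add_Ioi (f := p) (b := t) hp.integrableOn hp.integrableOn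
    rw [hmean] at this
    rw [e]
    exact eq_neg_of_add_eq_zero_right this
  have hsub : ∀ t, ∫ x in (0 : ℝ)..t, p x = F 0 - F t := by
    intro t
    rw [← intervalIntegral.integral_Iic_sub_Iic hp.integrableOn hp.integrableOn, hFI, hFI]
    ring
  have hGc : Continuous fun t => ∫ x in (0 : ℝ)..t, p x :=
    intervalIntegral.continuous_primitive (fun _ _ => hp.intervalIntegrable) 0
  have hFc : Continuous F := by
    have : F = fun t => F 0 - ∫ x in (0 : ℝ)..t, p x := by
      funext t
      rw [hsub]
      ring
    rw [this]
    exact continuous_const.sub hGc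
  have hF2 : ∫ t in Set.Ioc (-r) r, ‖F t‖ ^ 2 = 0 := by
    have e1 : ∫ x, starRingEnd ℂ (p x) * ∫ y, ((|x - y| : ℝ) : ℂ) * p y =
        0 - 2 * ∫ x, starRingEnd ℂ (p x) * ∫ y, ((min x y + r : ℝ) : ℂ) * p y := by
      have hconj : ∫ x, starRingEnd ℂ (p x) = 0 := by rw [integral_conj, hmean, map_zero]
      have i1 : Integrable fun x => starRingEnd ℂ (p x) * M1 :=
        (LinearIsometryEquiv.integrable_comp_iff (Complex.conjLIE) (φ := p)).2 hp |>.mul_const M1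
      have s1 := integral_sub i1 (hmi.const_mul 2)
      rw [integral_mul_const, hconj, zero_mul, integral_const_mul] at s1
      rw [← s1]
      refine integral_congr_ae (Eventually.of_forall fun x => ?_)
      simp only [h1]
      ring
    rw [h, hme] at e1
    have e2 : ∫ t in Set.Ioc (-r) r, starRingEnd ℂ (F t) * F t =
        ((∫ t in Set.Ioc (-r) r, ‖F t‖ ^ 2 : ℝ) : ℂ) := by
      rw [← integral_complex_ofReal]
      refine integral_congr_ae (Eventually.of_forall fun t => ?_)
      simp only
      rw [Complex.conj_mul', Complex.ofReal_pow]
    rw [e2] at e1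
    have e3 : (((∫ t in Set.Ioc (-r) r, ‖F t‖ ^ 2 : ℝ)) : ℂ) = 0 := by linear_combination (1 / 2) * e1
    exact_mod_cast e3
  have hFae : ∀ᵐ t, t ∈ Set.Ioc (-r) r → F t = 0 := by
    rw [← ae_restrict_iff' measurableSet_Ioc]
    have := (integral_eq_zero_iff_of_nonneg (fun t => sq_nonneg ‖F t‖)
      ((hFc.norm.pow 2).integrableOn_Ioc)).1 hF2
    filter_upwards [this] with t ht
    simpa using ht
  have hout : ∀ t, t ∉ Set.Icc (-r) r → F t = 0 := by
    intro t ht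
    simp only [Set.mem_Icc, not_and_or, not_le] at ht
    rcases ht with ht | ht
    · rw [hFI, setIntegral_eq_zero_of_forall_eq_zero, neg_zero]
      intro x hx
      have hx' : x ≤ t := hx
      exact h0 x (lt_abs.2 (Or.inr (by linarith)))
    · refine integral_eq_zero_of_ae (Eventually.of_forall fun x => ?_)
      simp only [tailInd, Pi.zero_apply]
      split_ifs with hx
      · rw [h0 x (lt_abs.2 (Or.inl (ht.trans hx))), mul_zero]
      · rw [zero_mul]
  have hF0 : F = fun _ => 0 := by
    refine (hFc.ae_eq_iff_eq volume continuous_const).1 ?_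
    have hne : ∀ᵐ t : ℝ, t ≠ -r := by simp [ae_iff]
    filter_upwards [hFae, hne] with t ht hr
    by_cases h : t ∈ Set.Icc (-r) r
    · exact ht ⟨lt_of_le_of_ne h.1 hr.symm, h.2⟩
    · exact hout t h
  filter_upwards [LocallyIntegrable.ae_hasDerivAt_integral hp.locallyIntegrable] with x hx
  have h2 := hx 0
  have h3 : (fun t => ∫ x in (0 : ℝ)..t, p x) = fun _ => (0 : ℂ) := by
    funext t
    rw [hsub, hF0, sub_zero]
  rw [h3] at h2
  exact h2.unique (hasDerivAt_const x 0)

variable {w : Weight}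

theorem weight_memLp (w : Weight) : MemLp (fun q : ℝ × ℝ => (w q.1 : ℂ)) 2 slabMeasure := by
  have hm1 : Measurable fun x => (w x : ℂ) := by
    have := w.measurable
    fun_prop
  have h1 : MemLp (fun x => (w x : ℂ)) 2 volume := by
    have h2 : MemLp ((Set.Icc (-w.radius) w.radius).indicator fun _ => (1 : ℂ)) 2 volume :=
      memLp_indicator_const 2 measurableSet_Icc 1 (Or.inr (by simp))
    refine (memLp_weight_mul (w := w) h2).ae_eq (Eventually.of_forall fun x => ?_)
    by_cases hx : x ∈ Set.Icc (-w.radius) w.radius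
    · simp [hx]
    · have : w.radius < |x| := by
        by_contra h
        exact hx (abs_le.1 (not_lt.1 h))
      simp [w.supp this]
  refine memLp_two_of_lintegral_lt_top (hm1.comp measurable_fst).aestronglyMeasurable ?_
  change ∫⁻ q, ‖(w q.1 : ℂ)‖ₑ ^ 2 ∂slabMeasure < ∞
  rw [lintegral_slab_fst (f := fun x => ‖(w x : ℂ)‖ₑ ^ 2) (hm1.enorm.pow_const 2).aemeasurable]
  exact ENNReal.mul_lt_top (by norm_num) (MemLp.lintegral_sq_lt_top h1)

/-- The weight as an element of the phase space. -/
def Weight.vec (w : Weight) : Slab := (weight_memLp w).toLp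

theorem coeFn_vec : w.vec =ᵐ[slabMeasure] fun q => (w q.1 : ℂ) := (weight_memLp w).coeFn_toLp

theorem inner_vec (u : Slab) : inner ℂ w.vec u = 2 * ∫ x, w x * angleMean u x := by
  rw [inner_eq_integral_angleMean (p := fun x => (w x : ℂ)) coeFn_vec]
  simp only [Complex.conj_ofReal]

theorem convOp_one_apply (u : Slab) :
    convOp w (fun _ => 1) u = (1 / 2 * inner ℂ w.vec u) • w.vec := by
  refine Lp.ext ?_
  filter_upwards [coeFn_convOp (w := w) isAdmissible_one u, coeFn_vec (w := w),
    Lp.coeFn_smul (1 / 2 * inner ℂ w.vec u) w.vec] with q h1 h2 h3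
  rw [h1, h3, Pi.smul_apply, h2, inner_vec, smul_eq_mul]
  simp only [one_mul]
  ring

theorem isAdmissible_abs : IsAdmissible w fun t => ((|t| : ℝ) : ℂ) :=
  isAdmissible_of_bounded (by fun_prop) (m := 2 * w.radius) fun t ht => by
    rwa [Complex.norm_real, Real.norm_eq_abs, abs_abs]

theorem weight_mul_angleMean_eq_zero {u : Slab} (h1 : inner ℂ w.vec u = 0)
    (h2 : inner ℂ u (convOp w (fun t => ((|t| : ℝ) : ℂ)) u) = 0) :
    (fun x => (w x : ℂ) * angleMean u x) =ᵐ[volume] 0 := by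
  set p : ℝ → ℂ := fun x => w x * angleMean u x with hp
  have hpL : MemLp p 2 volume := memLp_weight_mul (memLp_angleMean u)
  have hwm : Measurable fun x => (w x : ℂ) := by have := w.measurable; fun_prop
  have hpm : Measurable p := hwm.mul (measurable_angleMean u)
  have hp0 : ∀ y, w.radius < |y| → p y = 0 := fun y hy => by simp [hp, w.supp hy]
  have hpi : Integrable p := by
    have := (isAdmissible_one (w := w)).integrable_mul hpL (fun t ht => hp0 t (by
      linarith [w.radius_pos]))
    simpa using this
  refine ae_eq_zero_of_integral_abs_eq_zero hpi hpm hp0 ?_ ?_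
  · rw [inner_vec] at h1
    exact (mul_eq_zero.1 h1).resolve_left two_ne_zero
  · rw [← inner_conj_symm, inner_eq_integral_angleMean
      (p := fun x => w x * ∫ y, ((|x - y| : ℝ) : ℂ) * p y) (coeFn_convOp isAdmissible_abs u),
      map_mul, ← integral_conj, map_ofNat] at h2
    have h3 := (mul_eq_zero.1 h2).resolve_left two_ne_zero
    rw [← h3]
    refine integral_congr_ae (Eventually.of_forall fun x => ?_)
    simp only [hp, map_mul, Complex.conj_ofReal, Complex.conj_conj]
    ring

/-- The kernel of a selfadjoint operator is orthogonal to the closure of its range. -/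
theorem eq_zero_of_mem_defectSpace {H : Type*} [NormedAddCommGroup H] [InnerProductSpace ℂ H]
    [CompleteSpace H] {V : H →L[ℂ] H} (hV : IsSelfAdjoint V) {u : H} (hu : u ∈ defectSpace V)
    (h : V u = 0) : u = 0 := by
  have h1 : u ∈ (V.range)ᗮ := by
    rw [Submodule.mem_orthogonal]
    rintro _ ⟨x, rfl⟩
    have h2 : inner ℂ (V x) u = inner ℂ x (V u) :=
      ContinuousLinearMap.isSelfAdjoint_iff_isSymmetric.1 hV x u
    exact h2.trans (by rw [h, inner_zero_right])
  have h2 : u ∈ (defectSpace V)ᗮ := by rwa [defectSpace, Submodule.orthogonal_closure]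
  exact inner_self_eq_zero.1 ((Submodule.mem_orthogonal _ _).1 h2 u hu)

end DistanceKernel

/-! ### Behaviour of the kernel operator near the real axis -/

section Decomposition

/-- The closed upper half-plane. -/
def closedUpperHalf : Set ℂ := {z | 0 ≤ z.im}

variable (w : Weight)

/-- The operator with kernel `½ w(x) (γ + ln |x - y|) w(y)`. -/
def logOp : Slab →L[ℂ] Slab :=
  convOp w fun t => 1 / 2 * (Real.eulerMascheroniConstant + (Real.log |t| : ℂ))

/-- The operator with kernel `w(x) Ein(-iz|x - y|) w(y)`. -/
def einOp (z : ℂ) : Slab →L[ℂ] Slab :=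
  convOp w fun t => expEin (-(Complex.I * z) * (|t| : ℝ))

/-- The operator with kernel `w(x) |x - y| w(y)`. -/
def absOp : Slab →L[ℂ] Slab := convOp w fun t => ((|t| : ℝ) : ℂ)

variable {w}

theorem isAdmissible_logSymbol :
    IsAdmissible w fun t => 1 / 2 * (Real.eulerMascheroniConstant + (Real.log |t| : ℂ)) :=
  ((isAdmissible_const _).add isAdmissible_log).const_mul _

theorem IsAdmissible.sub {φ ψ : ℝ → ℂ} (hφ : IsAdmissible w φ) (hψ : IsAdmissible w ψ) :
    IsAdmissible w (fun t => φ t - ψ t) :=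
  ⟨hφ.1.sub hψ.1, hφ.2.sub hψ.2⟩

theorem convOp_sub {φ ψ : ℝ → ℂ} (hφ : IsAdmissible w φ) (hψ : IsAdmissible w ψ) :
    convOp w (fun t => φ t - ψ t) = convOp w φ - convOp w ψ := by
  have := convOp_add hφ (hψ.const_mul (-1))
  rw [convOp_const_mul hψ, neg_one_smul, ← sub_eq_add_neg] at this
  rw [← this]
  congr 1
  funext t
  ring

/-- The three terms isolate the behaviour at z = 0: a fixed compact operator, a logarithmically
divergent rank one term, and a remainder of order z. -/
theorem convOp_transportSymbol {z : ℂ} (hz : z ∈ closedUpperHalf) :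
    convOp w (transportSymbol z) = -logOp w -
      (1 / 2 * Complex.log (-(Complex.I * z))) • convOp w (fun _ => 1) +
        (1 / 2 : ℂ) • einOp w z := by
  have h1 := isAdmissible_logSymbol (w := w)
  have h2 := isAdmissible_one (w := w)
  have h3 := isAdmissible_expEin (w := w) hz
  rw [logOp, einOp, ← convOp_const_mul h2, ← convOp_const_mul h3, ← neg_one_smul ℂ (convOp w _),
    ← convOp_const_mul h1, ← convOp_sub (h1.const_mul _) (h2.const_mul _),
    ← convOp_add ((h1.const_mul _).sub (h2.const_mul _)) (h3.const_mul _)]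
  congr 1
  funext t
  rw [transportSymbol]
  ring

theorem norm_mul_abs_le {z : ℂ} {t : ℝ} (ht : |t| ≤ 2 * w.radius) :
    ‖-(Complex.I * z) * (|t| : ℝ)‖ ≤ ‖z‖ * (2 * w.radius) := by
  rw [norm_mul, norm_neg, norm_mul, Complex.norm_I, one_mul, Complex.norm_real, Real.norm_eq_abs,
    abs_abs]
  gcongr

theorem norm_einOp_sub_le {z z' : ℂ} (hz : z ∈ closedUpperHalf) (hz' : z' ∈ closedUpperHalf) :
    ‖einOp w z - einOp w z'‖ ≤ ‖z - z'‖ * (2 * w.radius) * w.opBound := by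
  rw [einOp, einOp, ← convOp_sub (isAdmissible_expEin hz) (isAdmissible_expEin hz')]
  refine norm_convOp_le ((continuous_expEin_abs hz).sub (continuous_expEin_abs hz')).measurable
    fun t ht => ?_
  refine (norm_expEin_sub_le (re_neg_I_mul_abs_nonneg hz t) (re_neg_I_mul_abs_nonneg hz' t)).trans ?_
  refine le_of_eq_of_le ?_ (norm_mul_abs_le (z := z - z') ht)
  congr 1
  ring

theorem einOp_zero : einOp w 0 = 0 := by
  have := convOp_const_mul (isAdmissible_one (w := w)) 0
  rw [zero_smul] at this
  rw [einOp, ← this]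
  congr 1
  funext t
  simp [expEin_zero]

theorem norm_einOp_le {z : ℂ} (hz : z ∈ closedUpperHalf) :
    ‖einOp w z‖ ≤ ‖z‖ * (2 * w.radius) * w.opBound := by
  simpa [einOp_zero] using norm_einOp_sub_le (w := w) hz (z' := 0) (by simp [closedUpperHalf])

theorem tendsto_inv_smul_einOp :
    Tendsto (fun z => z⁻¹ • einOp w z) (𝓝[closedUpperHalf \ {0}] 0)
      (𝓝 (-(Complex.I • absOp w))) := by
  have hr := w.radius_pos
  -- For ‖z‖ ≤ 1/(2r) the argument -iz|t| has modulus at most 1, as the quadratic estimate for Ein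
  -- requires.
  have key : ∀ z ∈ closedUpperHalf, z ≠ 0 → ‖z‖ ≤ 1 / (2 * w.radius) →
      ‖z⁻¹ • einOp w z - -(Complex.I • absOp w)‖ ≤ ‖z‖ * ((2 * w.radius) ^ 2 * w.opBound) := by
    intro z hz h0 hle
    have h1 : ‖einOp w z + (Complex.I * z) • absOp w‖ ≤
        (‖z‖ * (2 * w.radius)) ^ 2 * w.opBound := by
      have e : einOp w z + (Complex.I * z) • absOp w = convOp w fun t =>
          expEin (-(Complex.I * z) * (|t| : ℝ)) + (Complex.I * z) * ((|t| : ℝ) : ℂ) := by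
        rw [convOp_add (isAdmissible_expEin hz) (isAdmissible_abs.const_mul _),
          convOp_const_mul isAdmissible_abs]
        rfl
      rw [e]
      refine norm_convOp_le ((continuous_expEin_abs hz).add (by fun_prop)).measurable
        fun t ht => ?_
      have h2 := norm_mul_abs_le (z := z) ht
      have h3 : ‖-(Complex.I * z) * (|t| : ℝ)‖ ≤ 1 := by
        refine h2.trans ?_
        rwa [← le_div_iff₀ (by positivity)]
      refine le_trans (le_of_eq_of_le ?_
        (norm_expEin_sub_self_le (re_neg_I_mul_abs_nonneg hz t) h3)) (by gcongr)
      simp only [Pi.add_apply]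
      congr 1
      ring
    have e2 : z⁻¹ • einOp w z - -(Complex.I • absOp w) =
        z⁻¹ • (einOp w z + (Complex.I * z) • absOp w) := by
      rw [sub_neg_eq_add, smul_add, smul_smul, mul_comm Complex.I z, inv_mul_cancel_left₀ h0]
    rw [e2, norm_smul, norm_inv, inv_mul_le_iff₀ (norm_pos_iff.2 h0)]
    refine h1.trans (le_of_eq ?_)
    ring
  rw [tendsto_iff_norm_sub_tendsto_zero]
  have hlim : Tendsto (fun z : ℂ => ‖z‖ * ((2 * w.radius) ^ 2 * w.opBound))
      (𝓝[closedUpperHalf \ {0}] 0) (𝓝 0) := by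
    have : Continuous fun z : ℂ => ‖z‖ * ((2 * w.radius) ^ 2 * w.opBound) := by fun_prop
    have h := (this.tendsto 0).mono_left (nhdsWithin_le_nhds (s := closedUpperHalf \ {0}))
    simpa using h
  refine squeeze_zero' (Eventually.of_forall fun _ => norm_nonneg _) ?_ hlim
  have hball : ∀ᶠ z : ℂ in 𝓝[closedUpperHalf \ {0}] 0, ‖z‖ ≤ 1 / (2 * w.radius) := by
    refine nhdsWithin_le_nhds ?_
    filter_upwards [Metric.ball_mem_nhds (0 : ℂ) (by positivity : 0 < 1 / (2 * w.radius))] with z hz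
    exact (mem_ball_zero_iff.1 hz).le
  filter_upwards [hball, self_mem_nhdsWithin] with z h1 h2
  exact key z h2.1 h2.2 h1

/-- Multiplication by -i rotates the closed upper half-plane onto the closed right half-plane, so
the principal logarithm is continuous up to the punctured real axis. -/
theorem neg_I_mul_mem_slitPlane {z : ℂ} (hz : z ∈ closedUpperHalf) (h0 : z ≠ 0) :
    -(Complex.I * z) ∈ Complex.slitPlane := by
  rw [Complex.mem_slitPlane_iff]
  have hz' : 0 ≤ z.im := hz
  simp only [Complex.neg_re, Complex.mul_re, Complex.I_re, zero_mul, Complex.I_im, one_mul,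
    zero_sub, neg_neg, Complex.neg_im, Complex.mul_im, zero_add]
  rcases hz'.lt_or_eq with h | h
  · exact Or.inl h
  · refine Or.inr fun h1 => h0 (Complex.ext ?_ h.symm)
    simpa using h1

theorem continuousOn_convOp_transportSymbol :
    ContinuousOn (fun z => convOp w (transportSymbol z)) (closedUpperHalf \ {0}) := by
  have h1 : ContinuousOn (fun z => einOp w z) (closedUpperHalf \ {0}) := by
    intro z hz
    refine tendsto_iff_norm_sub_tendsto_zero.2 ?_
    have hlim : Tendsto (fun z' : ℂ => ‖z' - z‖ * (2 * w.radius) * w.opBound)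
        (𝓝[closedUpperHalf \ {0}] z) (𝓝 0) := by
      have : Continuous fun z' : ℂ => ‖z' - z‖ * (2 * w.radius) * w.opBound := by fun_prop
      have h := (this.tendsto z).mono_left (nhdsWithin_le_nhds (s := closedUpperHalf \ {0}))
      simpa using h
    refine squeeze_zero' (Eventually.of_forall fun _ => norm_nonneg _) ?_ hlim
    filter_upwards [self_mem_nhdsWithin] with z' hz'
    exact norm_einOp_sub_le hz'.1 hz.1
  have h2 : ContinuousOn (fun z : ℂ => Complex.log (-(Complex.I * z))) (closedUpperHalf \ {0}) :=
    ContinuousOn.clog (by fun_prop) fun z hz => neg_I_mul_mem_slitPlane hz.1 hz.2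
  refine ContinuousOn.congr ?_ fun z hz => convOp_transportSymbol hz.1
  exact (continuousOn_const.sub ((h2.const_mul _).smul continuousOn_const)).add ((continuousOn_const (c := (1 / 2 : ℂ))).smul h1)

theorem abs_log_norm_le (z : ℂ) : |Real.log ‖z‖| ≤ ‖Complex.log (-(Complex.I * z))‖ := by
  have h := Complex.abs_re_le_norm (Complex.log (-(Complex.I * z)))
  rw [Complex.log_re, norm_neg, norm_mul, Complex.norm_I, one_mul] at h
  exact h

theorem norm_log_le (z : ℂ) :
    ‖Complex.log (-(Complex.I * z))‖ ≤ |Real.log ‖z‖| + Real.pi := by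
  refine (Complex.norm_le_abs_re_add_abs_im _).trans ?_
  rw [Complex.log_re, Complex.log_im, norm_neg, norm_mul, Complex.norm_I, one_mul]
  gcongr
  exact Complex.abs_arg_le_pi _

/-- Together with `tendsto_mul_log` these are the two growth conditions on the rank one coefficient
in `exists_lower_bound`. -/
theorem tendsto_norm_log_atTop {a : ℂ} (ha : a ≠ 0) :
    Tendsto (fun z => ‖a * Complex.log (-(Complex.I * z))‖) (𝓝[≠] 0) atTop := by
  have h1 : Tendsto (fun z : ℂ => ‖z‖) (𝓝[≠] 0) (𝓝[>] 0) := tendsto_norm_nhdsNE_zero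
  have h2 : Tendsto (fun z : ℂ => |Real.log ‖z‖|) (𝓝[≠] 0) atTop :=
    tendsto_abs_atBot_atTop.comp (Real.tendsto_log_nhdsGT_zero.comp h1)
  refine tendsto_atTop_mono (fun z => ?_) (h2.const_mul_atTop (norm_pos_iff.2 ha))
  rw [norm_mul]
  exact mul_le_mul_of_nonneg_left (abs_log_norm_le z) (norm_nonneg _)

theorem tendsto_mul_log (a : ℂ) :
    Tendsto (fun z => z * (a * Complex.log (-(Complex.I * z)))) (𝓝[≠] 0) (𝓝 0) := by
  have h1 : Continuous fun z : ℂ => ‖a‖ * (|‖z‖ * Real.log ‖z‖| + ‖z‖ * Real.pi) := by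
    have := Real.continuous_mul_log
    have h2 : Continuous fun z : ℂ => ‖z‖ * Real.log ‖z‖ := this.comp continuous_norm
    fun_prop
  have h3 := (h1.tendsto 0).mono_left (nhdsWithin_le_nhds (s := {0}ᶜ))
  simp only [norm_zero, zero_mul, abs_zero, add_zero, mul_zero] at h3
  refine squeeze_zero_norm (fun z => ?_) h3
  rw [norm_mul, norm_mul, abs_mul, abs_norm, ← mul_add, mul_left_comm]
  gcongr
  exact norm_log_le z

end Decomposition

/-! ### Cayley transforms and spectral singularities -/

section Cayley

variable {E : Type*} [NormedAddCommGroup E] [InnerProductSpace ℂ E]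

theorem mem_closedUpperHalf_of_mem_upperHalf {z : ℂ} (hz : z ∈ upperHalf) :
    z ∈ closedUpperHalf \ {0} :=
  ⟨(show 0 < z.im from hz).le, by rintro rfl; simp [upperHalf] at hz⟩

theorem ofReal_mem_closedUpperHalf {k : ℝ} (hk : k ≠ 0) : (k : ℂ) ∈ closedUpperHalf \ {0} :=
  ⟨by simp [closedUpperHalf], by simpa using hk⟩

/-- The operator `(I - B) (I + B)⁻¹`. -/
def cayley (B : E →L[ℂ] E) : E →L[ℂ] E := (1 - B) * Ring.inverse (1 + B)

theorem eq_cayley {S B : E →L[ℂ] E} (h : S * (1 + B) = 1 - B) (hu : IsUnit (1 + B)) :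
    S = cayley B := by
  rw [cayley, ← h, mul_assoc, Ring.mul_inverse_cancel _ hu, mul_one]

/-- The two factors commute. With the contraction on the left, ‖S h‖ is bounded by ‖(1 - B)h‖. -/
theorem cayley_eq {B : E →L[ℂ] E} (hu : IsUnit (1 + B)) :
    cayley B = Ring.inverse (1 + B) * (1 - B) := by
  have h1 : (1 + B) * (1 - B) = (1 - B) * (1 + B) := by noncomm_ring
  calc cayley B = Ring.inverse (1 + B) * ((1 + B) * (1 - B)) * Ring.inverse (1 + B) := by
        rw [← mul_assoc, Ring.inverse_mul_cancel _ hu, one_mul, cayley]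
    _ = _ := by rw [h1, ← mul_assoc, mul_assoc, Ring.mul_inverse_cancel _ hu, mul_one]

theorem inverse_cayley {B : E →L[ℂ] E} (hu : IsUnit (1 + B)) (hv : IsUnit (1 - B)) :
    IsUnit (cayley B) ∧ Ring.inverse (cayley B) = (2 : ℂ) • Ring.inverse (1 - B) - 1 := by
  have h1 : (2 : ℂ) • Ring.inverse (1 - B) - 1 = (1 + B) * Ring.inverse (1 - B) := by
    -- This rewriting leaves (1 - B)⁻¹ as the only unbounded ingredient of the inverse.
    have h2 : (1 + B : E →L[ℂ] E) = (2 : ℂ) • 1 - (1 - B) := by module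
    rw [h2, sub_mul, Ring.mul_inverse_cancel _ hv, smul_mul_assoc, one_mul]
  have h3 : (1 + B) * Ring.inverse (1 - B) * cayley B = 1 := by
    rw [cayley, mul_assoc, ← mul_assoc (Ring.inverse (1 - B)), Ring.inverse_mul_cancel _ hv,
      one_mul, Ring.mul_inverse_cancel _ hu]
  have h4 : cayley B * ((1 + B) * Ring.inverse (1 - B)) = 1 := by
    rw [cayley, mul_assoc, ← mul_assoc (Ring.inverse (1 + B)), Ring.inverse_mul_cancel _ hu,
      one_mul, Ring.mul_inverse_cancel _ hv]
  let U : (E →L[ℂ] E)ˣ := ⟨cayley B, (1 + B) * Ring.inverse (1 - B), h4, h3⟩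
  exact ⟨⟨U, rfl⟩, (Ring.inverse_unit U).trans h1.symm⟩

theorem norm_inverse_cayley_le {B : E →L[ℂ] E} (hu : IsUnit (1 + B)) (hv : IsUnit (1 - B)) {m : ℝ}
    (hm : ‖Ring.inverse (1 - B)‖ ≤ m) : ‖Ring.inverse (cayley B)‖ ≤ 2 * m + 1 := by
  rw [(inverse_cayley hu hv).2]
  refine (norm_sub_le _ _).trans (add_le_add ?_ ContinuousLinearMap.norm_id_le)
  rw [norm_smul, RCLike.norm_ofNat]
  gcongr

theorem norm_cayley_apply_le {B : E →L[ℂ] E} (hu : IsUnit (1 + B))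
    (h1 : ‖Ring.inverse (1 + B)‖ ≤ 1) (h : E) : ‖cayley B h‖ ≤ ‖(1 - B) h‖ := by
  rw [cayley_eq hu]
  refine ((Ring.inverse (1 + B)).le_opNorm ((1 - B) h)).trans ?_
  exact mul_le_of_le_one_left (norm_nonneg _) h1

variable [CompleteSpace E]

/-- Fredholm alternative: either 1 is an eigenvalue of the compact operator B, excluded by the lower
bound, or 1 - B is invertible. -/
theorem isUnit_one_sub_of_lower_bound {B : E →L[ℂ] E} (hB : IsCompactOperator B) {m : ℝ}
    (hm : 0 < m) (h : ∀ u, m * ‖u‖ ≤ ‖(1 - B) u‖) :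
    IsUnit (1 - B) ∧ ‖Ring.inverse (1 - B)‖ ≤ 1 / m := by
  have hu : IsUnit (1 - B) := by
    rcases hB.hasEigenvalue_or_mem_resolventSet (μ := (1 : ℂ)) one_ne_zero with h1 | h1
    · obtain ⟨v, hv⟩ := h1.exists_hasEigenvector
      have h2 : B v = v := by simpa using hv.apply_eq_smul
      have h3 := h v
      have h4 : (1 - B) v = 0 := by
        change v - B v = 0
        rw [h2, sub_self]
      rw [h4, norm_zero] at h3
      exact absurd (norm_pos_iff.2 hv.2) (by nlinarith)
    · simpa [resolventSet] using h1
  refine ⟨hu, ContinuousLinearMap.opNorm_le_bound _ (by positivity) fun v => ?_⟩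
  have h3 : (1 - B) (Ring.inverse (1 - B) v) = v :=
    congrArg (fun X : E →L[ℂ] E => X v) (Ring.mul_inverse_cancel _ hu)
  have h4 := h (Ring.inverse (1 - B) v)
  rw [h3] at h4
  rw [one_div, inv_mul_eq_div, le_div_iff₀ hm]
  linarith

/-- A function which is the Cayley transform of `B` in the upper half-plane, where `I + B` has a
contractive inverse up to the punctured real axis. -/
structure IsCayleyTransform (S B : ℂ → E →L[ℂ] E) : Prop where
  eq : ∀ z ∈ upperHalf, S z * (1 + B z) = 1 - B z
  isUnit : ∀ z ∈ closedUpperHalf \ {0}, IsUnit (1 + B z)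
  norm_le : ∀ z ∈ closedUpperHalf \ {0}, ‖Ring.inverse (1 + B z)‖ ≤ 1
  continuousOn : ContinuousOn B (closedUpperHalf \ {0})

variable {S B : ℂ → E →L[ℂ] E}

omit [CompleteSpace E] in
theorem IsCayleyTransform.eq_cayley (hS : IsCayleyTransform S B) {z : ℂ} (hz : z ∈ upperHalf) :
    S z = cayley (B z) :=
  SlabTransport.eq_cayley (hS.eq z hz) (hS.isUnit z (mem_closedUpperHalf_of_mem_upperHalf hz))

/-- Continuity of inversion at an invertible operator gives a norm limit within the whole
half-plane, stronger than the strong nontangential limit required. -/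
theorem IsCayleyTransform.tendsto (hS : IsCayleyTransform S B) {k : ℝ} (hk : k ≠ 0) :
    Tendsto S (𝓝[upperHalf] k) (𝓝 (cayley (B k))) := by
  have hB : Tendsto B (𝓝[upperHalf] k) (𝓝 (B k)) :=
    (hS.continuousOn k (ofReal_mem_closedUpperHalf hk)).mono_left
      (nhdsWithin_mono _ fun z hz => mem_closedUpperHalf_of_mem_upperHalf hz)
  obtain ⟨U, hU⟩ := hS.isUnit k (ofReal_mem_closedUpperHalf hk)
  have h1 : Tendsto (fun z => Ring.inverse (1 + B z)) (𝓝[upperHalf] k)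
      (𝓝 (Ring.inverse (1 + B k))) := by
    have h2 : ContinuousAt Ring.inverse (1 + B k) := hU ▸ NormedRing.inverse_continuousAt U
    exact h2.tendsto.comp (hB.const_add 1)
  refine ((hB.const_sub 1).mul h1).congr' ?_
  filter_upwards [self_mem_nhdsWithin] with z hz
  exact (hS.eq_cayley hz).symm

theorem IsCayleyTransform.hasBoundaryValue (hS : IsCayleyTransform S B) {k : ℝ} (hk : k ≠ 0) :
    HasBoundaryValue S k (cayley (B k)) := by
  intro a _ h
  have h1 : Tendsto S (𝓝[stolzAngle a k] k) (𝓝 (cayley (B k))) :=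
    (hS.tendsto hk).mono_left (nhdsWithin_mono _ fun z hz => hz.1)
  exact ((ContinuousLinearMap.apply ℂ E h).continuous.tendsto _).comp h1

theorem tendsto_ofReal_add_mul_I {ε : ℕ → ℝ} (hε : ∀ n, 0 < ε n) (h0 : Tendsto ε atTop (𝓝 0))
    (k : ℝ) : Tendsto (fun n => (k + ε n * Complex.I : ℂ)) atTop (𝓝[stolzAngle 1 k] k) := by
  refine tendsto_nhdsWithin_iff.2 ⟨?_, Eventually.of_forall fun n => ?_⟩
  · have h1 : Tendsto (fun n => (ε n : ℂ)) atTop (𝓝 ((0 : ℝ) : ℂ)) :=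
      (Complex.continuous_ofReal.tendsto 0).comp h0
    have h2 := (h1.mul_const Complex.I).const_add (k : ℂ)
    simpa using h2
  · simp [stolzAngle, hε n, (hε n).le]

/-- If the boundary values of a contractive function, applied to a fixed vector, vanish at a
point, then this point is not proper. -/
theorem not_isProperPoint {S : ℂ → E →L[ℂ] E} {A : ℝ → E →L[ℂ] E}
    (hA : ∀ k : ℝ, k ≠ 0 → HasBoundaryValue S k (A k)) {h : E} (hh : h ≠ 0) {C₁ : ℝ}
    (hC₁ : ∀ k : ℝ, k ≠ 0 → ‖A k h‖ ≤ C₁ * |k|) : ¬ IsProperPoint S 0 := by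
  rintro ⟨Si, Se, hf, δ, hδ, C, hC⟩
  -- A limit of Se h along one sequence of heights is enough: Si and S have nontangential limits, in
  -- particular along this sequence.
  obtain ⟨ε, hε, hε0, hlim⟩ := exists_ae_tendsto_of_bounded (f := fun z => Se z h) (M := ‖h‖)
    (fun z hz => (hf.contractive_outer.1 z hz).clm_apply (differentiableWithinAt_const h))
    (fun z hz => ((Se z).le_opNorm h).trans
      (mul_le_of_le_one_left (norm_nonneg _) (hf.contractive_outer.2 z hz)))
  have hz : ∀ (k : ℝ) n, (k + ε n * Complex.I : ℂ) ∈ upperHalf := fun k n => by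
    simp [upperHalf, hε n]
  have key : ∀ᵐ k : ℝ, k ≠ 0 → |k| < δ → ‖h‖ ≤ |C| * (C₁ * |k|) := by
    filter_upwards [hlim, hf.isometric] with k ⟨v, hv⟩ ⟨B, hB, hBi⟩ hk0 hkδ
    have hst := tendsto_ofReal_add_mul_I hε hε0 k
    have h1 : Tendsto (fun n => Si (k + ε n * Complex.I) (Se (k + ε n * Complex.I) h)) atTop
        (𝓝 (B v)) := by
      have h2 : Tendsto (fun n => Si (k + ε n * Complex.I) v) atTop (𝓝 (B v)) :=
        (hB 1 one_pos v).comp hst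
      have h3 : Tendsto (fun n => Si (k + ε n * Complex.I) (Se (k + ε n * Complex.I) h - v)) atTop
          (𝓝 0) := by
        refine squeeze_zero_norm (fun n => ?_) (tendsto_iff_norm_sub_tendsto_zero.1 hv)
        exact ((Si _).le_opNorm _).trans
          (mul_le_of_le_one_left (norm_nonneg _) (hf.contractive_inner.2 _ (hz k n)))
      have h4 := h3.add h2
      rw [zero_add] at h4
      refine h4.congr fun n => ?_
      rw [map_sub, sub_add_cancel]
    have h2 : Tendsto (fun n => S (k + ε n * Complex.I) h) atTop (𝓝 (A k h)) :=
      (hA k hk0 1 one_pos h).comp hst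
    -- The boundary value of Si is isometric, so the limit v of Se h has the same norm as the
    -- boundary value of S applied to h.
    have h3 : B v = A k h := tendsto_nhds_unique h1 (h2.congr fun n => by
      rw [hf.factor _ (hz k n)]; rfl)
    have h4 : ‖v‖ ≤ C₁ * |k| := by
      rw [← hBi v, h3]
      exact hC₁ k hk0
    have h5 : ∀ᶠ n in atTop, ‖h‖ ≤ |C| * ‖Se (k + ε n * Complex.I) h‖ := by
      have h6 : ∀ᶠ n in atTop, ‖(k + ε n * Complex.I : ℂ)‖ < δ := by
        have h7 : Tendsto (fun n => ‖(k + ε n * Complex.I : ℂ)‖) atTop (𝓝 ‖(k : ℂ)‖) :=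
          (hst.mono_right nhdsWithin_le_nhds).norm
        rw [Complex.norm_real] at h7
        exact h7.eventually_lt_const hkδ
      filter_upwards [h6] with n hn
      obtain ⟨hu, hle⟩ := hC (k + ε n * Complex.I) ⟨hz k n, by simpa using hn.le⟩
      have h8 : Ring.inverse (Se (k + ε n * Complex.I)) (Se (k + ε n * Complex.I) h) = h :=
        congrArg (fun X : E →L[ℂ] E => X h) (Ring.inverse_mul_cancel _ hu)
      calc ‖h‖ = ‖Ring.inverse (Se (k + ε n * Complex.I)) (Se (k + ε n * Complex.I) h)‖ := by
            rw [h8]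
        _ ≤ ‖Ring.inverse (Se (k + ε n * Complex.I))‖ * ‖Se (k + ε n * Complex.I) h‖ :=
            ContinuousLinearMap.le_opNorm _ _
        _ ≤ _ := by
            gcongr
            exact hle.trans (le_abs_self C)
    have h9 : ‖h‖ ≤ |C| * ‖v‖ := ge_of_tendsto (hv.norm.const_mul |C|) h5
    exact h9.trans (by gcongr)
  have hh' := norm_pos_iff.2 hh
  -- For 0 < k < η one has |C| |C₁| k < ‖h‖, contradicting the estimate at almost every k. The added
  -- 1 avoids division by zero.
  set η := min δ (‖h‖ / (|C| * |C₁| + 1))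
  have hη : 0 < η := by positivity
  obtain ⟨k, hk, hkη⟩ : ∃ k : ℝ, (k ≠ 0 → |k| < δ → ‖h‖ ≤ |C| * (C₁ * |k|)) ∧ k ∈ Set.Ioo 0 η := by
    have hpos : 0 < volume (Set.Ioo 0 η) := by simpa using hη
    have hfr : ∃ᵐ k ∂(volume : Measure ℝ), k ∈ Set.Ioo 0 η := by
      rw [frequently_ae_mem_iff]
      exact hpos.ne'
    obtain ⟨k, h1, h2⟩ := (hfr.and_eventually key).exists
    exact ⟨k, h2, h1⟩
  have hkabs : |k| = k := abs_of_pos hkη.1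
  have h1 := hk hkη.1.ne' (by rw [hkabs]; exact hkη.2.trans_le (min_le_left _ _))
  have h2 : k < ‖h‖ / (|C| * |C₁| + 1) := hkη.2.trans_le (min_le_right _ _)
  rw [lt_div_iff₀ (by positivity)] at h2
  rw [hkabs] at h1
  have h3 : |C| * (C₁ * k) ≤ |C| * (|C₁| * k) := by
    have := hkη.1
    gcongr
    exact le_abs_self _
  nlinarith [hkη.1]

end Cayley

/-! ### The characteristic function of the slab -/

section CharacteristicFunctionOfSlab

variable {E : Type*} [NormedAddCommGroup E] [InnerProductSpace ℂ E] [CompleteSpace E]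
  {S B : ℂ → E →L[ℂ] E}

omit [CompleteSpace E] in
theorem IsCayleyTransform.norm_inverse_le (hS : IsCayleyTransform S B) {δ C : ℝ}
    (hlow : ∀ z ∈ closedUpperHalf \ {0}, ‖z‖ ≤ δ →
      IsUnit (1 - B z) ∧ ‖Ring.inverse (1 - B z)‖ ≤ C / ‖z‖) {z : ℂ}
    (hz : z ∈ closedUpperHalf \ {0}) (hzδ : ‖z‖ ≤ δ) :
    IsUnit (cayley (B z)) ∧ ‖Ring.inverse (cayley (B z))‖ ≤ (2 * C + δ) / ‖z‖ := by
  obtain ⟨h1, h2⟩ := hlow z hz hzδ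
  refine ⟨(inverse_cayley (hS.isUnit z hz) h1).1,
    (norm_inverse_cayley_le (hS.isUnit z hz) h1 h2).trans ?_⟩
  have hz0 : 0 < ‖z‖ := norm_pos_iff.2 hz.2
  -- The summand 1 in 2C/‖z‖ + 1 is absorbed as δ/‖z‖, because ‖z‖ ≤ δ.
  rw [le_div_iff₀ hz0, add_mul, mul_assoc, div_mul_cancel₀ _ hz0.ne']
  linarith

theorem IsCayleyTransform.isStrictSpectralSingularity (hS : IsCayleyTransform S B) {δ C : ℝ}
    (hδ : 0 < δ) (hlow : ∀ z ∈ closedUpperHalf \ {0}, ‖z‖ ≤ δ →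
      IsUnit (1 - B z) ∧ ‖Ring.inverse (1 - B z)‖ ≤ C / ‖z‖)
    {h : E} (hh : h ≠ 0) {C₁ : ℝ}
    (hC₁ : ∀ k : ℝ, k ≠ 0 → ‖cayley (B k) h‖ ≤ C₁ * |k|) :
    IsStrictSpectralSingularityOfOrder S 0 1 := by
  have hne : ∀ᵐ k : ℝ, k ≠ 0 := by simp [ae_iff]
  refine ⟨one_pos, not_isProperPoint (A := fun k => cayley (B k))
    (fun k hk => hS.hasBoundaryValue hk) hh hC₁, ⟨δ, hδ, 2 * C + δ, ?_⟩, ⟨h, hh, C₁, ?_⟩⟩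
  · filter_upwards [hne] with k hk hkδ
    have hn : ‖(k : ℂ)‖ = |k| := by rw [Complex.norm_real, Real.norm_eq_abs]
    rw [sub_zero] at hkδ ⊢
    obtain ⟨h1, h2⟩ := hS.norm_inverse_le hlow (ofReal_mem_closedUpperHalf hk)
      (by rw [hn]; exact hkδ.le)
    refine ⟨cayley (B k), hS.hasBoundaryValue hk, h1, ?_⟩
    rwa [hn, div_eq_mul_inv, ← Real.rpow_neg_one] at h2
  · filter_upwards [hne] with k hk
    refine ⟨cayley (B k), hS.hasBoundaryValue hk, ?_⟩
    rw [sub_zero, Real.rpow_one]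
    exact hC₁ k hk

theorem continuous_compress {H : Type*} [NormedAddCommGroup H] [InnerProductSpace ℂ H]
    (K : Submodule ℂ H) [K.HasOrthogonalProjection] : Continuous (compress K) :=
  continuous_const.clm_comp (continuous_id.clm_comp continuous_const)

variable {c : Lp ℝ ∞ (volume : Measure ℝ)} {w : Weight}

variable (c w) in
/-- The part in `E` of the operator with kernel `½ w(x) E₁(-iz|x - y|) w(y)`. -/
def transportKernelOp (z : ℂ) : scatteringSpace c →L[ℂ] scatteringSpace c :=
  compress (scatteringSpace c) (convOp w (transportSymbol z))

theorem continuousOn_transportKernelOp :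
    ContinuousOn (transportKernelOp c w) (closedUpperHalf \ {0}) :=
  (continuous_compress _).comp_continuousOn continuousOn_convOp_transportSymbol

theorem transportKernelOp_spec (hc : ∀ᵐ x : ℝ, 0 ≤ c x) (hw : ∀ᵐ x, w x = √(c x)) {z : ℂ}
    (hz : z ∈ upperHalf) :
    scatteringCharFun c z * (1 + transportKernelOp c w z) = 1 - transportKernelOp c w z ∧
      ∀ u, 0 ≤ (inner ℂ u (transportKernelOp c w z u)).re := by
  obtain ⟨W, hW0, hWW, hW⟩ := exists_sqrt_imaginaryPart hc hw
  obtain ⟨R, hR⟩ := isFullySymmetric_freeTransport.exists_isResolventAt hz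
  have h1 := sandwich_eq_convOp hz hR hW
  rw [transportKernelOp, ← h1]
  refine ⟨characteristicFunction_mul isFullySymmetric_freeTransport hW0 hWW hz hR, fun u => ?_⟩
  rw [inner_compress]
  exact isFullySymmetric_freeTransport.re_inner_sandwich_nonneg hz hR
    (IsSelfAdjoint.of_nonneg hW0) _

/-- On the punctured real axis there is no resolvent to argue with; the sign is inherited by
continuity from the upper half-plane. -/
theorem re_inner_transportKernelOp_nonneg (hc : ∀ᵐ x : ℝ, 0 ≤ c x) (hw : ∀ᵐ x, w x = √(c x))
    {z : ℂ} (hz : z ∈ closedUpperHalf \ {0}) (u : scatteringSpace c) :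
    0 ≤ (inner ℂ u (transportKernelOp c w z u)).re := by
  have hcl : z ∈ closure upperHalf := by
    have : closure {z : ℂ | 0 < z.im} = {z : ℂ | 0 ≤ z.im} := Complex.closure_setOfPred_lt_im 0
    rw [upperHalf, this]
    exact hz.1
  have hlim : Tendsto (transportKernelOp c w) (𝓝[upperHalf] z) (𝓝 (transportKernelOp c w z)) :=
    (continuousOn_transportKernelOp z hz).mono_left
      (nhdsWithin_mono _ fun z hz => mem_closedUpperHalf_of_mem_upperHalf hz)
  have hlim2 : Tendsto (fun z => (inner ℂ u (transportKernelOp c w z u)).re) (𝓝[upperHalf] z)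
      (𝓝 (inner ℂ u (transportKernelOp c w z u)).re) :=
    (Complex.continuous_re.tendsto _).comp ((tendsto_const_nhds (x := u)).inner
      (((ContinuousLinearMap.apply ℂ (scatteringSpace c) u).continuous.tendsto _).comp hlim))
  have := mem_closure_iff_nhdsWithin_neBot.1 hcl
  refine ge_of_tendsto hlim2 ?_
  filter_upwards [self_mem_nhdsWithin] with z' hz'
  exact (transportKernelOp_spec hc hw hz').2 u

theorem isCayleyTransform_scatteringCharFun (hc : ∀ᵐ x : ℝ, 0 ≤ c x) (hw : ∀ᵐ x, w x = √(c x)) :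
    IsCayleyTransform (scatteringCharFun c) (transportKernelOp c w) where
  eq _ hz := (transportKernelOp_spec hc hw hz).1
  isUnit _ hz :=
    (isUnit_one_add_of_re_inner_nonneg (re_inner_transportKernelOp_nonneg hc hw hz)).1
  norm_le _ hz :=
    (isUnit_one_add_of_re_inner_nonneg (re_inner_transportKernelOp_nonneg hc hw hz)).2
  continuousOn := continuousOn_transportKernelOp

/-- The coefficient ¼ is ½ from the symbol times ½ from the rank one operator, whose vector pairing
is taken in the phase space. -/
theorem one_sub_transportKernelOp_apply {z : ℂ} (hz : z ∈ closedUpperHalf)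
    (u : scatteringSpace c) : (1 - transportKernelOp c w z) u =
      u + compress (scatteringSpace c) (logOp w) u +
        ((1 / 4 * Complex.log (-(Complex.I * z))) *
          inner ℂ ((scatteringSpace c).orthogonalProjectionOnto w.vec) u) •
            (scatteringSpace c).orthogonalProjectionOnto w.vec -
        (1 / 2 : ℂ) • compress (scatteringSpace c) (einOp w z) u := by
  have h1 : compress (scatteringSpace c) (convOp w (fun _ => 1)) u =
      (1 / 2 * inner ℂ ((scatteringSpace c).orthogonalProjectionOnto w.vec) u) •
        (scatteringSpace c).orthogonalProjectionOnto w.vec := by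
    change (scatteringSpace c).orthogonalProjectionOnto (convOp w (fun _ => 1) (u : Slab)) = _
    rw [convOp_one_apply, map_smul, Submodule.inner_orthogonalProjectionOnto_eq_of_mem_right]
  rw [transportKernelOp, convOp_transportSymbol hz, compress_add, compress_sub, compress_neg,
    compress_smul, compress_smul]
  change u - (-(compress (scatteringSpace c) (logOp w) u) -
    (1 / 2 * Complex.log (-(Complex.I * z))) •
      (compress (scatteringSpace c) (convOp w (fun _ => 1)) u) +
        (1 / 2 : ℂ) • compress (scatteringSpace c) (einOp w z) u) = _
  rw [h1]
  module

theorem exists_lower_bound_transportKernelOp (hc : ∀ᵐ x : ℝ, 0 ≤ c x)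
    (hw : ∀ᵐ x, w x = √(c x)) :
    ∃ δ : ℝ, 0 < δ ∧ ∃ C : ℝ, 0 < C ∧ ∀ z ∈ closedUpperHalf \ {0}, ‖z‖ ≤ δ →
      IsUnit (1 - transportKernelOp c w z) ∧
        ‖Ring.inverse (1 - transportKernelOp c w z)‖ ≤ C / ‖z‖ := by
  obtain ⟨W, hW0, hWW, hW⟩ := exists_sqrt_imaginaryPart hc hw
  set K := scatteringSpace c
  have hYs : ∀ u v : K, inner ℂ (compress K (logOp w) u) v = inner ℂ u (compress K (logOp w) v) := by
    have hs : ∀ u v : Slab, inner ℂ u (logOp w v) = inner ℂ (logOp w u) v :=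
      inner_convOp_symm isAdmissible_logSymbol fun t => by
        rw [abs_neg]
        have : (1 / 2 * (Real.eulerMascheroniConstant + (Real.log |t| : ℂ)) : ℂ) =
          ((1 / 2 * (Real.eulerMascheroniConstant + Real.log |t|) : ℝ) : ℂ) := by push_cast; rfl
        rw [this, Complex.conj_ofReal]
    intro u v
    rw [← inner_conj_symm, inner_compress, inner_compress, hs u v, inner_conj_symm]
  -- Strict negativity of |x - y| gives √c u = 0, hence Vu = 0, and V is injective on E.
  have hD : ∀ u : K, u ≠ 0 → inner ℂ (K.orthogonalProjectionOnto w.vec) u = 0 →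
      inner ℂ u (compress K (absOp w) u) ≠ 0 := by
    intro u hu h1 h2
    rw [Submodule.inner_orthogonalProjectionOnto_eq_of_mem_right] at h1
    rw [inner_compress] at h2
    have h3 := weight_mul_angleMean_eq_zero h1 h2
    have h4 : W (u : Slab) = 0 := by
      refine (Lp.eq_zero_iff_ae_eq_zero).2 ?_
      filter_upwards [hW u, ae_fst h3] with q a1 a2
      rw [a1]
      exact a2
    have h5 : imaginaryPart c (u : Slab) = 0 := by
      rw [← hWW]
      change W (W u) = 0
      rw [h4, map_zero]
    exact hu (Subtype.ext (eq_zero_of_mem_defectSpace (isSelfAdjoint_imaginaryPart c) u.2 h5))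
  have hG : Tendsto (fun z => z⁻¹ • compress K (einOp w z)) (𝓝[closedUpperHalf \ {0}] 0)
      (𝓝 (-(Complex.I • compress K (absOp w)))) := by
    have h1 := ((continuous_compress K).tendsto _).comp (tendsto_inv_smul_einOp (w := w))
    rw [compress_neg, compress_smul] at h1
    exact h1.congr fun z => compress_smul K _ _
  obtain ⟨δ, hδ, C, hC, h⟩ := exists_lower_bound
    (isCompactOperator_compress (isCompactOperator_convOp isAdmissible_logSymbol)) hYs hD
    (tendsto_norm_log_atTop (a := 1 / 4) (by norm_num)) (tendsto_mul_log (1 / 4)) hG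
  refine ⟨δ, hδ, C, hC, fun z hz hzδ => ?_⟩
  have hz0 : 0 < ‖z‖ := norm_pos_iff.2 hz.2
  have h1 := isUnit_one_sub_of_lower_bound (B := transportKernelOp c w z) (m := ‖z‖ / C)
    (isCompactOperator_compress (isCompactOperator_convOp (isAdmissible_transportSymbol hz.1)))
    (by positivity) (fun u => by
      rw [div_mul_eq_mul_div, div_le_iff₀ hC, one_sub_transportKernelOp_apply hz.1, mul_comm _ C]
      exact h z hz.1 hz.2 hzδ u)
  rwa [one_div_div] at h1

/-- For h in N the equation (I + Y)h = 0 and the condition ⟨h, √c⟩ = 0 remove all terms but -½G(z)h;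
half of the bound 2r‖z‖ for the symbol gives the constant. -/
theorem norm_one_sub_transportKernelOp_apply_le (hw : ∀ᵐ x, w x = √(c x))
    {h : scatteringSpace c} (hh : h ∈ exceptionalVectors c) {z : ℂ} (hz : z ∈ closedUpperHalf) :
    ‖(1 - transportKernelOp c w z) h‖ ≤ w.radius * w.opBound * ‖h‖ * ‖z‖ := by
  obtain ⟨u, -, hu, hY, hmean⟩ := hh
  have hm := angleMean_ae_eq hu
  have h1 : inner ℂ ((scatteringSpace c).orthogonalProjectionOnto w.vec) h = 0 := by
    rw [Submodule.inner_orthogonalProjectionOnto_eq_of_mem_right, inner_vec]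
    have : ∫ x, (w x : ℂ) * angleMean (h : Slab) x = ∫ x, u x * (√(c x) : ℂ) := by
      refine integral_congr_ae ?_
      filter_upwards [hm, hw] with x a1 a2
      rw [a1, a2, mul_comm]
    rw [this, hmean, mul_zero]
  have h2 : (h : Slab) + logOp w h = 0 := by
    refine (Lp.eq_zero_iff_ae_eq_zero).2 ?_
    filter_upwards [Lp.coeFn_add (h : Slab) (logOp w h), hu, ae_fst hY, ae_fst hw,
      coeFn_convOp (isAdmissible_logSymbol (w := w)) (h : Slab)] with q a1 a2 a3 a4 a5
    have a5' : logOp w h q = _ := a5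
    rw [a1, Pi.add_apply, a2, a5', Pi.zero_apply, ← a3, ← integral_const_mul]
    congr 1
    refine integral_congr_ae ?_
    filter_upwards [hm, hw] with y b1 b2
    rw [b1, b2, a4, kernelY]
    push_cast
    ring
  have h3 : h + compress (scatteringSpace c) (logOp w) h = 0 := by
    have h4 := compress_add (scatteringSpace c) 1 (logOp w)
    have h5 := congrArg (fun X : scatteringSpace c →L[ℂ] scatteringSpace c => X h) h4
    rw [compress_one] at h5
    change (scatteringSpace c).orthogonalProjectionOnto ((h : Slab) + logOp w h) = _ at h5
    rw [h2, map_zero] at h5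
    exact h5.symm
  rw [one_sub_transportKernelOp_apply hz, h1, h3, mul_zero, zero_smul, add_zero, zero_sub, norm_neg,
    norm_smul]
  have h6 := ((compress (scatteringSpace c) (einOp w z)).le_opNorm h).trans
    (mul_le_mul_of_nonneg_right ((norm_compress_le _ _).trans (norm_einOp_le hz)) (norm_nonneg h))
  have h7 : ‖(1 / 2 : ℂ)‖ = 1 / 2 := by norm_num
  rw [h7]
  linarith

end CharacteristicFunctionOfSlab

end SlabTransport

end

theorem mainTheorem6 (c : MeasureTheory.Lp ℝ ∞ (volume : Measure ℝ))
    (hc_nonneg : ∀ᵐ x : ℝ, 0 ≤ c x)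
    (hc_supp : ∃ a : ℝ, ∀ᵐ x : ℝ, a < |x| → c x = 0) :
    (∃ δ : ℝ, 0 < δ ∧ ∃ C : ℝ, ∀ z ∈ SlabTransport.halfDisc δ 0,
      IsUnit (SlabTransport.scatteringCharFun c z) ∧
        ‖Ring.inverse (SlabTransport.scatteringCharFun c z)‖ ≤ C / ‖z‖) ∧
    ((∃ h ∈ SlabTransport.exceptionalVectors c, h ≠ 0) →
      SlabTransport.IsStrictSpectralSingularityOfOrder (SlabTransport.scatteringCharFun c) 0 1 ∧
      ∀ h ∈ SlabTransport.exceptionalVectors c, ∃ δ : ℝ, 0 < δ ∧ ∃ C : ℝ, ∀ k : ℝ,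
        0 < |k| → |k| < δ →
          ∃ A : SlabTransport.scatteringSpace c →L[ℂ] SlabTransport.scatteringSpace c,
            SlabTransport.HasBoundaryValue (SlabTransport.scatteringCharFun c) k A ∧
              ‖A h‖ ≤ C * |k|) := by
  obtain ⟨w, hw⟩ := SlabTransport.exists_weight c hc_supp
  have hS := SlabTransport.isCayleyTransform_scatteringCharFun hc_nonneg hw
  obtain ⟨δ, hδ, C, -, hlow⟩ := SlabTransport.exists_lower_bound_transportKernelOp hc_nonneg hw
  have hbound : ∀ h ∈ SlabTransport.exceptionalVectors c, ∀ k : ℝ, k ≠ 0 →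
      ‖SlabTransport.cayley (SlabTransport.transportKernelOp c w k) h‖ ≤
        w.radius * w.opBound * ‖h‖ * |k| := by
    intro h hh k hk
    have hk' := SlabTransport.ofReal_mem_closedUpperHalf hk
    refine (SlabTransport.norm_cayley_apply_le (hS.isUnit k hk') (hS.norm_le k hk') h).trans ?_
    have := SlabTransport.norm_one_sub_transportKernelOp_apply_le hw hh hk'.1
    rwa [Complex.norm_real, Real.norm_eq_abs] at this
  refine ⟨⟨δ, hδ, 2 * C + δ, fun z hz => ?_⟩, ?_⟩
  · have hz' : z ∈ SlabTransport.upperHalf := hz.1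
    rw [hS.eq_cayley hz']
    exact hS.norm_inverse_le hlow (SlabTransport.mem_closedUpperHalf_of_mem_upperHalf hz')
      (by simpa using hz.2)
  · rintro ⟨h, hh, hh0⟩
    -- The estimate on N holds for every real k ≠ 0, so the radius 1 is arbitrary.
    refine ⟨hS.isStrictSpectralSingularity hδ hlow hh0 (hbound h hh), fun h' hh' =>
      ⟨1, one_pos, w.radius * w.opBound * ‖h'‖, fun k hk _ => ?_⟩⟩
    have hk0 : k ≠ 0 := abs_pos.1 hk
    exact ⟨_, hS.hasBoundaryValue hk0, hbound h' hh' k hk0⟩
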